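/- **Conventions.** Let $g\in\mathbb C\{x_1,\dots,x_n\}$ be regular in $x_n$, i.e. $g(0,\dots,0,x_n)\not\equiv 0$. Let $P=x_n^d+\sum_{i=1}^d a_i(x_1,\dots,x_{n-1})x_n^{d-i}$ be its Weierstrass polynomial ($g=u\cdot P$ with $u(0)\neq 0$, $a_i(0)=0$), with roots $\xi_1,\dots,\xi_d$ in $x_n$, listed with multiplicity. For $i\ge 1$ the $i$-th generalized discriminant of $g$ is $$D^i_g=\sum_{r_1<\dots<r_j}\ \prod_{k<l;\ k,l\in\{r_1,\dots,r_j\}}(\xi_k-\xi_l)^2\in\mathbb C\{x_1,\dots,x_{n-1}\},\qquad j=d+1-i .$$ So $D_g:=D^1_g$ is the classical discriminant (equal to $1$ if $d\le 1$). Let $\operatorname{idiscr}(g)$ be the smallest $i$ with $D^i_g\not\equiv 0$. Let $\operatorname{mult}_p$ denote the order of vanishing of an analytic function at $p$. Let $D(x,y,s)$ be an analytic germ at the origin of $\mathbb C^2\times\mathbb C^m$, where $s$ is a parameter. We say that its zero set is an *equisingular family of plane curve singularities* (at the origin of $\mathbb C^2$, with parameter $s$ and projection $(x,y)\mapsto x$)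 if either $D(0)\ne0$, or $D$ is regular in $y$, $D(0,0,s)=0$ for all small $s$, and $\operatorname{mult}_{(0,s)}\big(D^{i_0}_D\big)$, with $i_0=\operatorname{idiscr}(D)$ and $D^{i_0}_D=D^{i_0}_D(x,s)$ formed with respect to $y$, is independent of $s$ for small $s$. Let $V=g^{-1}(0)\subset(\mathbb C^3,0)$ with $g\in\mathbb C\{x,y,z\}$ reduced, $g(0)=0$. For small $b\in\mathbb C$ let $\Delta_b$ be the discriminant locus of the restriction to $V$ of the projection $(x,y,z)\mapsto(x,y-bz)$, i.e. the zero set in the $(x,y)$-plane of the discriminant with respect to $z$ of $g(x,y+bz,z)$. The coordinates $x,y,z$ are *$\nu$-transverse* for $V$ if (1) the $z$-axis is not contained in the tangent cone of $V$ at $0$; (2) the $y$-axis is not contained in the tangent cone of $\Delta_0$ at $0$; (3) the $\Delta_b$, for $b$ near $0$, form an equisingular family of plane curve singularities. In this case the *multiplicity sequence* of $V$ in these coordinates is $$\nu^*(V,0)=\big(\operatorname{mult}_0 g,\ \operatorname{mult}_0 D_g,\ i_0,\ \operatorname{mult}_0 D^{i_0}_{D_g}\big),\qquad i_0=\operatorname{idiscr}(D_g),$$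 where $D_g\in\mathbb C\{x,y\}$ is formed with respect to $z$ and $D^{i_0}_{D_g}\in\mathbb C\{x\}$ with respect to $y$. **Proposition.** Let $f(x,y,z,t)=f_t(x,y,z)\in\mathbb C\{x,y,z,t\}$, $t\in(\mathbb C^l,0)$, with $f_t(0)=0$ and $f_t$ reduced for all $t$ near $0$, and let $V_t=f_t^{-1}(0)\subset(\mathbb C^3,0)$. Assume that the family $V_t$ is $\nu$-transverse Zariski equisingular in the coordinates $x,y,z$, that is, $x,y,z$ are $\nu$-transverse for $V_0$, and the discriminant loci $\Delta_{b,t}$ of the projections $(x,y,z,t)\mapsto(x,y-bz,t)$ (the zero sets of the discriminant with respect to $z$ of $f(x,y+bz,z,t)$) form an equisingular family of plane curve singularities with parameter $(b,t)\in(\mathbb C\times\mathbb C^l,0)$. Then for all $t$ sufficiently close to $0$ the coordinates $x,y,z$ are $\nu$-transverse for $V_t$, and $\nu^*(V_t,0)=\nu^*(V_0,0)$. -/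

import Mathlib

open Filter Topology Polynomial

namespace ZariskiEq

/-- The generalized discriminant (subdiscriminant) `D_i` of a monic polynomial with roots
`ξ 0, …, ξ (d - 1)`, listed with multiplicity: with `j = d + 1 - i`, the sum over all `j`-element
sets of indices of the product of the `(ξ a - ξ b) ^ 2` over the pairs of indices in the set.
For `i = 1` it is the classical discriminant. -/
noncomputable def rootDiscr {d : ℕ} (ξ : Fin d → ℂ) (i : ℕ) : ℂ :=
  ∑ s ∈ Finset.powersetCard (d + 1 - i) (Finset.univ : Finset (Fin d)),
    ∏ a ∈ s, ∏ b ∈ s with a < b, (ξ a - ξ b) ^ 2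

/-- The `i`-th generalized discriminant of a complex monic polynomial. -/
noncomputable def polyDiscr (p : ℂ[X]) (i : ℕ) : ℂ :=
  rootDiscr (fun k => p.roots.toList.get k) i

section Germs

variable {E : Type*} [NormedAddCommGroup E] [NormedSpace ℂ E]

/-- The multiplicity (order) of an analytic function `g` at `p`: the degree of its first
nonvanishing Taylor term at `p`. It is `⊤` if `g` vanishes identically near `p`. -/
noncomputable def mult (g : E → ℂ) (p : E) : ℕ∞ :=
  ⨅ (n : ℕ) (_ : iteratedFDeriv ℂ n g p ≠ 0), (n : ℕ∞)

/-- The germ at `0` of `g` is reduced: no square of a nonunit of the ring of analytic germs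
divides it. (In particular it is not the zero germ.) -/
def IsReducedGerm (g : E → ℂ) : Prop :=
  ∀ a h : E → ℂ, AnalyticAt ℂ a 0 → AnalyticAt ℂ h 0 →
    (∀ᶠ p in 𝓝 0, g p = a p ^ 2 * h p) → a 0 ≠ 0

/-- The analytic germ `g` at `0` is regular in its last variable: `g (0, z)` is not identically
zero near `z = 0`. -/
def RegularInLast (g : E × ℂ → ℂ) : Prop :=
  AnalyticAt ℂ g 0 ∧ ¬ ∀ᶠ z in 𝓝 (0 : ℂ), g (0, z) = 0

/-- `P` is the Weierstrass polynomial (in the last variable) of the germ `g` at `0`: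
`g = u * P` near `0` with `u` an analytic unit, and `P` is monic, with coefficients analytic
at `0`, all of which, except for the leading one, vanish at `0`. -/
def IsWeierstrassPoly (g : E × ℂ → ℂ) (P : E → ℂ[X]) : Prop :=
  ∃ d : ℕ, (∀ x, (P x).Monic ∧ (P x).natDegree = d) ∧ P 0 = X ^ d ∧
    (∀ i, AnalyticAt ℂ (fun x => (P x).coeff i) 0) ∧
    ∃ u : E × ℂ → ℂ, AnalyticAt ℂ u 0 ∧ u 0 ≠ 0 ∧
      ∀ᶠ p in 𝓝 (0 : E × ℂ), g p = u p * (P p.1).eval p.2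

open Classical in
/-- A representative of the Weierstrass polynomial of `g` with respect to the last variable. Its
germ at `0` is uniquely determined, and it exists as soon as `g` is regular in that variable
(the value `1` is used otherwise). -/
noncomputable def weierstrassPoly (g : E × ℂ → ℂ) : E → ℂ[X] :=
  if h : ∃ P, IsWeierstrassPoly g P then h.choose else fun _ => 1

/-- The `i`-th generalized discriminant `D^i_g` of `g` with respect to the last variable. -/
noncomputable def genDiscr (i : ℕ) (g : E × ℂ → ℂ) : E → ℂ :=
  fun x => polyDiscr (weierstrassPoly g x) i

/-- The discriminant `D_g = D^1_g`. -/
noncomputable def stdDiscr (g : E × ℂ → ℂ) : E → ℂ := genDiscr 1 g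

/-- The smallest `i` for which `D^i_g` is not identically zero near `0`. It is at least `1`, as
`genDiscr 0 g` is an empty sum. -/
noncomputable def idiscr (g : E × ℂ → ℂ) : ℕ :=
  sInf {i : ℕ | ¬ ∀ᶠ x in 𝓝 (0 : E), genDiscr i g x = 0}

/-- The first generalized discriminant of `g` that is not identically zero. -/
noncomputable def firstDiscr (g : E × ℂ → ℂ) : E → ℂ := genDiscr (idiscr g) g

/-- The last coordinate axis is transverse at the origin to the zero set of `g`: it is not
contained in the tangent cone. -/
def AxisTransverse (g : E × ℂ → ℂ) : Prop :=
  ((0, 1) : E × ℂ) ∉ tangentConeAt ℂ {p : E × ℂ | g p = 0} 0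

/-- The zero sets at the origin of `(x, y) ↦ D ((s, x), y)` form a family of germs of plane
curves, parameterized by `s` near `0`, that is (Zariski) equisingular for the projection
`(x, y) ↦ x`: either `D` is a unit (all the germs are empty), or `D` is regular in `y`, the
curves pass through the origin, and the first generalized discriminant of `D` that is not
identically zero is equimultiple along `x = 0`. -/
def IsEquisingularCurveFamily (D : (E × ℂ) × ℂ → ℂ) : Prop :=
  D 0 ≠ 0 ∨
    (RegularInLast D ∧ (∀ᶠ s in 𝓝 (0 : E), D ((s, 0), 0) = 0) ∧
      ∀ᶠ s in 𝓝 (0 : E), mult (firstDiscr D) (s, 0) = mult (firstDiscr D) (0, 0))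

end Germs

/-- The function `f (x, y, z, t)` in the coordinates adapted to the projection
`(x, y, z, t) ↦ (x, y - b z, t)`, with `(b, t)` as parameters:
`((((b, t), x), y), z) ↦ f (x, y + b z, z, t)`. -/
def shearFamily {T : Type*} (f : ((ℂ × ℂ) × ℂ) × T → ℂ) :
    (((ℂ × T) × ℂ) × ℂ) × ℂ → ℂ :=
  fun p => f (((p.1.1.2, p.1.2 + p.1.1.1.1 * p.2), p.2), p.1.1.1.2)

/-- The same for a single function `g (x, y, z)`: `(((b, x), y), z) ↦ g (x, y + b z, z)`. -/
def shear (g : (ℂ × ℂ) × ℂ → ℂ) : ((ℂ × ℂ) × ℂ) × ℂ → ℂ :=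
  fun p => g ((p.1.1.2, p.1.2 + p.1.1.1 * p.2), p.2)

/-- The coordinates `((x, y), z)` are nested-uniformly-transverse for the surface `g = 0`:
the `z`-axis is transverse to it, the `y`-axis is transverse to the discriminant locus `Δ_0`,
and the discriminant loci `Δ_b` of the projections `(x, y, z) ↦ (x, y - b z)` form, for small `b`,
an equisingular family of plane curve singularities. -/
def IsNuTransverse (g : (ℂ × ℂ) × ℂ → ℂ) : Prop :=
  AxisTransverse g ∧ AxisTransverse (stdDiscr g) ∧ IsEquisingularCurveFamily (stdDiscr (shear g))

/-- The family of surfaces `V_t = {f (·, t) = 0}` is `ν`-transverse Zariski equisingular: the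
coordinates are `ν`-transverse for `V_0`, and the discriminant loci `Δ_{b,t}` form an equisingular
family of plane curve singularities parameterized by `(b, t)`. -/
def IsNuTransverseZariskiEquisingular {T : Type*} [NormedAddCommGroup T] [NormedSpace ℂ T]
    (f : ((ℂ × ℂ) × ℂ) × T → ℂ) : Prop :=
  IsNuTransverse (fun p => f (p, 0)) ∧ IsEquisingularCurveFamily (stdDiscr (shearFamily f))

/-- The multiplicity sequence of the surface `g = 0` (`g` reduced) in the given coordinates:
`(mult_0 V, mult_0 D_g, i_0, mult_0 D^{i_0}_{D_g})` with `i_0 = idiscr D_g`. -/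
noncomputable def multSeq (g : (ℂ × ℂ) × ℂ → ℂ) : ℕ∞ × ℕ∞ × ℕ × ℕ∞ :=
  (mult g 0, mult (stdDiscr g) 0, idiscr (stdDiscr g), mult (firstDiscr (stdDiscr g)) 0)

end ZariskiEq

/-!
Zariski equisingularity of the discriminants makes a family of surfaces equimultiple, together with
its discriminants.

Write `P` for the Weierstrass polynomial in `z` of the sheared family `f (x, y + b z, z, t)`, with
parameter `s = (b, t)`, and `W` for the Weierstrass polynomial in `y` of its discriminant. Both
satisfy the same principle (`eventually_isBigO_coeff`): if a family of monic polynomials `P (s, x)`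
has a number of distinct roots that does not depend on `s`, for `x` in an open cone, if the roots
for `s = 0` are `O(‖x‖)`, and if `P (s, 0)` has the root `0`, then `P (s, 0) = X ^ d` and the
coefficients of `P (s, ·)` vanish at `x = 0` to the orders of those of a homogeneous polynomial.
Fix `x` and restrict `s` to a complex disc through `0`. As the number of roots is constant, the
roots form a covering of the disc (`isCoveringMap_rootSpace`), which is trivial, so that the roots
are holomorphic functions of the parameter with nowhere vanishing differences. Harnack's inequality
(`norm_sub_root_le`) turns the bound `O(‖x‖)` for the differences at `s = 0` into `O(‖x‖ ^ θ)` for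
small `s`, with `θ < 1` arbitrarily close to `1`. The average of the roots is a coefficient, hence
analytic, and vanishes at `x = 0`; so the roots are themselves `O(‖x‖ ^ θ)`, and as `d θ > d - 1`,
analyticity of the coefficients restores the integral orders.

For `W` the hypothesis on the number of roots comes from equisingularity: the first generalized
discriminant that is not identically zero is `x ^ k` times a unit
(`IsEquisingularCurveFamily.exists_eq_pow_mul`), hence it does not vanish for `x ≠ 0`. It follows
that the roots of `W` satisfy `|y| ≤ C |x|` uniformly in `s` (`exists_norm_root_le_uniform`). Outside
of that cone the discriminant of `P` does not vanish, so `P` has `d` distinct roots there and the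
principle applies to `P` as well.

As the roots of `P` and `W` over the parameter space all vanish, `P` and `W` restrict to the
Weierstrass polynomials of each member of the family (`IsWeierstrassPoly.restrict`), from which the
tangent cones (`IsWeierstrassPoly.axisTransverse_iff`) and the multiplicities
(`IsWeierstrassPoly.mult_eq`, `IsWeierstrassPoly.mult_firstDiscr`) are read off.
-/

namespace ZariskiEq

/-! ### Orders of vanishing -/

section Order

variable {E : Type*} [NormedAddCommGroup E] [NormedSpace ℂ E]

/-- The restriction of an analytic function to a line vanishes to order `n` only if the homogeneous
Taylor terms of degree less than `n` vanish on the direction of that line. -/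
theorem powerSeries_diag_eq_zero_of_line {g : E → ℂ} {ps : FormalMultilinearSeries ℂ E ℂ} {p v : E}
    {n : ℕ} (h : HasFPowerSeriesAt g ps p)
    (hv : (fun c : ℂ => g (p + c • v)) =O[𝓝 0] fun c : ℂ => c ^ n) :
    ∀ m < n, ps m (fun _ => v) = 0 := by
  intro m
  induction m using Nat.strong_induction_on with
  | _ m ih =>
    intro hm
    have hsum : ∀ c : ℂ, ps.partialSum (m + 1) (c • v) = c ^ m * ps m (fun _ => v) := by
      intro c
      rw [FormalMultilinearSeries.partialSum, Finset.sum_range_succ, Finset.sum_eq_zero, zero_add]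
      · simpa using (ps m).map_smul_univ (fun _ => c) (fun _ => v)
      · intro k hk
        have hk' := Finset.mem_range.1 hk
        have := (ps k).map_smul_univ (fun _ => c) (fun _ => v)
        rw [this, ih k hk' (hk'.trans hm), smul_zero]
    have ht : Tendsto (fun c : ℂ => c • v) (𝓝 0) (𝓝 0) := by
      have : Continuous fun c : ℂ => c • v := by fun_prop
      simpa using this.tendsto 0
    have h1 : (fun c : ℂ => g (p + c • v) - c ^ m * ps m (fun _ => v)) =O[𝓝 0]
        fun c : ℂ => c ^ (m + 1) := by
      have := (h.isBigO_sub_partialSum_pow (m + 1)).comp_tendsto ht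
      simp only [Function.comp_def, hsum] at this
      refine this.trans ?_
      refine Asymptotics.IsBigO.of_bound (‖v‖ ^ (m + 1)) (Eventually.of_forall fun c => ?_)
      rw [norm_smul, mul_pow, norm_mul, norm_pow, norm_pow, norm_pow]
      simp [mul_comm]
    have h2 : (fun c : ℂ => g (p + c • v)) =O[𝓝 0] fun c : ℂ => c ^ (m + 1) := by
      refine hv.trans ?_
      obtain ⟨k, rfl⟩ := Nat.exists_eq_add_of_le (Nat.succ_le_of_lt hm)
      simp only [Nat.succ_eq_add_one, pow_add _ (m + 1) k]
      have hb : (fun c : ℂ => c ^ k) =O[𝓝 0] fun _ : ℂ => (1 : ℂ) :=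
        ((continuous_pow k).tendsto (0 : ℂ)).isBigO_one ℂ
      simpa using (Asymptotics.isBigO_refl (fun c : ℂ => c ^ (m + 1)) (𝓝 0)).mul hb
    have h3 : (fun c : ℂ => c ^ m * ps m (fun _ => v)) =O[𝓝 0] fun c : ℂ => c ^ (m + 1) := by
      simpa using h2.sub h1
    obtain ⟨K, hK⟩ := h3.bound
    have h4 : ∀ᶠ c : ℂ in 𝓝[≠] 0, ‖ps m (fun _ => v)‖ ≤ K * ‖c‖ := by
      filter_upwards [hK.filter_mono nhdsWithin_le_nhds, self_mem_nhdsWithin] with c hc hc0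
      have hc0 : 0 < ‖c‖ ^ m := pow_pos (norm_pos_iff.2 hc0) m
      rw [norm_mul, norm_pow, norm_pow, pow_succ] at hc
      have : ‖c‖ ^ m * ‖ps m (fun _ => v)‖ ≤ ‖c‖ ^ m * (K * ‖c‖) := by linarith
      exact le_of_mul_le_mul_left this hc0
    have h5 : Tendsto (fun c : ℂ => K * ‖c‖) (𝓝[≠] 0) (𝓝 0) := by
      have : Continuous fun c : ℂ => K * ‖c‖ := by fun_prop
      simpa using (this.tendsto 0).mono_left nhdsWithin_le_nhds
    have := ge_of_tendsto h5 h4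
    simpa using this

theorem isBigO_of_powerSeries_diag_eq_zero {g : E → ℂ} {ps : FormalMultilinearSeries ℂ E ℂ} {p : E}
    {n : ℕ} (h : HasFPowerSeriesAt g ps p) (h0 : ∀ m < n, ∀ v, ps m (fun _ => v) = 0) :
    (fun y => g (p + y)) =O[𝓝 0] fun y => ‖y‖ ^ n := by
  refine (h.isBigO_sub_partialSum_pow n).congr_left fun y => ?_
  rw [FormalMultilinearSeries.partialSum, Finset.sum_eq_zero, sub_zero]
  exact fun m hm => h0 m (Finset.mem_range.1 hm) y

/-- An analytic function whose restrictions to the lines in an open set of directions vanish to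
order `n` vanishes to order `n`: its homogeneous Taylor terms of lower degree vanish on an open
set. -/
theorem isBigO_of_isBigO_lines {g : E → ℂ} {p : E} {n : ℕ} (hg : AnalyticAt ℂ g p)
    {O : Set E} (hO : IsOpen O) (hne : O.Nonempty)
    (hl : ∀ v ∈ O, (fun c : ℂ => g (p + c • v)) =O[𝓝 0] fun c : ℂ => c ^ n) :
    (fun y => g (p + y)) =O[𝓝 0] fun y => ‖y‖ ^ n := by
  obtain ⟨ps, h⟩ := hg
  refine isBigO_of_powerSeries_diag_eq_zero h fun m hm => ?_
  have han : AnalyticOnNhd ℂ (fun v => ps m (fun _ : Fin m => v)) Set.univ := by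
    intro v _
    exact ((ps m).analyticAt (x := fun _ => v)).comp
      (f := fun w : E => fun _ : Fin m => w)
      (ContinuousLinearMap.analyticAt (ContinuousLinearMap.pi fun _ : Fin m =>
        ContinuousLinearMap.id ℂ E) v)
  obtain ⟨v₀, hv₀⟩ := hne
  have hz : (fun v => ps m (fun _ : Fin m => v)) =ᶠ[𝓝 v₀] 0 := by
    filter_upwards [hO.mem_nhds hv₀] with v hv
    exact powerSeries_diag_eq_zero_of_line h (hl v hv) m hm
  intro v
  exact han.eqOn_zero_of_preconnected_of_eventuallyEq_zero isPreconnected_univ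
    (Set.mem_univ v₀) hz (Set.mem_univ v)

theorem IsBigO.line {g : E → ℂ} {p : E} {n : ℕ}
    (h : (fun y => g (p + y)) =O[𝓝 0] fun y => ‖y‖ ^ n) (v : E) :
    (fun c : ℂ => g (p + c • v)) =O[𝓝 0] fun c : ℂ => c ^ n := by
  have ht : Tendsto (fun c : ℂ => c • v) (𝓝 0) (𝓝 0) := by
    have : Continuous fun c : ℂ => c • v := by fun_prop
    simpa using this.tendsto 0
  refine (h.comp_tendsto ht).trans ?_
  refine Asymptotics.IsBigO.of_bound (‖v‖ ^ n) (Eventually.of_forall fun c => ?_)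
  simp only [Function.comp_apply]
  rw [norm_smul, mul_pow, norm_mul, norm_pow, norm_pow, norm_pow]
  simp [mul_comm]

theorem le_mult_iff_iteratedFDeriv {g : E → ℂ} {p : E} {n : ℕ} :
    (n : ℕ∞) ≤ mult g p ↔ ∀ m < n, iteratedFDeriv ℂ m g p = 0 := by
  simp only [mult, le_iInf_iff, Nat.cast_le]
  constructor
  · intro h m hm
    by_contra hne
    exact absurd (h m hne) (not_le.2 hm)
  · intro h m hne
    by_contra hlt
    exact hne (h m (not_le.1 hlt))

/-- The multiplicity as an order of growth. The terms of a power series are not assumed symmetric,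
so those of low degree vanish on the diagonal only; this suffices for the iterated derivatives. -/
theorem le_mult_iff {g : E → ℂ} {p : E} (hg : AnalyticAt ℂ g p) {n : ℕ} :
    (n : ℕ∞) ≤ mult g p ↔ (fun y => g (p + y)) =O[𝓝 0] fun y => ‖y‖ ^ n := by
  rw [le_mult_iff_iteratedFDeriv]
  obtain ⟨ps, h⟩ := hg
  constructor
  · intro h0
    refine isBigO_of_powerSeries_diag_eq_zero h fun m hm v => ?_
    obtain ⟨r, hr⟩ := h
    have := hr.factorial_smul v m
    rw [h0 m hm] at this
    simpa [Nat.factorial_ne_zero] using this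
  · intro hO m hm
    have h0 : ∀ m < n, ∀ v, ps m (fun _ => v) = 0 := fun m hm v =>
      powerSeries_diag_eq_zero_of_line h (IsBigO.line hO v) m hm
    obtain ⟨r, hr⟩ := h
    -- the terms of degree `< n` vanish on the diagonal, so they can be removed from the series
    let qs : FormalMultilinearSeries ℂ E ℂ := fun k => if k < n then 0 else ps k
    have hq : HasFPowerSeriesOnBall g qs p r := by
      refine ⟨?_, hr.r_pos, fun {y} hy => ?_⟩
      · refine ENNReal.le_of_forall_nnreal_lt fun r' hr' => ?_
        obtain ⟨C, -, hC⟩ := ps.norm_mul_pow_le_of_lt_radius (hr'.trans_le hr.r_le)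
        refine qs.le_radius_of_bound C fun k => ?_
        refine le_trans ?_ (hC k)
        gcongr
        by_cases hk : k < n <;> simp [qs, hk]
      · convert hr.hasSum hy using 2 with k
        by_cases hk : k < n
        · simp [qs, hk, h0 k hk y]
        · simp [qs, hk]
    ext v
    rw [hq.iteratedFDeriv_eq_sum_of_completeSpace v]
    simp [qs, hm]

theorem mult_eq_coe_iff {g : E → ℂ} {p : E} (hg : AnalyticAt ℂ g p) {n : ℕ} :
    mult g p = n ↔ ((fun y => g (p + y)) =O[𝓝 0] fun y => ‖y‖ ^ n) ∧
      ¬ (fun y => g (p + y)) =O[𝓝 0] fun y => ‖y‖ ^ (n + 1) := by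
  rw [← le_mult_iff hg, ← le_mult_iff hg, not_le]
  constructor
  · rintro h
    exact ⟨h.ge, h ▸ by exact_mod_cast Nat.lt_succ_self n⟩
  · rintro ⟨h1, h2⟩
    refine le_antisymm ?_ h1
    push_cast at h2
    exact Order.le_of_lt_add_one h2

theorem eventually_eq_zero_of_mult_eq_top {g : E → ℂ} {p : E} (hg : AnalyticAt ℂ g p)
    (h : mult g p = ⊤) : ∀ᶠ q in 𝓝 p, g q = 0 := by
  have hO : ∀ n : ℕ, (fun y => g (p + y)) =O[𝓝 0] fun y => ‖y‖ ^ n := fun n =>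
    (le_mult_iff hg).1 (h ▸ le_top)
  obtain ⟨ps, r, hr⟩ := hg
  filter_upwards [Metric.eball_mem_nhds p hr.r_pos] with q hq
  have hs := hr.hasSum (y := q - p) (by simpa [edist_eq_enorm_sub] using hq)
  have h0 : ∀ n, ps n (fun _ => q - p) = 0 := fun n =>
    powerSeries_diag_eq_zero_of_line ⟨r, hr⟩ (IsBigO.line (hO (n + 1)) _) n (Nat.lt_succ_self n)
  simp only [h0, add_sub_cancel] at hs
  exact hs.unique hasSum_zero

theorem mult_congr {g g' : E → ℂ} {p : E} (h : g =ᶠ[𝓝 p] g') : mult g p = mult g' p := by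
  simp only [mult, (h.iteratedFDeriv ℂ _).eq_of_nhds]

end Order

/-- The order of vanishing of an analytic function of one variable is an integer. -/
theorem isBigO_pow_of_isBigO_rpow {φ : ℂ → ℂ} (hφ : AnalyticAt ℂ φ 0) {j : ℕ} {q : ℝ}
    (hq : (j : ℝ) - 1 < q) (h : φ =O[𝓝[≠] 0] fun c : ℂ => ‖c‖ ^ q) :
    φ =O[𝓝 0] fun c : ℂ => c ^ j := by
  by_cases hz : ∀ᶠ c in 𝓝 0, φ c = 0
  · exact (Asymptotics.isBigO_zero _ _).congr' (hz.mono fun c hc => hc.symm) EventuallyEq.rfl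
  obtain ⟨n, g, hg, hg0, hgn⟩ := hφ.exists_eventuallyEq_pow_smul_nonzero_iff.2 hz
  simp only [sub_zero, smul_eq_mul] at hgn
  have hjn : j ≤ n := by
    by_contra hlt
    have hlt' : (n : ℝ) + 1 ≤ j := by exact_mod_cast not_le.1 hlt
    obtain ⟨K, hK⟩ := h.bound
    have h1 : ∀ᶠ c : ℂ in 𝓝[≠] 0, ‖g c‖ ≤ K * ‖c‖ ^ (q - n) := by
      filter_upwards [hK, hgn.filter_mono nhdsWithin_le_nhds, self_mem_nhdsWithin] with c hc hc1 hc0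
      have hc0 : 0 < ‖c‖ := norm_pos_iff.2 hc0
      rw [hc1, norm_mul, norm_pow, Real.norm_of_nonneg (by positivity)] at hc
      rw [Real.rpow_sub hc0, Real.rpow_natCast, ← mul_div_assoc, le_div_iff₀ (by positivity)]
      linarith
    have h2 : Tendsto (fun c : ℂ => K * ‖c‖ ^ (q - n)) (𝓝[≠] 0) (𝓝 0) := by
      have hc : ContinuousAt (fun x : ℝ => x ^ (q - n)) 0 :=
        Real.continuousAt_rpow_const _ _ (Or.inr (by linarith))
      have hc' : Tendsto (fun c : ℂ => ‖c‖ ^ (q - n)) (𝓝 0) (𝓝 0) := by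
        have := hc.tendsto.comp (show Tendsto (fun c : ℂ => ‖c‖) (𝓝 0) (𝓝 0) by
          simpa using (continuous_norm (E := ℂ)).tendsto 0)
        simpa [Function.comp_def, Real.zero_rpow (show q - n ≠ 0 by intro h; linarith)] using this
      simpa using (hc'.mono_left nhdsWithin_le_nhds).const_mul K
    have h3 : Tendsto (fun c => ‖g c‖) (𝓝[≠] 0) (𝓝 ‖g 0‖) :=
      (hg.continuousAt.norm).tendsto.mono_left nhdsWithin_le_nhds
    have := le_of_tendsto_of_tendsto h3 h2 h1
    exact hg0 (norm_le_zero_iff.1 this)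
  obtain ⟨k, rfl⟩ := Nat.exists_eq_add_of_le hjn
  have hb : (fun c => c ^ k * g c) =O[𝓝 0] fun _ : ℂ => (1 : ℂ) :=
    (((continuous_pow k).continuousAt.mul hg.continuousAt).tendsto).isBigO_one ℂ
  have := (Asymptotics.isBigO_refl (fun c : ℂ => c ^ j) (𝓝 0)).mul hb
  refine this.congr' ?_ (by simp)
  filter_upwards [hgn] with c hc
  rw [hc, pow_add]; ring

/-- A form of the Schwarz lemma for functions vanishing to order `j`. -/
theorem norm_le_of_isBigO_pow {φ : ℂ → ℂ} {ρ M : ℝ} {j : ℕ}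
    (hd : DifferentiableOn ℂ φ (Metric.ball 0 ρ)) (hM : ∀ c ∈ Metric.ball (0 : ℂ) ρ, ‖φ c‖ ≤ M)
    (hj : φ =O[𝓝 0] fun c : ℂ => c ^ j) {c : ℂ} (hc : c ∈ Metric.ball (0 : ℂ) ρ) :
    ‖φ c‖ ≤ M * (‖c‖ / ρ) ^ j := by
  rcases j with _ | n
  · simpa using hM c hc
  have h0 : φ 0 = 0 := by
    have := hj.eq_zero_imp.self_of_nhds
    exact this (by simp)
  have := Complex.dist_le_mul_div_pow_of_mapsTo_ball_of_isLittleO (f := φ) (c := 0) (n := n)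
    (R₂ := M) hd (fun x hx => by simpa [h0] using hM x hx) ?_ hc
  · simpa [h0] using this
  · simp only [h0, sub_zero]
    refine hj.trans_isLittleO ?_
    have h1 : (fun c : ℂ => c) =o[𝓝 0] fun _ : ℂ => (1 : ℝ) := by
      rw [Asymptotics.isLittleO_one_iff]; exact tendsto_id
    have := (Asymptotics.isBigO_refl (fun c : ℂ => c ^ n) (𝓝 0)).norm_right.mul_isLittleO h1
    simpa [pow_succ] using this

/-! ### Analytic families of functions on a circle -/

section Curry

variable {E : Type*} [NormedAddCommGroup E] [NormedSpace ℂ E]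
variable {K : Type*} [TopologicalSpace K] [CompactSpace K]

/-- The `n`-linear map `q` on `E × ℂ`, applied pointwise on `K` to `E × C(K, ℂ)`. -/
noncomputable def pointwiseMultilinear {n : ℕ} (K : Type*) [TopologicalSpace K] [CompactSpace K]
    (q : (E × ℂ) [×n]→L[ℂ] ℂ) : (E × C(K, ℂ)) [×n]→L[ℂ] C(K, ℂ) :=
  MultilinearMap.mkContinuous
    { toFun := fun v => ⟨fun ζ => q fun i => ((v i).1, (v i).2 ζ), by fun_prop⟩
      map_update_add' := fun v i x y => by
        ext ζ
        have := (q.compContinuousLinearMap fun _ => (ContinuousLinearMap.id ℂ E).prodMap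
          (ContinuousMap.evalCLM ℂ ζ)).map_update_add v i x y
        exact this
      map_update_smul' := fun v i c x => by
        ext ζ
        have := (q.compContinuousLinearMap fun _ => (ContinuousLinearMap.id ℂ E).prodMap
          (ContinuousMap.evalCLM ℂ ζ)).map_update_smul v i c x
        exact this } ‖q‖ fun v => by
      refine (ContinuousMap.norm_le _ (by positivity)).2 fun ζ => ?_
      refine (q.le_opNorm _).trans ?_
      gcongr with i
      exact max_le_max le_rfl ((v i).2.norm_coe_le_norm ζ)

theorem norm_pointwiseMultilinear_le {n : ℕ} (q : (E × ℂ) [×n]→L[ℂ] ℂ) :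
    ‖pointwiseMultilinear K q‖ ≤ ‖q‖ :=
  MultilinearMap.mkContinuous_norm_le _ (norm_nonneg _) _

/-- A function analytic at the origin of `E × ℂ` gives an analytic map from `E` to the Banach
algebra of continuous functions on any small circle: its power series makes sense over that
algebra. -/
theorem exists_analyticAt_curry {F : E × ℂ → ℂ} (hF : AnalyticAt ℂ F 0) :
    ∃ ρ₀ > 0, ∀ ρ, 0 < ρ → ρ < ρ₀ → ∃ Φ : E → C(Metric.sphere (0 : ℂ) ρ, ℂ),
      AnalyticAt ℂ Φ 0 ∧ ∀ᶠ w in 𝓝 0, ∀ ζ, Φ w ζ = F (w, ζ) := by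
  obtain ⟨ps, r, hr⟩ := hF
  obtain ⟨ρ₀, hρ₀, hρr⟩ : ∃ ρ₀ : NNReal, 0 < ρ₀ ∧ (ρ₀ : ENNReal) < r := by
    obtain ⟨a, ha, har⟩ := ENNReal.lt_iff_exists_nnreal_btwn.1 hr.r_pos
    exact ⟨a, by exact_mod_cast ha, har⟩
  refine ⟨ρ₀, hρ₀, fun ρ hρ hρρ₀ => ?_⟩
  let K := Metric.sphere (0 : ℂ) ρ
  let qs : FormalMultilinearSeries ℂ (E × C(K, ℂ)) C(K, ℂ) := fun n => pointwiseMultilinear K (ps n)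
  have hrad : ps.radius ≤ qs.radius :=
    FormalMultilinearSeries.radius_le_of_le fun {n} => norm_pointwiseMultilinear_le _
  have hpos : 0 < qs.radius := hr.r_pos.trans_le (hr.r_le.trans hrad)
  have hq := qs.hasFPowerSeriesOnBall hpos
  let ι : C(K, ℂ) := ⟨Subtype.val, continuous_subtype_val⟩
  have hι : ‖ι‖ ≤ ρ := (ContinuousMap.norm_le _ hρ.le).2 fun ζ => by
    exact (mem_sphere_zero_iff_norm.1 ζ.2).le
  have hball : ∀ {w : E}, ‖w‖ < ρ₀ → ((w, ι) : E × C(K, ℂ)) ∈ Metric.eball 0 qs.radius := by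
    intro w hw
    rw [Metric.mem_eball, edist_zero_right]
    refine lt_of_lt_of_le ?_ (hρr.le.trans (hr.r_le.trans hrad))
    rw [enorm_eq_nnnorm, ENNReal.coe_lt_coe, ← NNReal.coe_lt_coe, coe_nnnorm, Prod.norm_def]
    exact max_lt hw (hι.trans_lt hρρ₀)
  refine ⟨fun w => qs.sum (w, ι), ?_, ?_⟩
  · have h1 : AnalyticAt ℂ qs.sum (0, ι) := hq.analyticAt_of_mem (hball (by simpa using hρ₀))
    exact h1.comp (f := fun w : E => (w, ι)) (analyticAt_id.prod analyticAt_const)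
  · filter_upwards [Metric.ball_mem_nhds (0 : E) (NNReal.coe_pos.2 hρ₀)] with w hw ζ
    have hw : ‖w‖ < ρ₀ := by simpa using hw
    have h1 := (hq.hasSum (hball hw)).mapL (ContinuousMap.evalCLM ℂ ζ)
    have h2 := hr.hasSum (y := ((w, (ζ : ℂ)) : E × ℂ)) (by
      rw [Metric.mem_eball, edist_zero_right]
      refine lt_trans ?_ hρr
      rw [enorm_eq_nnnorm, ENNReal.coe_lt_coe, ← NNReal.coe_lt_coe, coe_nnnorm, Prod.norm_def]
      exact max_lt hw (by simpa [mem_sphere_zero_iff_norm.1 ζ.2] using hρρ₀))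
    rw [zero_add] at h1 h2
    exact h1.unique h2

omit [CompactSpace K] in
theorem ringInverse_apply {φ : C(K, ℂ)} (h : IsUnit φ) (ζ : K) :
    (Ring.inverse φ) ζ = (φ ζ)⁻¹ := by
  have := congrArg (fun ψ : C(K, ℂ) => ψ ζ) (Ring.inverse_mul_cancel φ h)
  exact eq_inv_of_mul_eq_one_left (by simpa using this)

theorem analyticAt_ringInverse {Φ : E → C(K, ℂ)} {w : E} (hΦ : AnalyticAt ℂ Φ w)
    (h : IsUnit (Φ w)) : AnalyticAt ℂ (fun w => Ring.inverse (Φ w)) w :=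
  (analyticOnNhd_inverse (𝕜 := ℂ) (A := C(K, ℂ)) (Φ w) h).comp hΦ

end Curry

/-- Integration over the circle of radius `ρ`, as a functional on the continuous functions. -/
noncomputable def circleCLM (ρ : ℝ) (hρ : 0 ≤ ρ) : C(Metric.sphere (0 : ℂ) ρ, ℂ) →L[ℂ] ℂ :=
  LinearMap.mkContinuous
    { toFun := fun φ => ∫ θ in (0 : ℝ)..2 * Real.pi,
        deriv (circleMap 0 ρ) θ • φ ⟨circleMap 0 ρ θ, circleMap_mem_sphere 0 hρ θ⟩
      map_add' := fun φ ψ => by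
        rw [← intervalIntegral.integral_add]
        · simp [mul_add]
        all_goals
          refine Continuous.intervalIntegrable ?_ _ _
          simp only [deriv_circleMap]
          fun_prop
      map_smul' := fun c φ => by
        simp only [RingHom.id_apply]
        rw [← intervalIntegral.integral_smul]
        congr 1
        ext θ
        simp
        ring } (ρ * |2 * Real.pi - 0|) fun φ => by
      refine (intervalIntegral.norm_integral_le_of_norm_le_const (C := ρ * ‖φ‖) ?_).trans
        (le_of_eq (by ring))
      intro θ _
      rw [norm_smul]
      gcongr
      · simp [abs_of_nonneg hρ]
      · exact φ.norm_coe_le_norm _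

theorem circleCLM_apply {ρ : ℝ} (hρ : 0 ≤ ρ) {φ : C(Metric.sphere (0 : ℂ) ρ, ℂ)} {f : ℂ → ℂ}
    (h : ∀ ζ, φ ζ = f ζ) : circleCLM ρ hρ φ = ∮ ζ in C(0, ρ), f ζ := by
  change (∫ θ in (0 : ℝ)..2 * Real.pi,
    deriv (circleMap 0 ρ) θ • φ ⟨circleMap 0 ρ θ, circleMap_mem_sphere 0 hρ θ⟩) = _
  simp only [h]
  rfl

section Cauchy

variable {E : Type*} [NormedAddCommGroup E] [NormedSpace ℂ E]

/-- The inclusion of the circle in `ℂ`. -/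
def circleInclusion (ρ : ℝ) : C(Metric.sphere (0 : ℂ) ρ, ℂ) := ⟨Subtype.val, continuous_subtype_val⟩

theorem isUnit_circleInclusion_sub {ρ : ℝ} {z : ℂ} (hz : ‖z‖ < ρ) :
    IsUnit (circleInclusion ρ - z • 1) := by
  rw [ContinuousMap.isUnit_iff_forall_ne_zero]
  intro ζ h
  have : (ζ : ℂ) = z := by simpa [circleInclusion, sub_eq_zero] using h
  have h2 := mem_sphere_zero_iff_norm.1 ζ.2
  rw [this] at h2
  exact absurd h2 hz.ne

/-- The Cauchy integral of an analytic family of functions on a circle is jointly analytic. -/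
theorem exists_analyticAt_cauchy {ρ : ℝ} (hρ : 0 < ρ) {Φ : E → C(Metric.sphere (0 : ℂ) ρ, ℂ)}
    (hΦ : AnalyticAt ℂ Φ 0) : ∃ V : E × ℂ → ℂ, AnalyticAt ℂ V 0 ∧
      ∀ w, ∀ f : ℂ → ℂ, (∀ ζ, Φ w ζ = f ζ) → ∀ z, ‖z‖ < ρ →
        V (w, z) = (2 * Real.pi * Complex.I)⁻¹ • ∮ ζ in C(0, ρ), (ζ - z)⁻¹ • f ζ := by
  refine ⟨fun q => (2 * Real.pi * Complex.I)⁻¹ •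
    circleCLM ρ hρ.le (Ring.inverse (circleInclusion ρ - q.2 • 1) * Φ q.1), ?_, ?_⟩
  · have h1 : AnalyticAt ℂ (fun q : E × ℂ => Ring.inverse (circleInclusion ρ - q.2 • 1)) 0 := by
      refine analyticAt_ringInverse ?_ (isUnit_circleInclusion_sub (by simpa using hρ))
      have h : AnalyticAt ℂ (fun q : E × ℂ =>
          ((ContinuousLinearMap.snd ℂ E ℂ).smulRight (1 : C(Metric.sphere (0 : ℂ) ρ, ℂ))) q) 0 :=
        ContinuousLinearMap.analyticAt _ _
      exact analyticAt_const.sub h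
    have h2 : AnalyticAt ℂ (fun q : E × ℂ => Φ q.1) 0 :=
      AnalyticAt.comp (g := Φ) (f := Prod.fst) (by simpa using hΦ) analyticAt_fst
    exact analyticAt_const.mul (((circleCLM ρ hρ.le).analyticAt _).comp
      (f := fun q : E × ℂ => Ring.inverse (circleInclusion ρ - q.2 • 1) * Φ q.1) (h1.mul h2))
  · intro w f hf z hz
    have h := circleCLM_apply hρ.le (f := fun ζ => (ζ - z)⁻¹ • f ζ)
      (φ := Ring.inverse (circleInclusion ρ - z • 1) * Φ w) fun ζ => by
        rw [ContinuousMap.mul_apply, ringInverse_apply (isUnit_circleInclusion_sub hz), hf]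
        simp [circleInclusion]
    rw [← h]

/-- Division by the last variable: the quotient is the Cauchy integral of `G (s, ζ) / ζ`, hence
analytic in all the variables. -/
theorem exists_eq_mul_of_zero {G : E × ℂ → ℂ} (hG : AnalyticAt ℂ G 0)
    (h0 : ∀ᶠ s in 𝓝 (0 : E), G (s, 0) = 0) :
    ∃ V : E × ℂ → ℂ, AnalyticAt ℂ V 0 ∧ ∀ᶠ q in 𝓝 (0 : E × ℂ), G q = q.2 * V q := by
  obtain ⟨ρ₀, hρ₀, H⟩ := exists_analyticAt_curry hG
  obtain ⟨R, hR, hRan⟩ : ∃ R > 0, ∀ q ∈ Metric.ball (0 : E × ℂ) R, AnalyticAt ℂ G q := by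
    simpa using Metric.eventually_nhds_iff_ball.1 hG.eventually_analyticAt
  obtain ⟨ρ, hρ, hρlt⟩ := exists_between (lt_min hρ₀ hR)
  obtain ⟨Φ, hΦ, hΦG⟩ := H ρ hρ (hρlt.trans_le (min_le_left _ _))
  have hunit : IsUnit (circleInclusion ρ) := by
    simpa using isUnit_circleInclusion_sub (z := 0) (by simpa using hρ)
  obtain ⟨V, hV, hVf⟩ := exists_analyticAt_cauchy hρ
    (hΦ.mul (analyticAt_const (v := Ring.inverse (circleInclusion ρ))))
  refine ⟨V, hV, ?_⟩
  have hs : ∀ᶠ q in 𝓝 (0 : E × ℂ), ‖q.1‖ < R ∧ (∀ ζ, Φ q.1 ζ = G (q.1, ζ)) ∧ G (q.1, 0) = 0 := by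
    have h1 : ∀ᶠ s in 𝓝 (0 : E), ‖s‖ < R ∧ (∀ ζ, Φ s ζ = G (s, ζ)) ∧ G (s, 0) = 0 := by
      filter_upwards [Metric.ball_mem_nhds (0 : E) hR, hΦG, h0] with s a b c
      exact ⟨by simpa using a, b, c⟩
    exact (continuous_fst.tendsto' (0 : E × ℂ) 0 rfl).eventually h1
  have hz : ∀ᶠ q in 𝓝 (0 : E × ℂ), ‖q.2‖ < ρ :=
    (continuous_snd.norm.tendsto' (0 : E × ℂ) 0 (by simp)).eventually (gt_mem_nhds hρ)
  filter_upwards [hs, hz] with ⟨s, x⟩ ⟨hs1, hs2, hs3⟩ hx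
  simp only at hs1 hs2 hs3 hx
  have hd : DifferentiableOn ℂ (fun ζ => G (s, ζ)) (Metric.closedBall 0 ρ) := by
    intro ζ hζ
    have hmem : ((s, ζ) : E × ℂ) ∈ Metric.ball (0 : E × ℂ) R := by
      rw [mem_ball_zero_iff, Prod.norm_def]
      exact max_lt hs1 ((mem_closedBall_zero_iff.1 hζ).trans_lt (hρlt.trans_le (min_le_right _ _)))
    exact ((hRan _ hmem).differentiableAt.comp ζ
      ((differentiableAt_const s).prodMk differentiableAt_id)).differentiableWithinAt
  have hslope : DifferentiableOn ℂ (dslope (fun ζ => G (s, ζ)) 0) (Metric.closedBall 0 ρ) :=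
    (Complex.differentiableOn_dslope (Metric.closedBall_mem_nhds 0 hρ)).2 hd
  have hC := (hslope.diffContOnCl_ball subset_rfl).two_pi_i_inv_smul_circleIntegral_sub_inv_smul
    (w := x) (by simpa using hx)
  have hval := hVf s (dslope (fun ζ => G (s, ζ)) 0) (fun ζ => by
    have hne : (ζ : ℂ) ≠ 0 := by
      intro h; have := mem_sphere_zero_iff_norm.1 ζ.2; rw [h, norm_zero] at this; exact hρ.ne this
    rw [Pi.mul_apply, ContinuousMap.mul_apply, ringInverse_apply hunit, hs2, dslope_of_ne _ hne, slope_def_field,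
      hs3]
    simp [circleInclusion, div_eq_mul_inv]) x hx
  rw [hC] at hval
  rw [hval]
  have := sub_smul_dslope (fun ζ => G (s, ζ)) 0 x
  simp only [hs3, sub_zero, smul_eq_mul] at this
  exact this.symm

/-- Division by a power of the last variable. -/
theorem exists_eq_pow_mul {k : ℕ} : ∀ {G : E × ℂ → ℂ}, AnalyticAt ℂ G 0 →
    (∀ᶠ s in 𝓝 (0 : E), (fun x : ℂ => G (s, x)) =O[𝓝 0] fun x : ℂ => x ^ k) →
    ∃ V : E × ℂ → ℂ, AnalyticAt ℂ V 0 ∧ ∀ᶠ q in 𝓝 (0 : E × ℂ), G q = q.2 ^ k * V q := by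
  induction k with
  | zero => exact fun {G} hG _ => ⟨G, hG, by simp⟩
  | succ k ih =>
    intro G hG hO
    obtain ⟨V, hV, hGV⟩ := exists_eq_mul_of_zero hG (by
      filter_upwards [hO] with s hs
      exact hs.eq_zero_imp.self_of_nhds (by simp))
    have hO' : ∀ᶠ s in 𝓝 (0 : E), (fun x : ℂ => V (s, x)) =O[𝓝 0] fun x : ℂ => x ^ k := by
      have h1 : ∀ᶠ s in 𝓝 (0 : E), AnalyticAt ℂ V (s, 0) ∧
          ∀ᶠ q in 𝓝 ((s, 0) : E × ℂ), G q = q.2 * V q :=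
        ((continuous_id.prodMk continuous_const).tendsto' (0 : E) ((0, 0) : E × ℂ) rfl).eventually
          (hV.eventually_analyticAt.and hGV.eventually_nhds)
      filter_upwards [hO, h1] with s hs ⟨hVs, hGs⟩
      have hcont : Tendsto (fun x : ℂ => ((s, x) : E × ℂ)) (𝓝 0) (𝓝 (s, 0)) :=
        (continuous_const.prodMk continuous_id).tendsto' _ _ rfl
      have hVx : AnalyticAt ℂ (fun x : ℂ => V (s, x)) 0 :=
        AnalyticAt.comp (g := V) (f := fun x : ℂ => (s, x)) hVs
          (analyticAt_const.prod analyticAt_id)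
      refine isBigO_pow_of_isBigO_rpow (q := k) hVx (by linarith) ?_
      obtain ⟨M, hM⟩ := hs.bound
      refine Asymptotics.IsBigO.of_bound M ?_
      filter_upwards [hM.filter_mono nhdsWithin_le_nhds,
        (hcont.eventually hGs).filter_mono nhdsWithin_le_nhds, self_mem_nhdsWithin] with x h1 h2 h3
      have hx : 0 < ‖x‖ := norm_pos_iff.2 h3
      rw [h2, norm_mul, norm_pow, pow_succ] at h1
      rw [Real.rpow_natCast, Real.norm_of_nonneg (by positivity)]
      have : ‖x‖ * ‖V (s, x)‖ ≤ ‖x‖ * (M * ‖x‖ ^ k) := by linarith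
      exact le_of_mul_le_mul_left this hx
    obtain ⟨W, hW, hVW⟩ := ih hV hO'
    refine ⟨W, hW, ?_⟩
    filter_upwards [hGV, hVW] with q h1 h2
    rw [h1, h2, pow_succ]
    ring

end Cauchy

/-! ### Symmetric functions of roots -/

section Symmetric

variable {E : Type*} [NormedAddCommGroup E] [NormedSpace ℂ E] {d : ℕ} {p : E}

/-- Newton's identities: if the power sums of a tuple depend analytically on a parameter, so do its
elementary symmetric functions (the tuple itself need not even be continuous). -/
theorem analyticAt_esymm_of_psum {ξ : E → Fin d → ℂ}
    (h : ∀ k : ℕ, AnalyticAt ℂ (fun w => ∑ i, ξ w i ^ k) p) (k : ℕ) :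
    AnalyticAt ℂ (fun w => MvPolynomial.aeval (ξ w) (MvPolynomial.esymm (Fin d) ℂ k)) p := by
  induction k using Nat.strong_induction_on with
  | _ k ih =>
    rcases Nat.eq_zero_or_pos k with rfl | hk
    · simpa using analyticAt_const
    have hrec : ∀ w, MvPolynomial.aeval (ξ w) (MvPolynomial.esymm (Fin d) ℂ k) =
        (k : ℂ)⁻¹ * ((-1) ^ (k + 1) * ∑ a ∈ Finset.HasAntidiagonal.antidiagonal k with a.1 < k, (-1) ^ a.1 *
          MvPolynomial.aeval (ξ w) (MvPolynomial.esymm (Fin d) ℂ a.1) * ∑ i, ξ w i ^ a.2) := by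
      intro w
      have := congrArg (MvPolynomial.aeval (ξ w)) (MvPolynomial.mul_esymm_eq_sum (Fin d) ℂ k)
      simp only [map_mul, map_natCast, map_pow, map_neg, map_one, map_sum, MvPolynomial.psum,
        MvPolynomial.aeval_X] at this
      rw [← this, inv_mul_cancel_left₀ (Nat.cast_ne_zero.2 hk.ne')]
    simp only [hrec]
    refine analyticAt_const.mul (analyticAt_const.mul ?_)
    refine Finset.analyticAt_fun_sum _ fun a ha => ?_
    exact (analyticAt_const.mul (ih a.1 (Finset.mem_filter.1 ha).2)).mul (h a.2)

theorem coeff_prod_X_sub_C (ξ : Fin d → ℂ) {k : ℕ} (hk : k ≤ d) :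
    (∏ i, (X - C (ξ i))).coeff k =
      (-1) ^ (d - k) * MvPolynomial.aeval ξ (MvPolynomial.esymm (Fin d) ℂ (d - k)) := by
  rw [MvPolynomial.aeval_esymm_eq_multiset_esymm]
  have := Multiset.prod_X_sub_C_coeff (Multiset.map ξ Finset.univ.val) (k := k) (by simpa using hk)
  rw [Multiset.map_map] at this
  simpa [Finset.prod] using this

theorem analyticAt_coeff_of_psum {ξ : E → Fin d → ℂ}
    (h : ∀ k : ℕ, AnalyticAt ℂ (fun w => ∑ i, ξ w i ^ k) p) (k : ℕ) :
    AnalyticAt ℂ (fun w => (∏ i, (X - C (ξ w i))).coeff k) p := by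
  rcases le_or_gt k d with hk | hk
  · simp only [coeff_prod_X_sub_C _ hk]
    exact analyticAt_const.mul (analyticAt_esymm_of_psum h _)
  · have h0 : ∀ w, (∏ i, (X - C (ξ w i))).coeff k = 0 := fun w => by
      refine coeff_eq_zero_of_natDegree_lt ?_
      rw [natDegree_prod_of_monic _ _ fun i _ => monic_X_sub_C (ξ w i)]
      simpa using hk
    simpa only [h0] using analyticAt_const

/-- The fundamental theorem of symmetric functions: a symmetric polynomial in the roots of a
polynomial with analytic coefficients is analytic. -/
theorem analyticAt_aeval_symmetric {ξ : E → Fin d → ℂ}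
    (h : ∀ k : ℕ, AnalyticAt ℂ (fun w => (∏ i, (X - C (ξ w i))).coeff k) p)
    {φ : MvPolynomial (Fin d) ℂ} (hφ : φ.IsSymmetric) :
    AnalyticAt ℂ (fun w => MvPolynomial.aeval (ξ w) φ) p := by
  obtain ⟨ψ, hψ⟩ := MvPolynomial.esymmAlgHom_surjective (σ := Fin d) (n := d) ℂ (by simp) ⟨φ, hφ⟩
  have hφψ : φ = MvPolynomial.aeval (fun i : Fin d => MvPolynomial.esymm (Fin d) ℂ (i + 1)) ψ := by
    rw [← MvPolynomial.esymmAlgHom_apply, hψ]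
  have hval : ∀ w, MvPolynomial.aeval (ξ w) φ = MvPolynomial.aeval (fun i : Fin d =>
      MvPolynomial.aeval (ξ w) (MvPolynomial.esymm (Fin d) ℂ (i + 1))) ψ := by
    intro w
    rw [hφψ, ← MvPolynomial.comp_aeval_apply]
  simp only [hval]
  refine AnalyticAt.aeval_mvPolynomial (fun i => ?_) ψ
  have hi : d - (i + 1) ≤ d := Nat.sub_le _ _
  have hi' : d - (d - (i + 1 : ℕ)) = i + 1 := by have := i.2; omega
  have hc : ∀ w, MvPolynomial.aeval (ξ w) (MvPolynomial.esymm (Fin d) ℂ (i + 1)) =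
      (-1) ^ (i + 1 : ℕ) * (∏ i, (X - C (ξ w i))).coeff (d - (i + 1)) := by
    intro w
    rw [coeff_prod_X_sub_C _ hi, hi', ← mul_assoc, ← mul_pow]
    simp
  simp only [hc]
  exact analyticAt_const.mul (h _)

end Symmetric

/-! ### The Weierstrass preparation theorem -/

/-- A function analytic on a closed disc, without zeros on the boundary, is the product of finitely
many linear factors and a function without zeros. -/
theorem exists_factorization {ρ : ℝ} (hρ : 0 < ρ) {h : ℂ → ℂ}
    (hh : AnalyticOnNhd ℂ h (Metric.closedBall 0 ρ)) (hne : ∀ z, ‖z‖ = ρ → h z ≠ 0) :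
    ∃ s : Multiset ℂ, (∀ a ∈ s, ‖a‖ < ρ) ∧ ∃ v : ℂ → ℂ,
      AnalyticOnNhd ℂ v (Metric.closedBall 0 ρ) ∧ (∀ z ∈ Metric.closedBall 0 ρ, v z ≠ 0) ∧
      ∀ z ∈ Metric.closedBall 0 ρ, h =ᶠ[𝓝 z] fun z => (s.map fun a => z - a).prod * v z := by
  have hpre : IsPreconnected (Metric.closedBall (0 : ℂ) ρ) :=
    (convex_closedBall 0 ρ).isPreconnected
  have hiso : ∀ h : ℂ → ℂ, AnalyticOnNhd ℂ h (Metric.closedBall 0 ρ) →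
      (∀ z, ‖z‖ = ρ → h z ≠ 0) → ∀ a ∈ Metric.closedBall (0 : ℂ) ρ,
      ¬ ∃ᶠ z in 𝓝[≠] a, h z = 0 := by
    intro h hh hne a ha hfr
    have := hh.eqOn_zero_of_preconnected_of_frequently_eq_zero hpre ha hfr
    refine hne (ρ : ℂ) (by simp [hρ.le]) (this (by simp [abs_of_pos hρ]))
  have hfin : {z ∈ Metric.closedBall (0 : ℂ) ρ | h z = 0}.Finite := by
    by_contra hinf
    obtain ⟨a, ha, hacc⟩ := Set.Infinite.exists_accPt_of_subset_isCompact hinf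
      (isCompact_closedBall (0 : ℂ) ρ) (Set.sep_subset _ _)
    rw [accPt_iff_frequently_nhdsNE] at hacc
    exact hiso h hh hne a ha (hacc.mono fun z hz => hz.2)
  obtain ⟨n, hn⟩ : ∃ n, {z ∈ Metric.closedBall (0 : ℂ) ρ | h z = 0}.ncard = n := ⟨_, rfl⟩
  induction n generalizing h with
  | zero =>
    refine ⟨0, by simp, h, hh, fun z hz h0 => ?_, fun z _ => by simp⟩
    rw [Set.ncard_eq_zero hfin] at hn
    exact Set.eq_empty_iff_forall_notMem.1 hn z ⟨hz, h0⟩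
  | succ n ih =>
    obtain ⟨a, ha⟩ : {z ∈ Metric.closedBall (0 : ℂ) ρ | h z = 0}.Nonempty := by
      rw [← Set.ncard_pos hfin]; omega
    have haρ : ‖a‖ < ρ := lt_of_le_of_ne (mem_closedBall_zero_iff.1 ha.1) fun h1 => hne a h1 ha.2
    have hnz : ¬ ∀ᶠ z in 𝓝 a, h z = 0 := fun h0 =>
      hiso h hh hne a ha.1 (h0.filter_mono nhdsWithin_le_nhds).frequently
    obtain ⟨m, g, hg, hga, hgm⟩ := (hh a ha.1).exists_eventuallyEq_pow_smul_nonzero_iff.2 hnz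
    let h₁ : ℂ → ℂ := Function.update (fun z => h z / (z - a) ^ m) a (g a)
    have hh₁ : ∀ z, h z = (z - a) ^ m * h₁ z := by
      intro z
      by_cases hz : z = a
      · subst hz
        simpa [h₁] using hgm.self_of_nhds
      · have : (z - a) ^ m ≠ 0 := pow_ne_zero _ (sub_ne_zero.2 hz)
        simp only [h₁, Function.update_of_ne hz]
        field_simp
    have h₁a : h₁ =ᶠ[𝓝 a] g := by
      filter_upwards [hgm] with z hz
      by_cases hza : z = a
      · simp [h₁, hza]
      · have : (z - a) ^ m ≠ 0 := pow_ne_zero _ (sub_ne_zero.2 hza)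
        simp only [h₁, Function.update_of_ne hza, hz, smul_eq_mul]
        field_simp
    have han : AnalyticOnNhd ℂ h₁ (Metric.closedBall 0 ρ) := by
      intro z hz
      by_cases hza : z = a
      · subst hza
        exact hg.congr h₁a.symm
      · have h2 : AnalyticAt ℂ (fun z => h z / (z - a) ^ m) z :=
          (hh z hz).div ((analyticAt_id.sub analyticAt_const).pow m)
            (pow_ne_zero _ (sub_ne_zero.2 hza))
        refine h2.congr ?_
        filter_upwards [isOpen_ne.mem_nhds hza] with y hy
        simp [h₁, Function.update_of_ne hy]
    have hz₁ : {z ∈ Metric.closedBall (0 : ℂ) ρ | h₁ z = 0} =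
        {z ∈ Metric.closedBall (0 : ℂ) ρ | h z = 0} \ {a} := by
      ext z
      simp only [Set.mem_ofPred_eq, Set.mem_sdiff, Set.mem_singleton_iff]
      constructor
      · rintro ⟨h1, h2⟩
        refine ⟨⟨h1, by rw [hh₁, h2, mul_zero]⟩, ?_⟩
        rintro rfl
        exact hga (by simpa [h₁] using h2)
      · rintro ⟨⟨h1, h2⟩, h3⟩
        rw [hh₁] at h2
        exact ⟨h1, (mul_eq_zero.1 h2).resolve_left (pow_ne_zero _ (sub_ne_zero.2 h3))⟩
    obtain ⟨s, hs, v, hv, hv0, hsv⟩ := ih han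
      (fun z hz h0 => hne z hz (by rw [hh₁, h0, mul_zero])) (hz₁ ▸ hfin.sdiff)
      (by rw [hz₁, Set.ncard_sdiff_singleton_of_mem ha, hn]; rfl)
    refine ⟨Multiset.replicate m a + s, ?_, v, hv, hv0, ?_⟩
    · intro b hb
      rcases Multiset.mem_add.1 hb with hb | hb
      · rw [Multiset.eq_of_mem_replicate hb]; exact haρ
      · exact hs b hb
    · intro z hz
      filter_upwards [hsv z hz] with y hy
      rw [hh₁, hy]
      simp [mul_assoc]

/-- The argument principle, with power weights. -/
theorem circleIntegral_pow_mul_logDeriv {ρ : ℝ} (hρ : 0 < ρ) {v : ℂ → ℂ}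
    (hv : AnalyticOnNhd ℂ v (Metric.closedBall 0 ρ)) (hv0 : ∀ z ∈ Metric.closedBall 0 ρ, v z ≠ 0)
    (k : ℕ) (s : Multiset ℂ) (hs : ∀ a ∈ s, ‖a‖ < ρ) :
    (∮ ζ in C(0, ρ), ζ ^ k * logDeriv (fun z => (s.map fun a => z - a).prod * v z) ζ) =
      (2 * Real.pi * Complex.I) * (s.map fun a => a ^ k).sum := by
  have hprod : ∀ s : Multiset ℂ, AnalyticOnNhd ℂ (fun z : ℂ => (s.map fun a => z - a).prod)
      Set.univ := by
    intro s
    induction s using Multiset.induction_on with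
    | empty => simpa using analyticOnNhd_const
    | cons a s ih =>
      simp only [Multiset.map_cons, Multiset.prod_cons]
      exact (analyticOnNhd_id.sub analyticOnNhd_const).mul ih
  induction s using Multiset.induction_on with
  | empty =>
    simp only [Multiset.map_zero, Multiset.prod_zero, one_mul, Multiset.sum_zero, mul_zero]
    refine DiffContOnCl.circleIntegral_eq_zero hρ.le ?_
    refine DifferentiableOn.diffContOnCl_ball (U := Metric.closedBall 0 ρ) ?_ subset_rfl
    intro z hz
    have : AnalyticAt ℂ (fun ζ => ζ ^ k * logDeriv v ζ) z :=
      (analyticAt_id.pow k).mul ((hv z hz).deriv.div (hv z hz) (hv0 z hz))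
    exact this.differentiableAt.differentiableWithinAt
  | cons a s ih =>
    have hsa : ‖a‖ < ρ := hs a (Multiset.mem_cons_self a s)
    have hs' : ∀ b ∈ s, ‖b‖ < ρ := fun b hb => hs b (Multiset.mem_cons_of_mem hb)
    have hne : ∀ ζ : ℂ, ‖ζ‖ = ρ → ∀ b : ℂ, ‖b‖ < ρ → ζ - b ≠ 0 := by
      intro ζ hζ b hb h0
      rw [sub_eq_zero.1 h0] at hζ
      exact hb.ne hζ
    have hprod0 : ∀ ζ : ℂ, ‖ζ‖ = ρ → (s.map fun a => ζ - a).prod * v ζ ≠ 0 := by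
      intro ζ hζ
      refine mul_ne_zero ?_ (hv0 ζ (by simp [hζ]))
      rw [Ne, Multiset.prod_eq_zero_iff, Multiset.mem_map]
      rintro ⟨b, hb, h0⟩
      exact hne ζ hζ b (hs' b hb) h0
    have hpa : ∀ ζ : ℂ, ‖ζ‖ = ρ → AnalyticAt ℂ (fun z => (s.map fun a => z - a).prod * v z) ζ :=
      fun ζ hζ => (hprod s ζ trivial).mul (hv ζ (by simp [hζ]))
    have hlog : ∀ ζ : ℂ, ‖ζ‖ = ρ →
        ζ ^ k * logDeriv (fun z => ((a ::ₘ s).map fun a => z - a).prod * v z) ζ =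
        (ζ - a)⁻¹ • ζ ^ k + ζ ^ k * logDeriv (fun z => (s.map fun a => z - a).prod * v z) ζ := by
      intro ζ hζ
      simp only [Multiset.map_cons, Multiset.prod_cons, mul_assoc]
      rw [logDeriv_mul (f := fun z => z - a) ζ (hne ζ hζ a hsa) (hprod0 ζ hζ) (by fun_prop)
        (hpa ζ hζ).differentiableAt]
      have : logDeriv (fun z => z - a) ζ = (ζ - a)⁻¹ := by
        simp [logDeriv_apply]
      rw [this, smul_eq_mul]
      ring
    rw [circleIntegral.integral_congr hρ.le (fun ζ hζ => hlog ζ (mem_sphere_zero_iff_norm.1 hζ)),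
      circleIntegral.integral_add, ih hs', Multiset.map_cons, Multiset.sum_cons, mul_add]
    · congr 1
      exact ((differentiable_id.pow k).diffContOnCl (s := Metric.ball 0 ρ)
        ).circleIntegral_sub_inv_smul (by simpa using hsa)
    · refine ContinuousOn.circleIntegrable hρ.le fun ζ hζ => ?_
      have := hne ζ (mem_sphere_zero_iff_norm.1 hζ) a hsa
      exact ContinuousAt.continuousWithinAt (by fun_prop (disch := assumption))
    · refine ContinuousOn.circleIntegrable hρ.le fun ζ hζ => ?_
      have hζ := mem_sphere_zero_iff_norm.1 hζ
      have : AnalyticAt ℂ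
          (fun ζ => ζ ^ k * logDeriv (fun z => (s.map fun a => z - a).prod * v z) ζ) ζ :=
        (analyticAt_id.pow k).mul ((hpa ζ hζ).deriv.div (hpa ζ hζ) (hprod0 ζ hζ))
      exact this.continuousAt.continuousWithinAt

section Weierstrass

variable {E : Type*} [NormedAddCommGroup E] [NormedSpace ℂ E]

theorem exists_fin_tuple {α : Type*} (s : Multiset α) {d : ℕ} (hs : s.card = d) :
    ∃ ξ : Fin d → α, s = Finset.univ.val.map ξ := by
  subst hs
  have h : s.toList.length = s.card := s.length_toList
  refine ⟨fun i => s.toList.get (i.cast h.symm), ?_⟩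
  have h1 : (s : Multiset α) = ((s.toList : List α) : Multiset α) := s.coe_toList.symm
  have h2 : s.toList = List.ofFn fun i : Fin s.card => s.toList.get (i.cast h.symm) := by
    apply List.ext_get
    · simp
    · intro n h1 h2
      simp
  conv_lhs => rw [h1, h2]
  rw [Fin.univ_val_map]

theorem analyticAt_slice {g : E × ℂ → ℂ} {w : E} {z : ℂ} (hg : AnalyticAt ℂ g (w, z)) :
    AnalyticAt ℂ (fun z => g (w, z)) z :=
  AnalyticAt.comp (g := g) (f := fun z : ℂ => (w, z)) hg (analyticAt_const.prod analyticAt_id)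

theorem deriv_slice {g : E × ℂ → ℂ} {w : E} {z : ℂ} (hg : AnalyticAt ℂ g (w, z)) :
    deriv (fun z => g (w, z)) z = fderiv ℂ g (w, z) (0, 1) := by
  have h1 : HasDerivAt (fun z : ℂ => (w, z)) ((0, 1) : E × ℂ) z :=
    (hasDerivAt_const z w).prodMk (hasDerivAt_id z)
  exact (hg.differentiableAt.hasFDerivAt.comp_hasDerivAt z h1).deriv

/-- The zeros of a single slice `g (w, ·)` in a disc, with their power sums expressed by integrals
over the boundary circle. -/
theorem exists_zeros_slice {g : E × ℂ → ℂ} {ρ : ℝ} (hρ : 0 < ρ) {w : E}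
    {φ φ' : C(Metric.sphere (0 : ℂ) ρ, ℂ)} (hg : ∀ z ∈ Metric.closedBall 0 ρ, AnalyticAt ℂ g (w, z))
    (hφ : ∀ ζ, φ ζ = g (w, ζ)) (hφ' : ∀ ζ : Metric.sphere (0 : ℂ) ρ, φ' ζ = fderiv ℂ g (w, ζ) (0, 1))
    (hu : IsUnit φ) :
    ∃ s : Multiset ℂ, (∀ a ∈ s, ‖a‖ < ρ) ∧ (∃ v : ℂ → ℂ,
      AnalyticOnNhd ℂ v (Metric.closedBall 0 ρ) ∧ (∀ z ∈ Metric.closedBall 0 ρ, v z ≠ 0) ∧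
      ∀ z ∈ Metric.closedBall 0 ρ, g (w, z) = (s.map fun a => z - a).prod * v z) ∧
      ∀ k : ℕ, circleCLM ρ hρ.le (circleInclusion ρ ^ k * φ' * Ring.inverse φ) =
        (2 * Real.pi * Complex.I) * (s.map fun a => a ^ k).sum := by
  have hne : ∀ z, ‖z‖ = ρ → g (w, z) ≠ 0 := by
    intro z hz h0
    have := (ContinuousMap.isUnit_iff_forall_ne_zero φ).1 hu ⟨z, by simpa using hz⟩
    rw [hφ] at this
    exact this h0
  obtain ⟨s, hs, v, hv, hv0, hsv⟩ := exists_factorization hρ (h := fun z => g (w, z))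
    (fun z hz => analyticAt_slice (hg z hz)) hne
  refine ⟨s, hs, ⟨v, hv, hv0, fun z hz => (hsv z hz).self_of_nhds⟩, fun k => ?_⟩
  rw [← circleIntegral_pow_mul_logDeriv hρ hv hv0 k s hs]
  refine circleCLM_apply hρ.le fun ζ => ?_
  have hζ : (ζ : ℂ) ∈ Metric.closedBall (0 : ℂ) ρ := Metric.sphere_subset_closedBall ζ.2
  have hcongr : logDeriv (fun z => (s.map fun a => z - a).prod * v z) ζ =
      deriv (fun z => g (w, z)) ζ / g (w, ζ) := by
    have h : g (w, ζ) = (s.map fun a => (ζ : ℂ) - a).prod * v ζ := (hsv ζ hζ).self_of_nhds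
    rw [logDeriv_apply, ← (hsv ζ hζ).deriv_eq, ← h]
  rw [hcongr, deriv_slice (hg _ hζ), ContinuousMap.mul_apply, ContinuousMap.mul_apply,
    ringInverse_apply hu, hφ, hφ', ContinuousMap.pow_apply]
  simp only [circleInclusion, ContinuousMap.coe_mk]
  rw [div_eq_mul_inv, mul_assoc]

/-- The Weierstrass preparation theorem. The power sums of the zeros of `g (w, ·)` in a small disc
are contour integrals, hence analytic in `w`; the unit is recovered from its values on the circle
by Cauchy's formula. -/
theorem exists_isWeierstrassPoly {g : E × ℂ → ℂ} (hg : RegularInLast g) :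
    ∃ P, IsWeierstrassPoly g P := by
  obtain ⟨hg, hreg⟩ := hg
  have hg' : AnalyticAt ℂ (fun q => fderiv ℂ g q (0, 1)) 0 :=
    ((ContinuousLinearMap.apply ℂ ℂ ((0, 1) : E × ℂ)).analyticAt _).comp hg.fderiv
  obtain ⟨ρ₁, hρ₁, H₁⟩ := exists_analyticAt_curry hg
  obtain ⟨ρ₂, hρ₂, H₂⟩ := exists_analyticAt_curry hg'
  obtain ⟨R, hR, hRan⟩ : ∃ R > 0, ∀ q ∈ Metric.ball (0 : E × ℂ) R, AnalyticAt ℂ g q :=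
    Metric.eventually_nhds_iff_ball.1 hg.eventually_analyticAt
  obtain ⟨R₁, hR₁, hR₁z⟩ : ∃ R₁ > 0, ∀ z ∈ Metric.ball (0 : ℂ) R₁, z ≠ 0 → g (0, z) ≠ 0 := by
    have h := ((analyticAt_slice (w := (0 : E)) (z := (0 : ℂ)) hg
      ).eventually_eq_zero_or_eventually_ne_zero).resolve_left hreg
    rw [eventually_nhdsWithin_iff] at h
    exact Metric.eventually_nhds_iff_ball.1 h
  obtain ⟨ρ, hρ, hρlt⟩ := exists_between (lt_min (lt_min hρ₁ hρ₂) (lt_min hR hR₁))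
  have hlt₁ : ρ < ρ₁ := hρlt.trans_le ((min_le_left _ _).trans (min_le_left _ _))
  have hlt₂ : ρ < ρ₂ := hρlt.trans_le ((min_le_left _ _).trans (min_le_right _ _))
  have hltR : ρ < R := hρlt.trans_le ((min_le_right _ _).trans (min_le_left _ _))
  have hltR₁ : ρ < R₁ := hρlt.trans_le ((min_le_right _ _).trans (min_le_right _ _))
  obtain ⟨Φ, hΦ, hΦg⟩ := H₁ ρ hρ hlt₁
  obtain ⟨Φ', hΦ', hΦg'⟩ := H₂ ρ hρ hlt₂
  have hunit0 : IsUnit (Φ 0) := by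
    rw [ContinuousMap.isUnit_iff_forall_ne_zero]
    intro ζ
    have hζ := mem_sphere_zero_iff_norm.1 ζ.2
    rw [hΦg.self_of_nhds]
    refine hR₁z ζ (by simpa [hζ] using hltR₁) fun h0 => ?_
    rw [h0, norm_zero] at hζ
    exact hρ.ne hζ
  have hunit : ∀ᶠ w in 𝓝 0, IsUnit (Φ w) := hΦ.continuousAt.eventually (Units.isOpen.mem_nhds hunit0)
  let S : ℕ → E → ℂ := fun k w =>
    circleCLM ρ hρ.le (circleInclusion ρ ^ k * Φ' w * Ring.inverse (Φ w))
  have hS : ∀ k, AnalyticAt ℂ (S k) 0 := fun k =>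
    ((circleCLM ρ hρ.le).analyticAt _).comp
      (f := fun w => circleInclusion ρ ^ k * Φ' w * Ring.inverse (Φ w))
      ((analyticAt_const.mul hΦ').mul (analyticAt_ringInverse hΦ hunit0))
  have hz : ∀ᶠ w in 𝓝 (0 : E), ∃ s : Multiset ℂ, (∀ a ∈ s, ‖a‖ < ρ) ∧ (∃ v : ℂ → ℂ,
      AnalyticOnNhd ℂ v (Metric.closedBall 0 ρ) ∧ (∀ z ∈ Metric.closedBall 0 ρ, v z ≠ 0) ∧
      ∀ z ∈ Metric.closedBall 0 ρ, g (w, z) = (s.map fun a => z - a).prod * v z) ∧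
      ∀ k : ℕ, S k w = (2 * Real.pi * Complex.I) * (s.map fun a => a ^ k).sum := by
    filter_upwards [hΦg, hΦg', hunit, Metric.ball_mem_nhds (0 : E) hR] with w h1 h2 h3 h4
    refine exists_zeros_slice hρ (fun z hz => hRan _ ?_) h1 h2 h3
    rw [mem_ball_zero_iff, Prod.norm_def]
    exact max_lt (by simpa using h4) ((mem_closedBall_zero_iff.1 hz).trans_lt hltR)
  obtain ⟨s₀, hs₀, ⟨v₀, -, hv₀, hsv₀⟩, hS₀⟩ := hz.self_of_nhds
  have hpi : (2 * Real.pi * Complex.I : ℂ) ≠ 0 := Complex.two_pi_I_ne_zero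
  -- the number of zeros in the disc is an integer depending continuously on `w`
  have hcard : ∀ᶠ w in 𝓝 (0 : E), ‖(2 * Real.pi * Complex.I : ℂ)⁻¹ * S 0 w - s₀.card‖ < 1 := by
    have hc : ContinuousAt (fun w => ‖(2 * Real.pi * Complex.I : ℂ)⁻¹ * S 0 w - s₀.card‖) 0 :=
      ((continuousAt_const.mul (hS 0).continuousAt).sub continuousAt_const).norm
    refine hc.eventually (gt_mem_nhds ?_)
    simp only [hS₀ 0, pow_zero, Multiset.map_const', Multiset.sum_replicate, nsmul_eq_mul, mul_one]
    rw [inv_mul_cancel_left₀ hpi]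
    simp
  obtain ⟨ξ, hgood⟩ : ∃ ξ : E → Fin s₀.card → ℂ, ∀ᶠ w in 𝓝 (0 : E),
      (∀ i, ‖ξ w i‖ < ρ) ∧ (∃ v : ℂ → ℂ,
      AnalyticOnNhd ℂ v (Metric.closedBall 0 ρ) ∧ (∀ z ∈ Metric.closedBall 0 ρ, v z ≠ 0) ∧
      ∀ z ∈ Metric.closedBall 0 ρ, g (w, z) = (∏ i, (z - ξ w i)) * v z) ∧
      ∀ k : ℕ, ∑ i, ξ w i ^ k = (2 * Real.pi * Complex.I : ℂ)⁻¹ * S k w := by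
    refine Eventually.choice (r := fun w (ξ : Fin s₀.card → ℂ) => (∀ i, ‖ξ i‖ < ρ) ∧ (∃ v : ℂ → ℂ,
      AnalyticOnNhd ℂ v (Metric.closedBall 0 ρ) ∧ (∀ z ∈ Metric.closedBall 0 ρ, v z ≠ 0) ∧
      ∀ z ∈ Metric.closedBall 0 ρ, g (w, z) = (∏ i, (z - ξ i)) * v z) ∧
      ∀ k : ℕ, ∑ i, ξ i ^ k = (2 * Real.pi * Complex.I : ℂ)⁻¹ * S k w) ?_
    filter_upwards [hz, hcard] with w ⟨s, hs, ⟨v, hv1, hv2, hv3⟩, hSw⟩ h2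
    have hcs : s.card = s₀.card := by
      rw [hSw 0] at h2
      simp only [pow_zero, Multiset.map_const', Multiset.sum_replicate, nsmul_eq_mul,
        mul_one] at h2
      rw [inv_mul_cancel_left₀ hpi] at h2
      have h3 : |((s.card : ℤ) - (s₀.card : ℤ) : ℤ)| < 1 := by
        have h4 : ((s.card : ℂ) - (s₀.card : ℂ)) = (((s.card : ℤ) - (s₀.card : ℤ) : ℤ) : ℂ) := by
          push_cast; rfl
        rw [h4, Complex.norm_intCast] at h2
        exact_mod_cast h2
      rw [Int.abs_lt_one_iff] at h3
      omega
    obtain ⟨ξ, rfl⟩ := exists_fin_tuple s hcs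
    refine ⟨ξ, fun i => hs _ (by simp), ⟨v, hv1, hv2, fun z hz => ?_⟩, fun k => ?_⟩
    · rw [hv3 z hz, Multiset.map_map]
      rfl
    · rw [hSw k, inv_mul_cancel_left₀ hpi, Multiset.map_map]
      rfl
  have hcoeff : ∀ k, AnalyticAt ℂ (fun w => (∏ i, (X - C (ξ w i))).coeff k) 0 := by
    refine analyticAt_coeff_of_psum fun k => ?_
    have : AnalyticAt ℂ (fun w => (2 * Real.pi * Complex.I : ℂ)⁻¹ * S k w) 0 :=
      analyticAt_const.mul (hS k)
    refine this.congr ?_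
    filter_upwards [hgood] with w hw using (hw.2.2 k).symm
  have hmonic : ∀ w, (∏ i, (X - C (ξ w i))).Monic := fun w =>
    monic_prod_of_monic _ _ fun i _ => monic_X_sub_C _
  have hdeg : ∀ w, (∏ i, (X - C (ξ w i))).natDegree = s₀.card := fun w => by
    rw [natDegree_prod_of_monic _ _ fun i _ => monic_X_sub_C _]; simp
  have heval : ∀ w z, (∏ i, (X - C (ξ w i))).eval z = ∏ i, (z - ξ w i) := fun w z => by
    simp [eval_prod]
  -- the polynomials as an analytic family of functions on the circle
  let Pc : E → C(Metric.sphere (0 : ℂ) ρ, ℂ) := fun w =>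
    ∑ k ∈ Finset.range (s₀.card + 1), (∏ i, (X - C (ξ w i))).coeff k • circleInclusion ρ ^ k
  have hPc_an : AnalyticAt ℂ Pc 0 := by
    refine Finset.analyticAt_fun_sum _ fun k _ => ?_
    exact (((ContinuousLinearMap.id ℂ ℂ).smulRight (circleInclusion ρ ^ k)).analyticAt _).comp
      (f := fun w => (∏ i, (X - C (ξ w i))).coeff k) (hcoeff k)
  have hPc : ∀ w ζ, Pc w ζ = ∏ i, ((ζ : ℂ) - ξ w i) := by
    intro w ζ
    rw [← heval, eval_eq_sum_range, hdeg]
    simp [Pc, circleInclusion, ContinuousMap.sum_apply]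
  have hPc_unit : ∀ w, (∀ i, ‖ξ w i‖ < ρ) → IsUnit (Pc w) := by
    intro w hw
    rw [ContinuousMap.isUnit_iff_forall_ne_zero]
    intro ζ
    rw [hPc, Finset.prod_ne_zero_iff]
    intro i _ h0
    have := mem_sphere_zero_iff_norm.1 ζ.2
    rw [sub_eq_zero.1 h0] at this
    exact (hw i).ne this
  obtain ⟨V, hV, hVf⟩ := exists_analyticAt_cauchy hρ (Φ := fun w => Φ w * Ring.inverse (Pc w))
    (hΦ.mul (analyticAt_ringInverse hPc_an (hPc_unit 0 hgood.self_of_nhds.1)))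
  have hVv : ∀ᶠ w in 𝓝 (0 : E), ∀ z, ‖z‖ < ρ →
      V (w, z) ≠ 0 ∧ g (w, z) = V (w, z) * (∏ i, (X - C (ξ w i))).eval z := by
    filter_upwards [hgood, hΦg] with w ⟨h1, ⟨v, hv, hv0, hsv⟩, _⟩ h2 z hz
    have hcirc : ∀ ζ : Metric.sphere (0 : ℂ) ρ, (Φ w * Ring.inverse (Pc w)) ζ = v ζ := by
      intro ζ
      have hne := (ContinuousMap.isUnit_iff_forall_ne_zero _).1 (hPc_unit w h1) ζ
      rw [ContinuousMap.mul_apply, ringInverse_apply (hPc_unit w h1), h2,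
        hsv _ (Metric.sphere_subset_closedBall ζ.2), ← hPc]
      field_simp
    have hdiff : DifferentiableOn ℂ v (Metric.closedBall 0 ρ) := fun z hz =>
      (hv z hz).differentiableAt.differentiableWithinAt
    have hC := (hdiff.diffContOnCl_ball subset_rfl).two_pi_i_inv_smul_circleIntegral_sub_inv_smul
      (w := z) (by simpa using hz)
    have hval : V (w, z) = v z := by rw [← hC]; exact hVf w v hcirc z hz
    have hz' : z ∈ Metric.closedBall (0 : ℂ) ρ := by simpa using hz.le
    rw [hval]
    exact ⟨hv0 z hz', by rw [hsv z hz', heval, mul_comm]⟩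
  refine ⟨fun w => ∏ i, (X - C (ξ w i)), s₀.card, fun w => ⟨hmonic w, hdeg w⟩, ?_, hcoeff, V, hV,
    (hVv.self_of_nhds 0 (by simpa using hρ)).1, ?_⟩
  · have hξ0 : ∀ i, ξ 0 i = 0 := by
      intro i
      obtain ⟨h1, ⟨v, -, -, hsv⟩, -⟩ := hgood.self_of_nhds
      by_contra hne
      refine hR₁z (ξ 0 i) (by simpa using (h1 i).trans hltR₁) hne ?_
      rw [hsv _ (by simpa using (h1 i).le), Finset.prod_eq_zero (Finset.mem_univ i) (sub_self _),
        zero_mul]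
    simp [hξ0]
  · have h1 := (continuous_fst.tendsto' (0 : E × ℂ) 0 rfl).eventually hVv
    have h2 : ∀ᶠ q in 𝓝 (0 : E × ℂ), ‖q.2‖ < ρ :=
      (continuous_snd.norm.tendsto' (0 : E × ℂ) 0 (by simp)).eventually (gt_mem_nhds hρ)
    filter_upwards [h1, h2] with q hq1 hq2 using (hq1 q.2 hq2).2

/-- A scaled bound for the roots of a monic polynomial in terms of its coefficients. -/
theorem norm_root_le {p : ℂ[X]} (hp : p.Monic) {d : ℕ} (hd : p.natDegree = d) {M R : ℝ}
    (hM : 0 ≤ M) (hR : 0 ≤ R) (hc : ∀ i < d, ‖p.coeff i‖ ≤ M * R ^ (d - i)) {z : ℂ}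
    (hz : p.IsRoot z) : ‖z‖ ≤ (1 + d * M) * R := by
  by_contra! hlt
  have hdM : 0 ≤ d * M * R := by positivity
  have hRz : R ≤ ‖z‖ := by linarith [add_mul 1 (d * M) R]
  have hz0 : 0 < ‖z‖ := lt_of_le_of_lt (by positivity) hlt
  rcases Nat.eq_zero_or_pos d with rfl | hd0
  · have : p = 1 := hp.natDegree_eq_zero.1 hd
    simp [this] at hz
  have hsum : z ^ d = -∑ i ∈ Finset.range d, p.coeff i * z ^ i := by
    have h := hz
    rw [IsRoot.def, eval_eq_sum_range, hd, Finset.sum_range_succ, ← hd, hp.coeff_natDegree,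
      hd] at h
    linear_combination h
  have hle : ‖z‖ ^ d ≤ ∑ i ∈ Finset.range d, M * (R * ‖z‖ ^ (d - 1)) := by
    rw [← norm_pow, hsum, norm_neg]
    refine (norm_sum_le _ _).trans (Finset.sum_le_sum fun i hi => ?_)
    have hi := Finset.mem_range.1 hi
    rw [norm_mul, norm_pow]
    calc ‖p.coeff i‖ * ‖z‖ ^ i ≤ M * R ^ (d - i) * ‖z‖ ^ i := by gcongr; exact hc i hi
      _ = M * (R * (R ^ (d - 1 - i) * ‖z‖ ^ i)) := by
        rw [show d - i = d - 1 - i + 1 by omega, pow_succ]; ring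
      _ ≤ M * (R * (‖z‖ ^ (d - 1 - i) * ‖z‖ ^ i)) := by gcongr
      _ = M * (R * ‖z‖ ^ (d - 1)) := by rw [← pow_add, show d - 1 - i + i = d - 1 by omega]
  rw [Finset.sum_const, Finset.card_range, nsmul_eq_mul,
    show d = d - 1 + 1 by omega, pow_succ, ← show d = d - 1 + 1 by omega] at hle
  have : ‖z‖ ≤ d * M * R := by
    refine le_of_mul_le_mul_left ?_ (pow_pos hz0 (d - 1))
    linarith
  linarith [add_mul 1 (d * M) R]

omit [NormedSpace ℂ E] in
theorem eventually_norm_root_lt {P : E → ℂ[X]} {d : ℕ} {w₀ : E}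
    (hP : ∀ w, (P w).Monic ∧ (P w).natDegree = d) (h0 : P w₀ = X ^ d)
    (hc : ∀ i, ContinuousAt (fun w => (P w).coeff i) w₀) {ε : ℝ} (hε : 0 < ε) :
    ∀ᶠ w in 𝓝 w₀, ∀ z, (P w).IsRoot z → ‖z‖ < ε := by
  set R := ε / (2 * (1 + d)) with hRdef
  have hR : 0 < R := by positivity
  have h1 : ∀ i ∈ Finset.range d, ∀ᶠ w in 𝓝 w₀, ‖(P w).coeff i‖ ≤ 1 * R ^ (d - i) := by
    intro i hi
    have hi := Finset.mem_range.1 hi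
    have h2 := (hc i).norm.tendsto
    rw [h0, coeff_X_pow, if_neg hi.ne, norm_zero] at h2
    filter_upwards [h2.eventually (gt_mem_nhds (pow_pos hR (d - i)))] with w hw
    rw [one_mul]; exact hw.le
  filter_upwards [(Finset.eventually_all _).2 h1] with w hw z hz
  refine (norm_root_le (hP w).1 (hP w).2 zero_le_one hR.le
    (fun i hi => hw i (Finset.mem_range.2 hi)) hz).trans_lt ?_
  rw [hRdef, mul_one]
  field_simp
  norm_num

theorem eq_of_rootMultiplicity_eq {p q : ℂ[X]} (hp : p.Monic) (hq : q.Monic)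
    (h : ∀ a, p.rootMultiplicity a = q.rootMultiplicity a) : p = q := by
  have hr : p.roots = q.roots := by
    ext a; rw [count_roots, count_roots, h a]
  rw [(IsAlgClosed.splits p).eq_prod_roots_of_monic hp, hr,
    ← (IsAlgClosed.splits q).eq_prod_roots_of_monic hq]

theorem rootMultiplicity_eq_of_mul_eq {p q : ℂ[X]} (hp : p ≠ 0) (hq : q ≠ 0) {u v : ℂ → ℂ} {a : ℂ}
    (hu : AnalyticAt ℂ u a) (hv : AnalyticAt ℂ v a) (hu0 : u a ≠ 0) (hv0 : v a ≠ 0)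
    (h : ∀ᶠ z in 𝓝 a, u z * p.eval z = v z * q.eval z) :
    p.rootMultiplicity a = q.rootMultiplicity a := by
  have hpoly : ∀ r : ℂ[X], AnalyticAt ℂ (fun z => r.eval z) a := fun r => by
    simpa using AnalyticAt.aeval_polynomial (analyticAt_id (𝕜 := ℂ) (z := a)) r
  have key : ∀ (p : ℂ[X]), p ≠ 0 → ∀ u : ℂ → ℂ, AnalyticAt ℂ u a → u a ≠ 0 →
      ∃ g : ℂ → ℂ, AnalyticAt ℂ g a ∧ g a ≠ 0 ∧ ∀ᶠ z in 𝓝 a,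
        u z * p.eval z = (z - a) ^ p.rootMultiplicity a • g z := by
    intro p hp u hu hu0
    obtain ⟨r, hr, hra⟩ := exists_eq_pow_rootMultiplicity_mul_and_not_dvd p hp a
    refine ⟨fun z => u z * r.eval z, hu.mul (hpoly r), mul_ne_zero hu0 ?_, ?_⟩
    · rwa [dvd_iff_isRoot] at hra
    · refine Eventually.of_forall fun z => ?_
      conv_lhs => rw [hr]
      simp
      ring
  refine AnalyticAt.unique_eventuallyEq_pow_smul_nonzero (f := fun z => u z * p.eval z) (z₀ := a)
    (key p hp u hu hu0) ?_
  obtain ⟨g, hg, hg0, hgq⟩ := key q hq v hv hv0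
  exact ⟨g, hg, hg0, by filter_upwards [h, hgq] with z h1 h2; rw [h1, h2]⟩

/-- The germ of the Weierstrass polynomial is unique. -/
theorem IsWeierstrassPoly.eventuallyEq {g : E × ℂ → ℂ} {P Q : E → ℂ[X]}
    (hP : IsWeierstrassPoly g P) (hQ : IsWeierstrassPoly g Q) : P =ᶠ[𝓝 0] Q := by
  obtain ⟨d, hPd, hP0, hPc, u, hu, hu0, hgu⟩ := hP
  obtain ⟨e, hQd, hQ0, hQc, v, hv, hv0, hgv⟩ := hQ
  obtain ⟨δ, hδ, H⟩ := Metric.eventually_nhds_iff_ball.1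
    ((((hu.eventually_analyticAt.and hv.eventually_analyticAt).and
      ((hu.continuousAt.eventually_ne hu0).and (hv.continuousAt.eventually_ne hv0))).and
      (hgu.and hgv)))
  have hmem : ∀ {w : E} {z : ℂ}, ‖w‖ < δ → ‖z‖ < δ → ((w, z) : E × ℂ) ∈ Metric.ball 0 δ := by
    intro w z hw hz
    rw [mem_ball_zero_iff, Prod.norm_def]
    exact max_lt hw hz
  filter_upwards [eventually_norm_root_lt hPd hP0 (fun i => (hPc i).continuousAt) hδ,
    eventually_norm_root_lt hQd hQ0 (fun i => (hQc i).continuousAt) hδ,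
    Metric.ball_mem_nhds (0 : E) hδ] with w hPr hQr hw
  have hw : ‖w‖ < δ := by simpa using hw
  refine eq_of_rootMultiplicity_eq (hPd w).1 (hQd w).1 fun a => ?_
  by_cases ha : ‖a‖ < δ
  · obtain ⟨⟨⟨h1, h2⟩, h3, h4⟩, -⟩ := H (w, a) (hmem hw ha)
    refine rootMultiplicity_eq_of_mul_eq (hPd w).1.ne_zero (hQd w).1.ne_zero
      (analyticAt_slice h1) (analyticAt_slice h2) h3 h4 ?_
    filter_upwards [continuous_norm.continuousAt.eventually (gt_mem_nhds ha)] with z hz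
    obtain ⟨-, h5, h6⟩ := H (w, z) (hmem hw hz)
    exact h5.symm.trans h6
  · rw [rootMultiplicity_eq_zero fun h => ha (hPr a h), rootMultiplicity_eq_zero fun h => ha (hQr a h)]

theorem IsWeierstrassPoly.congr {g g' : E × ℂ → ℂ} {P : E → ℂ[X]} (hP : IsWeierstrassPoly g P)
    (h : g =ᶠ[𝓝 0] g') : IsWeierstrassPoly g' P := by
  obtain ⟨d, hPd, hP0, hPc, u, hu, hu0, hgu⟩ := hP
  refine ⟨d, hPd, hP0, hPc, u, hu, hu0, ?_⟩
  filter_upwards [h, hgu] with q h1 h2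
  rw [← h1, h2]

theorem IsWeierstrassPoly.weierstrassPoly_eventuallyEq {g : E × ℂ → ℂ} {P : E → ℂ[X]}
    (hP : IsWeierstrassPoly g P) : weierstrassPoly g =ᶠ[𝓝 0] P := by
  have h : ∃ P, IsWeierstrassPoly g P := ⟨P, hP⟩
  have h1 : weierstrassPoly g = h.choose := by
    rw [weierstrassPoly, dif_pos h]
  rw [h1]
  exact h.choose_spec.eventuallyEq hP

/-- The Weierstrass polynomial restricts to that of a slice through a nearby base point at which
all its roots still vanish. -/
theorem IsWeierstrassPoly.restrict {E' : Type*} [NormedAddCommGroup E'] [NormedSpace ℂ E']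
    {g : E × ℂ → ℂ} {P : E → ℂ[X]} (hP : IsWeierstrassPoly g P) (L : E' →L[ℂ] E) :
    ∀ᶠ w₀ in 𝓝 (0 : E), P w₀ = X ^ (P 0).natDegree →
      IsWeierstrassPoly (fun q : E' × ℂ => g (w₀ + L q.1, q.2)) fun w => P (w₀ + L w) := by
  obtain ⟨d, hPd, hP0, hPc, u, hu, hu0, hgu⟩ := hP
  rw [(hPd 0).2]
  have hcoef : ∀ᶠ w in 𝓝 (0 : E), ∀ i ∈ Finset.range (d + 1),
      AnalyticAt ℂ (fun x => (P x).coeff i) w :=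
    (Finset.eventually_all _).2 fun i _ => (hPc i).eventually_analyticAt
  have hq : ∀ᶠ w in 𝓝 (0 : E), AnalyticAt ℂ u (w, 0) ∧ u (w, 0) ≠ 0 ∧
      ∀ᶠ q in 𝓝 ((w, 0) : E × ℂ), g q = u q * (P q.1).eval q.2 :=
    ((continuous_id.prodMk continuous_const).tendsto' (0 : E) ((0, 0) : E × ℂ) rfl).eventually
      (hu.eventually_analyticAt.and ((hu.continuousAt.eventually_ne hu0).and hgu.eventually_nhds))
  filter_upwards [hcoef, hq] with w₀ h1 ⟨h2, h3, h4⟩ hw₀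
  have hL : ∀ x : E', AnalyticAt ℂ (fun w : E' => w₀ + L w) x := fun x =>
    analyticAt_const.add (L.analyticAt x)
  have hLq : AnalyticAt ℂ (fun q : E' × ℂ => (w₀ + L q.1, q.2)) 0 :=
    (analyticAt_const.add ((L.analyticAt _).comp analyticAt_fst)).prod analyticAt_snd
  refine ⟨d, fun w => hPd _, by simpa using hw₀, fun i => ?_, fun q => u (w₀ + L q.1, q.2), ?_,
    by simpa using h3, ?_⟩
  · rcases lt_or_ge i (d + 1) with hi | hi
    · exact AnalyticAt.comp (g := fun x => (P x).coeff i) (f := fun w : E' => w₀ + L w)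
        (by simpa using h1 i (Finset.mem_range.2 hi)) (hL 0)
    · have : ∀ w, (P (w₀ + L w)).coeff i = 0 := fun w =>
        coeff_eq_zero_of_natDegree_lt (by rw [(hPd _).2]; omega)
      simpa only [this] using analyticAt_const
  · exact AnalyticAt.comp (g := u) (f := fun q : E' × ℂ => (w₀ + L q.1, q.2))
      (by simpa using h2) hLq
  · exact (hLq.continuousAt.tendsto).eventually (by simpa using h4)

end Weierstrass

/-! ### Generalized discriminants -/

section Discriminant

/-- The sum defining the generalized discriminants, over an arbitrary commutative ring: over the
`j`-element sets of indices, of the products of the squares of the differences. -/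
def tupleDiscr {R : Type*} [CommRing R] {d : ℕ} (x : Fin d → R) (j : ℕ) : R :=
  ∑ s ∈ Finset.powersetCard j (Finset.univ : Finset (Fin d)),
    ∏ a ∈ s, ∏ b ∈ s with a < b, (x a - x b) ^ 2

/-- The product over the pairs `a < b` is, up to a sign depending on the number of indices only, a
product over all pairs of different indices; this form does not refer to the order of the
indices. -/
theorem prod_sq_sub_eq_offDiag {R : Type*} [CommRing R] {d : ℕ} (x : Fin d → R)
    (s : Finset (Fin d)) :
    ∏ a ∈ s, ∏ b ∈ s with a < b, (x a - x b) ^ 2 =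
      (-1) ^ (s.card * (s.card - 1) / 2) * ∏ q ∈ s.offDiag, (x q.1 - x q.2) := by
  have hlt : ∏ a ∈ s, ∏ b ∈ s with a < b, (x a - x b) ^ 2 =
      ∏ q ∈ s.offDiag with q.1 < q.2, (x q.1 - x q.2) ^ 2 := by
    rw [Finset.prod_congr rfl fun a _ => Finset.prod_filter (fun b => a < b) _,
      ← Finset.prod_product' (f := fun a b => if a < b then (x a - x b) ^ 2 else 1),
      ← Finset.prod_filter]
    refine Finset.prod_congr ?_ fun _ _ => rfl
    ext ⟨a, b⟩
    simp only [Finset.mem_filter, Finset.mem_product, Finset.mem_offDiag]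
    constructor
    · rintro ⟨⟨ha, hb⟩, h⟩; exact ⟨⟨ha, hb, h.ne⟩, h⟩
    · rintro ⟨⟨ha, hb, -⟩, h⟩; exact ⟨⟨ha, hb⟩, h⟩
  have himg : (s.offDiag.filter fun q => ¬ q.1 < q.2) =
      (s.offDiag.filter fun q => q.1 < q.2).image Prod.swap := by
    ext ⟨a, b⟩
    simp only [Finset.mem_filter, Finset.mem_offDiag, Finset.mem_image, Prod.exists, Prod.swap_prod_mk,
      Prod.mk.injEq]
    constructor
    · rintro ⟨⟨ha, hb, hne⟩, h⟩
      exact ⟨b, a, ⟨⟨hb, ha, hne.symm⟩, lt_of_le_of_ne (not_lt.1 h) hne.symm⟩, rfl, rfl⟩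
    · rintro ⟨c, e, ⟨⟨hc, he, hne⟩, h⟩, rfl, rfl⟩
      exact ⟨⟨he, hc, hne.symm⟩, h.not_gt⟩
  have hcard : s.card * (s.card - 1) / 2 = (s.offDiag.filter fun q => q.1 < q.2).card := by
    have h1 := Finset.card_filter_add_card_filter_not (s := s.offDiag) (fun q => q.1 < q.2)
    rw [himg, Finset.card_image_of_injective _ Prod.swap_injective, Finset.offDiag_card] at h1
    rw [Nat.mul_sub_one]
    omega
  rw [hlt, ← Finset.prod_filter_mul_prod_filter_not s.offDiag (fun q => q.1 < q.2), himg,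
    Finset.prod_image Prod.swap_injective.injOn, hcard, ← Finset.prod_const,
    ← Finset.prod_mul_distrib, ← Finset.prod_mul_distrib]
  refine Finset.prod_congr rfl fun q _ => ?_
  simp only [Prod.fst_swap, Prod.snd_swap]
  ring

theorem tupleDiscr_comp_perm {R : Type*} [CommRing R] {d : ℕ} (x : Fin d → R) (j : ℕ)
    (σ : Equiv.Perm (Fin d)) : tupleDiscr (x ∘ σ) j = tupleDiscr x j := by
  unfold tupleDiscr
  refine Finset.sum_equiv (Equiv.finsetCongr σ) (fun s => ?_) fun s _ => ?_
  · simp [Finset.mem_powersetCard]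
  · rw [prod_sq_sub_eq_offDiag, prod_sq_sub_eq_offDiag]
    simp only [Equiv.finsetCongr_apply, Finset.card_map]
    congr 1
    refine Finset.prod_bij (fun q _ => (σ q.1, σ q.2)) ?_ ?_ ?_ ?_
    · rintro ⟨a, b⟩ h
      simpa using h
    · rintro ⟨a, b⟩ _ ⟨a', b'⟩ _ h
      simpa using h
    · rintro ⟨a, b⟩ h
      refine ⟨(σ.symm a, σ.symm b), ?_, by simp⟩
      simpa [Finset.mem_map_equiv] using h
    · rintro ⟨a, b⟩ _
      rfl

theorem exists_perm_of_map_eq {α : Type*} {d : ℕ} {ξ η : Fin d → α}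
    (h : Finset.univ.val.map ξ = Finset.univ.val.map η) : ∃ σ : Equiv.Perm (Fin d), ξ = η ∘ σ := by
  classical
  have hc : ∀ c, Nonempty ({a // ξ a = c} ≃ {a // η a = c}) := fun c => by
    have h1 := congrArg (Multiset.count c) h
    rw [Multiset.count_map, Multiset.count_map] at h1
    refine ⟨Fintype.equivOfCardEq ?_⟩
    rw [Fintype.card_subtype, Fintype.card_subtype]
    simpa only [Finset.card_def, Finset.filter_val, eq_comm (a := c)] using h1
  refine ⟨Equiv.ofFiberEquiv fun c => (hc c).some, ?_⟩
  ext a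
  exact (Equiv.ofFiberEquiv_map _ a).symm

theorem polyDiscr_eq_tupleDiscr {p : ℂ[X]} {d : ℕ} {ξ : Fin d → ℂ}
    (h : p.roots = Finset.univ.val.map ξ) (i : ℕ) : polyDiscr p i = tupleDiscr ξ (d + 1 - i) := by
  have hd : p.roots.toList.length = d := by rw [Multiset.length_toList, h]; simp
  subst hd
  have h2 : Finset.univ.val.map ξ = Finset.univ.val.map fun k => p.roots.toList.get k := by
    rw [← h, Fin.univ_val_map, List.ofFn_get, Multiset.coe_toList]
  obtain ⟨σ, hσ⟩ := exists_perm_of_map_eq h2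
  rw [hσ, tupleDiscr_comp_perm]
  rfl

theorem exists_roots_tuple {p : ℂ[X]} (hp : p.Monic) {d : ℕ} (hd : p.natDegree = d) :
    ∃ ξ : Fin d → ℂ, p.roots = Finset.univ.val.map ξ ∧ p = ∏ i, (X - C (ξ i)) := by
  have hs := IsAlgClosed.splits p
  obtain ⟨ξ, hξ⟩ := exists_fin_tuple p.roots (hs.natDegree_eq_card_roots.symm.trans hd)
  refine ⟨ξ, hξ, ?_⟩
  conv_lhs => rw [hs.eq_prod_roots_of_monic hp, hξ, Multiset.map_map]
  rfl

/-- The generalized discriminants are symmetric in the roots, so they are analytic functions of the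
coefficients. -/
theorem analyticAt_polyDiscr {E : Type*} [NormedAddCommGroup E] [NormedSpace ℂ E] {P : E → ℂ[X]}
    {d : ℕ} {w : E} (hP : ∀ w, (P w).Monic ∧ (P w).natDegree = d)
    (hc : ∀ i, AnalyticAt ℂ (fun w => (P w).coeff i) w) (i : ℕ) :
    AnalyticAt ℂ (fun w => polyDiscr (P w) i) w := by
  choose ξ hξ hPξ using fun w => exists_roots_tuple (hP w).1 (hP w).2
  have hsymm : (tupleDiscr (MvPolynomial.X (R := ℂ) : Fin d → _) (d + 1 - i)).IsSymmetric := by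
    intro σ
    rw [← tupleDiscr_comp_perm _ _ σ]
    conv_lhs => rw [tupleDiscr_comp_perm _ _ σ]
    simp [tupleDiscr, map_sum, map_prod]
  have := analyticAt_aeval_symmetric (ξ := ξ) (p := w) (fun k => by simpa only [← hPξ] using hc k)
    hsymm
  refine this.congr (Eventually.of_forall fun w => ?_)
  simp only [polyDiscr_eq_tupleDiscr (hξ w)]
  simp [tupleDiscr, map_sum, map_prod]

theorem tupleDiscr_eq_zero {d j : ℕ} {ξ : Fin d → ℂ} (h : (Finset.univ.image ξ).card < j) :
    tupleDiscr ξ j = 0 := by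
  refine Finset.sum_eq_zero fun s hs => ?_
  rw [Finset.mem_powersetCard] at hs
  obtain ⟨a, ha, b, hb, hab, he⟩ := Finset.exists_ne_map_eq_of_card_lt_of_maps_to
    (s := s) (t := Finset.univ.image ξ) (f := ξ) (by rwa [hs.2]) (fun a _ => by simp)
  rw [prod_sq_sub_eq_offDiag, Finset.prod_eq_zero (i := (a, b)), mul_zero]
  · simp [ha, hb, hab]
  · simp [he]

/-- If `j` is the number of different entries, all the nonzero terms of the sum coincide. -/
theorem tupleDiscr_ne_zero {d j : ℕ} {ξ : Fin d → ℂ} (h : (Finset.univ.image ξ).card = j) :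
    tupleDiscr ξ j ≠ 0 := by
  set c : ℂ := (-1) ^ (j * (j - 1) / 2) * ∏ q ∈ (Finset.univ.image ξ).offDiag, (q.1 - q.2) with hc
  have hc0 : c ≠ 0 := by
    refine mul_ne_zero (pow_ne_zero _ (by norm_num)) (Finset.prod_ne_zero_iff.2 fun q hq => ?_)
    exact sub_ne_zero.2 (Finset.mem_offDiag.1 hq).2.2
  have hterm : ∀ s ∈ Finset.powersetCard j (Finset.univ : Finset (Fin d)),
      ∏ a ∈ s, ∏ b ∈ s with a < b, (ξ a - ξ b) ^ 2 = if Set.InjOn ξ s then c else 0 := by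
    intro s hs
    rw [Finset.mem_powersetCard] at hs
    rw [prod_sq_sub_eq_offDiag]
    split_ifs with hinj
    · have himg : s.image ξ = Finset.univ.image ξ :=
        Finset.eq_of_subset_of_card_le (Finset.image_subset_image (Finset.subset_univ s))
          (by rw [Finset.card_image_of_injOn hinj, hs.2, h])
      rw [hc, hs.2, ← himg]
      congr 1
      refine Finset.prod_bij (fun q _ => (ξ q.1, ξ q.2)) ?_ ?_ ?_ ?_
      · rintro ⟨a, b⟩ hq
        obtain ⟨ha, hb, hab⟩ := Finset.mem_offDiag.1 hq
        exact Finset.mem_offDiag.2 ⟨Finset.mem_image_of_mem _ ha, Finset.mem_image_of_mem _ hb,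
          fun he => hab (hinj ha hb he)⟩
      · rintro ⟨a, b⟩ hq ⟨a', b'⟩ hq' he
        obtain ⟨ha, hb, -⟩ := Finset.mem_offDiag.1 hq
        obtain ⟨ha', hb', -⟩ := Finset.mem_offDiag.1 hq'
        rw [Prod.mk.injEq] at he
        exact Prod.ext (hinj ha ha' he.1) (hinj hb hb' he.2)
      · rintro ⟨a, b⟩ hq
        obtain ⟨ha, hb, hab⟩ := Finset.mem_offDiag.1 hq
        obtain ⟨a', ha', rfl⟩ := Finset.mem_image.1 ha
        obtain ⟨b', hb', rfl⟩ := Finset.mem_image.1 hb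
        exact ⟨(a', b'), Finset.mem_offDiag.2 ⟨ha', hb', fun he => hab (congrArg ξ he)⟩, rfl⟩
      · rintro ⟨a, b⟩ _
        rfl
    · simp only [Set.InjOn, not_forall] at hinj
      obtain ⟨a, ha, b, hb, he, hab⟩ := hinj
      rw [Finset.prod_eq_zero (i := (a, b)), mul_zero]
      · exact Finset.mem_offDiag.2 ⟨ha, hb, hab⟩
      · simp [he]
  rw [tupleDiscr, Finset.sum_congr rfl hterm, ← Finset.sum_filter, Finset.sum_const, nsmul_eq_mul]
  refine mul_ne_zero (Nat.cast_ne_zero.2 ?_) hc0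
  obtain ⟨s, hsinj, hs⟩ : ∃ s : Finset (Fin d), Set.InjOn ξ s ∧ s.card = j := by
    have hg : ∀ c : Finset.univ.image ξ, ∃ a, ξ a = c := fun c => by
      simpa using Finset.mem_image.1 c.2
    choose g hg using hg
    have hginj : Function.Injective g := fun c c' h => Subtype.ext (by rw [← hg c, h, hg c'])
    refine ⟨Finset.univ.image g, ?_, ?_⟩
    · rintro a ha b hb he
      obtain ⟨c, -, rfl⟩ := Finset.mem_image.1 ha
      obtain ⟨c', -, rfl⟩ := Finset.mem_image.1 hb
      rw [hg, hg] at he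
      rw [Subtype.ext he]
    · rw [Finset.card_image_of_injective _ hginj, Finset.card_univ, Fintype.card_coe, h]
  refine Finset.card_ne_zero_of_mem (a := s) ?_
  rw [Finset.mem_filter, Finset.mem_powersetCard]
  exact ⟨⟨Finset.subset_univ s, hs⟩, hsinj⟩

theorem polyDiscr_eq_zero {p : ℂ[X]} (hp : p.Monic) {i : ℕ}
    (h : p.roots.toFinset.card < p.natDegree + 1 - i) : polyDiscr p i = 0 := by
  obtain ⟨ξ, hξ, -⟩ := exists_roots_tuple hp rfl
  rw [polyDiscr_eq_tupleDiscr hξ]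
  refine tupleDiscr_eq_zero ?_
  rwa [hξ] at h

theorem polyDiscr_ne_zero {p : ℂ[X]} (hp : p.Monic) {i : ℕ}
    (h : p.roots.toFinset.card = p.natDegree + 1 - i) : polyDiscr p i ≠ 0 := by
  obtain ⟨ξ, hξ, -⟩ := exists_roots_tuple hp rfl
  rw [polyDiscr_eq_tupleDiscr hξ]
  refine tupleDiscr_ne_zero ?_
  rwa [hξ] at h

theorem card_roots_toFinset_le {p : ℂ[X]} : p.roots.toFinset.card ≤ p.natDegree :=
  (Multiset.toFinset_card_le _).trans p.card_roots'

theorem card_roots_of_polyDiscr_one_ne_zero {p : ℂ[X]} (hp : p.Monic) (h : polyDiscr p 1 ≠ 0) :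
    p.roots.toFinset.card = p.natDegree := by
  refine le_antisymm card_roots_toFinset_le ?_
  by_contra hlt
  exact h (polyDiscr_eq_zero hp (by omega))

/-- The first generalized discriminant that is not identically zero determines the generic number
of roots: it can vanish only where the number of roots drops. -/
theorem eventually_card_roots {E : Type*} [TopologicalSpace E] [Zero E] {P : E → ℂ[X]} {d : ℕ}
    (hP : ∀ w, (P w).Monic ∧ (P w).natDegree = d) {i₀ : ℕ}
    (hlt : ∀ i < i₀, ∀ᶠ w in 𝓝 (0 : E), polyDiscr (P w) i = 0) :
    ∀ᶠ w in 𝓝 (0 : E), polyDiscr (P w) i₀ ≠ 0 → (P w).roots.toFinset.card = d + 1 - i₀ := by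
  filter_upwards [(Finset.eventually_all (Finset.range i₀)).2 fun i hi =>
    hlt i (Finset.mem_range.1 hi)] with w hw hne
  have hle : (P w).roots.toFinset.card ≤ d := (hP w).2 ▸ card_roots_toFinset_le
  rcases lt_trichotomy (P w).roots.toFinset.card (d + 1 - i₀) with h | h | h
  · exact absurd (polyDiscr_eq_zero (hP w).1 (by rwa [(hP w).2])) hne
  · exact h
  · refine absurd (hw (d + 1 - (P w).roots.toFinset.card) (Finset.mem_range.2 (by omega)))
      (polyDiscr_ne_zero (hP w).1 ?_)
    rw [(hP w).2]
    omega

end Discriminant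

/-! ### Families of polynomials with a constant number of roots -/

section LocalRoots

theorem analyticAt_eval {E : Type*} [NormedAddCommGroup E] [NormedSpace ℂ E] {P : E → ℂ[X]} {d : ℕ}
    (hP : ∀ w, (P w).natDegree = d) {w : E} (hc : ∀ i, AnalyticAt ℂ (fun w => (P w).coeff i) w)
    (z : ℂ) : AnalyticAt ℂ (fun q : E × ℂ => (P q.1).eval q.2) (w, z) := by
  have h : (fun q : E × ℂ => (P q.1).eval q.2) =
      fun q : E × ℂ => ∑ i ∈ Finset.range (d + 1), (P q.1).coeff i * q.2 ^ i := by
    ext q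
    rw [eval_eq_sum_range, hP]
  rw [h]
  refine Finset.analyticAt_fun_sum _ fun i _ => ?_
  exact (AnalyticAt.comp (g := fun w => (P w).coeff i) (f := fun q : E × ℂ => q.1) (hc i)
    analyticAt_fst).mul (analyticAt_snd.pow i)

/-- Near a root `z₀` of `p a`, the roots of `p b` for `b` near `a` are those of a Weierstrass
polynomial of positive degree. -/
theorem exists_local_weierstrass {p : ℂ → ℂ[X]} {d : ℕ}
    (hp : ∀ b, (p b).Monic ∧ (p b).natDegree = d) {a : ℂ}
    (hc : ∀ i, AnalyticAt ℂ (fun b => (p b).coeff i) a) {z₀ : ℂ} (hz : (p a).IsRoot z₀) :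
    ∃ (m : ℕ) (Q : ℂ → ℂ[X]), m ≠ 0 ∧ (∀ b, (Q b).Monic ∧ (Q b).natDegree = m) ∧ Q a = X ^ m ∧
      (∀ i, AnalyticAt ℂ (fun b => (Q b).coeff i) a) ∧
      ∃ δ > 0, ∀ᶠ b in 𝓝 a, ∀ z, ‖z‖ < δ → ((p b).IsRoot (z₀ + z) ↔ (Q b).IsRoot z) := by
  have hsh : AnalyticAt ℂ (fun q : ℂ × ℂ => (a + q.1, z₀ + q.2)) 0 :=
    (analyticAt_const.add analyticAt_fst).prod (analyticAt_const.add analyticAt_snd)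
  have hg : AnalyticAt ℂ (fun q : ℂ × ℂ => (p (a + q.1)).eval (z₀ + q.2)) 0 :=
    AnalyticAt.comp (g := fun q : ℂ × ℂ => (p q.1).eval q.2)
      (f := fun q : ℂ × ℂ => (a + q.1, z₀ + q.2))
      (by simpa using analyticAt_eval (fun b => (hp b).2) hc z₀) hsh
  have hreg : RegularInLast fun q : ℂ × ℂ => (p (a + q.1)).eval (z₀ + q.2) := by
    refine ⟨hg, fun h0 => (hp a).1.ne_zero (eq_zero_of_infinite_isRoot _ ?_)⟩
    have h1 : ∀ᶠ z in 𝓝 z₀, (p a).IsRoot z := by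
      have h2 : Tendsto (fun z => z - z₀) (𝓝 z₀) (𝓝 0) := by
        simpa using (continuous_id.sub continuous_const).tendsto z₀ (f := fun z : ℂ => z - z₀)
      filter_upwards [h2.eventually h0] with z hz
      simpa using hz
    exact infinite_of_mem_nhds z₀ h1
  obtain ⟨Q, m, hQ, hQ0, hQc, u, hu, hu0, hgu⟩ := exists_isWeierstrassPoly hreg
  have hback : Tendsto (fun b : ℂ => b - a) (𝓝 a) (𝓝 0) := by
    simpa using (continuous_id.sub continuous_const).tendsto a (f := fun z : ℂ => z - a)
  refine ⟨m, fun b => Q (b - a), ?_, fun b => hQ _, by simpa using hQ0, fun i => ?_, ?_⟩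
  · rintro rfl
    have h1 := hgu.self_of_nhds
    have h2 : (p a).eval z₀ = 0 := hz
    simp [hQ0, h2] at h1
    exact hu0 h1.symm
  · exact AnalyticAt.comp (g := fun b => (Q b).coeff i) (f := fun b : ℂ => b - a)
      (by simpa using hQc i) (analyticAt_id.sub analyticAt_const)
  · obtain ⟨δ, hδ, H⟩ := Metric.eventually_nhds_iff_ball.1
      (hgu.and (hu.continuousAt.eventually_ne hu0))
    refine ⟨δ, hδ, ?_⟩
    filter_upwards [hback.eventually (Metric.ball_mem_nhds 0 hδ)] with b hb z hz
    have hmem : ((b - a, z) : ℂ × ℂ) ∈ Metric.ball 0 δ := by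
      rw [mem_ball_zero_iff, Prod.norm_def]
      exact max_lt (by simpa using hb) hz
    obtain ⟨h1, h2⟩ := H _ hmem
    simp only [add_sub_cancel] at h1
    rw [IsRoot.def, IsRoot.def, h1, mul_eq_zero, or_iff_right h2]

theorem exists_root_of_natDegree_ne_zero {q : ℂ[X]} {m : ℕ} (hq : q.natDegree = m)
    (hm : m ≠ 0) : ∃ z, q.IsRoot z :=
  IsAlgClosed.exists_root q fun h => hm (hq ▸ natDegree_eq_zero_iff_degree_le_zero.2 h.le)

/-- If the number of roots is locally constant, each root extends to an analytic function, and
there is no other root nearby. -/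
theorem exists_local_root {p : ℂ → ℂ[X]} {d : ℕ}
    (hp : ∀ b, (p b).Monic ∧ (p b).natDegree = d) {a : ℂ}
    (hc : ∀ i, AnalyticAt ℂ (fun b => (p b).coeff i) a)
    (hcard : ∀ᶠ b in 𝓝 a, (p b).roots.toFinset.card = (p a).roots.toFinset.card) {z₀ : ℂ}
    (hz : (p a).IsRoot z₀) :
    ∃ ξ : ℂ → ℂ, AnalyticAt ℂ ξ a ∧ ξ a = z₀ ∧ ∃ δ > 0, ∀ᶠ b in 𝓝 a, ∀ z, ‖z - z₀‖ < δ →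
      ((p b).IsRoot z ↔ z = ξ b) := by
  have hroot : ∀ b z, z ∈ (p b).roots.toFinset ↔ (p b).IsRoot z := fun b z => by
    rw [Multiset.mem_toFinset, mem_roots (hp b).1.ne_zero]
  -- each disc around a root of `p a` contains a root of `p b`
  have hex : ∀ δ > 0, ∀ r ∈ (p a).roots.toFinset, ∀ᶠ b in 𝓝 a, ∃ z, ‖z - r‖ < δ ∧
      (p b).IsRoot z := by
    intro δ hδ r hr
    obtain ⟨m, Q, hm, hQ, hQa, hQc, δ', hδ', H⟩ := exists_local_weierstrass hp hc ((hroot a r).1 hr)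
    filter_upwards [H, eventually_norm_root_lt hQ hQa (fun i => (hQc i).continuousAt)
      (lt_min hδ hδ')] with b h1 h2
    obtain ⟨z, hz⟩ := exists_root_of_natDegree_ne_zero (hQ b).2 hm
    have h3 := h2 z hz
    exact ⟨r + z, by simpa using h3.trans_le (min_le_left _ _),
      (h1 z (h3.trans_le (min_le_right _ _))).2 hz⟩
  obtain ⟨m, Q, hm, hQ, hQa, hQc, δ', hδ', H⟩ := exists_local_weierstrass hp hc hz
  obtain ⟨δ, hδ, hδδ', hsep⟩ : ∃ δ > 0, δ ≤ δ' ∧ ∀ r ∈ (p a).roots.toFinset,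
      ∀ r' ∈ (p a).roots.toFinset, r ≠ r' → 2 * δ ≤ ‖r - r'‖ := by
    have h1 : ∀ r ∈ (p a).roots.toFinset, ∀ r' ∈ (p a).roots.toFinset, ∀ᶠ δ in 𝓝[>] (0 : ℝ),
        r ≠ r' → 2 * δ ≤ ‖r - r'‖ := by
      intro r _ r' _
      rcases eq_or_ne r r' with h | h
      · exact Eventually.of_forall fun _ hne => absurd h hne
      · have h2 : 0 < ‖r - r'‖ / 2 := half_pos (norm_pos_iff.2 (sub_ne_zero.2 h))
        filter_upwards [nhdsWithin_le_nhds (gt_mem_nhds h2)] with δ hδ _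
        linarith [show δ < ‖r - r'‖ / 2 from hδ]
    have h2 := (Finset.eventually_all _).2 fun r hr => (Finset.eventually_all _).2 (h1 r hr)
    have h3 : ∀ᶠ δ in 𝓝[>] (0 : ℝ), δ < δ' := nhdsWithin_le_nhds (gt_mem_nhds hδ')
    have h4 : ∀ᶠ δ in 𝓝[>] (0 : ℝ), 0 < δ := self_mem_nhdsWithin
    obtain ⟨δ, hδ⟩ := (h2.and (h3.and h4)).exists
    exact ⟨δ, hδ.2.2, le_of_lt hδ.2.1, hδ.1⟩
  -- by counting, each disc contains exactly one
  have huniq : ∀ᶠ b in 𝓝 a, ∃ z₁, ∀ z, ‖z - z₀‖ < δ → ((p b).IsRoot z ↔ z = z₁) := by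
    filter_upwards [hcard, (Finset.eventually_all _).2 (hex δ hδ)] with b hb hall
    choose! F hF using hall
    have hinj : Set.InjOn F (p a).roots.toFinset := by
      intro r hr r' hr' he
      by_contra hne
      have h1 := hsep r hr r' hr' hne
      have h2 := (hF r hr).1
      have h3 := (hF r' hr').1
      rw [← he] at h3
      have h4 : ‖r - r'‖ ≤ ‖F r - r‖ + ‖F r - r'‖ := by
        rw [norm_sub_rev (F r) r]
        simpa using norm_add_le (r - F r) (F r - r')
      linarith
    have himg : (p a).roots.toFinset.image F = (p b).roots.toFinset := by
      refine Finset.eq_of_subset_of_card_le (fun z hz => ?_) ?_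
      · obtain ⟨r, hr, rfl⟩ := Finset.mem_image.1 hz
        exact (hroot b _).2 (hF r hr).2
      · rw [hb, Finset.card_image_of_injOn hinj]
    have hz₀ := (hroot a z₀).2 hz
    refine ⟨F z₀, fun z hzδ => ⟨fun hzr => ?_, ?_⟩⟩
    · have h1 : z ∈ (p a).roots.toFinset.image F := himg ▸ (hroot b z).2 hzr
      obtain ⟨r, hr, rfl⟩ := Finset.mem_image.1 h1
      by_contra hne
      have h2 : r ≠ z₀ := fun h => hne (by rw [h])
      have h3 := hsep r hr z₀ hz₀ h2
      have h4 := (hF r hr).1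
      have h5 : ‖r - z₀‖ ≤ ‖F r - r‖ + ‖F r - z₀‖ := by
        rw [norm_sub_rev (F r) r]
        simpa using norm_add_le (r - F r) (F r - z₀)
      linarith
    · rintro rfl
      exact (hF z₀ hz₀).2
  refine ⟨fun b => z₀ - (Q b).coeff (m - 1) / m, analyticAt_const.sub
    ((hQc _).div analyticAt_const (by simpa using hm)), ?_, δ, hδ, ?_⟩
  · simp [hQa, coeff_X_pow, show m - 1 ≠ m by omega]
  · filter_upwards [huniq, H, eventually_norm_root_lt hQ hQa (fun i => (hQc i).continuousAt) hδ]
      with b ⟨z₁, hz₁⟩ hb hlt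
    suffices h : z₀ - (Q b).coeff (m - 1) / m = z₁ by
      intro z hz
      rw [hz₁ z hz, h]
    -- a single root of multiplicity `m` is recovered from the coefficient of degree `m - 1`
    have hrep : (Q b).roots = Multiset.replicate m (z₁ - z₀) := by
      rw [Multiset.eq_replicate]
      refine ⟨by rw [← (hQ b).2]; exact (IsAlgClosed.splits (Q b)).natDegree_eq_card_roots.symm,
        fun z hz => ?_⟩
      have hz := (mem_roots (hQ b).1.ne_zero).1 hz
      have h1 := hlt z hz
      have h2 := (hz₁ (z₀ + z) (by simpa using h1)).1 ((hb z (h1.trans_le hδδ')).2 hz)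
      rw [← h2, add_sub_cancel_left]
    have h1 := (IsAlgClosed.splits (Q b)).nextCoeff_eq_neg_sum_roots_of_monic (hQ b).1
    rw [nextCoeff_of_natDegree_pos (by rw [(hQ b).2]; omega), (hQ b).2, hrep,
      Multiset.sum_replicate, nsmul_eq_mul] at h1
    rw [h1]
    have : (m : ℂ) ≠ 0 := by exact_mod_cast hm
    field_simp
    ring

end LocalRoots

section Monodromy

variable {p : ℂ → ℂ[X]} {d m : ℕ} {R : ℝ}

/-- The total space of the family of roots over the unit disc. The roots are confined to a closed
disc of radius `R`, a bound for all of them, so that the projection is proper. -/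
def RootSpace (p : ℂ → ℂ[X]) (R : ℝ) : Type :=
  {q : Metric.ball (0 : ℂ) 1 × Metric.closedBall (0 : ℂ) R // (p q.1).IsRoot q.2}

noncomputable instance : MetricSpace (RootSpace p R) :=
  inferInstanceAs (MetricSpace {q : Metric.ball (0 : ℂ) 1 × Metric.closedBall (0 : ℂ) R //
    (p q.1).IsRoot q.2})

/-- The projection of the space of roots to the disc. -/
def RootSpace.proj (q : RootSpace p R) : Metric.ball (0 : ℂ) 1 := q.1.1

/-- If the number of roots is constant, the space of roots is a covering of the disc. -/
theorem isCoveringMap_rootSpace (hp : ∀ b, (p b).Monic ∧ (p b).natDegree = d)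
    (hc : ∀ b ∈ Metric.ball (0 : ℂ) 1, ∀ i, AnalyticAt ℂ (fun b => (p b).coeff i) b)
    (hcard : ∀ b ∈ Metric.ball (0 : ℂ) 1, (p b).roots.toFinset.card = m)
    (hR : ∀ b ∈ Metric.ball (0 : ℂ) 1, ∀ z, (p b).IsRoot z → ‖z‖ ≤ R) :
    IsCoveringMap (RootSpace.proj : RootSpace p R → _) := by
  have hcont : Continuous (RootSpace.proj : RootSpace p R → _) :=
    continuous_fst.comp continuous_subtype_val
  have hlocal : ∀ e : RootSpace p R, ∃ ξ : ℂ → ℂ, AnalyticAt ℂ ξ e.proj ∧ ξ e.proj = e.1.2 ∧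
      ∃ δ > 0, ∀ᶠ b in 𝓝 (e.proj : ℂ), ∀ z : ℂ, ‖z - (e.1.2 : ℂ)‖ < δ → ((p b).IsRoot z ↔ z = ξ b) := by
    intro e
    refine exists_local_root hp (hc _ e.proj.2) ?_ e.2
    filter_upwards [Metric.isOpen_ball.mem_nhds e.proj.2] with b hb
    rw [hcard b hb, hcard _ e.proj.2]
  have hclosed : IsClosedMap (RootSpace.proj : RootSpace p R → _) := by
    have h1 : IsClosed {q : Metric.ball (0 : ℂ) 1 × Metric.closedBall (0 : ℂ) R |
        (p q.1).IsRoot q.2} := by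
      refine isClosed_eq (f := fun q : Metric.ball (0 : ℂ) 1 × Metric.closedBall (0 : ℂ) R =>
        (p q.1).eval (q.2 : ℂ)) (continuous_iff_continuousAt.2 fun q => ?_) continuous_const
      have h2 := (analyticAt_eval (fun b => (hp b).2) (hc _ q.1.2) (q.2 : ℂ)).continuousAt
      exact ContinuousAt.comp (g := fun q : ℂ × ℂ => (p q.1).eval q.2)
        (f := fun q : Metric.ball (0 : ℂ) 1 × Metric.closedBall (0 : ℂ) R => ((q.1 : ℂ), (q.2 : ℂ)))
        h2 (by fun_prop)
    exact (isClosedMap_fst_of_compactSpace (Y := Metric.closedBall (0 : ℂ) R)).comp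
      h1.isClosedEmbedding_subtypeVal.isClosedMap
  -- the local roots lift a neighborhood of each point
  have hopen : IsOpenMap (RootSpace.proj : RootSpace p R → _) := by
    refine isOpenMap_iff_nhds_le.2 fun e N hN => ?_
    obtain ⟨ξ, hξ, hξe, δ, hδ, H⟩ := hlocal e
    obtain ⟨ε, hε, hεN⟩ := Metric.mem_nhds_iff.1 (mem_map.1 hN)
    have h1 : ∀ᶠ b in 𝓝 (e.proj : ℂ), ‖ξ b - (e.1.2 : ℂ)‖ < min ε δ := by
      have h2 := (hξ.continuousAt.sub (continuousAt_const (y := (e.1.2 : ℂ)))).norm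
      have h3 : Tendsto (fun b => ‖ξ b - (e.1.2 : ℂ)‖) (𝓝 (e.proj : ℂ)) (𝓝 0) := by
        simpa [ContinuousAt, hξe] using h2
      exact h3.eventually (gt_mem_nhds (lt_min hε hδ))
    have h2 := (continuous_subtype_val.tendsto e.proj).eventually (h1.and H)
    filter_upwards [h2, Metric.ball_mem_nhds e.proj hε] with b ⟨h3, h4⟩ hb
    have hroot : (p b).IsRoot (ξ b) := (h4 _ (h3.trans_le (min_le_right _ _))).2 rfl
    refine hεN (a := (⟨(b, ⟨ξ b, by simpa using hR b b.2 _ hroot⟩), hroot⟩ : RootSpace p R)) ?_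
    change max (dist b e.proj) (dist (ξ b) (e.1.2 : ℂ)) < ε
    rw [Complex.dist_eq (ξ b)]
    exact max_lt hb (h3.trans_le (min_le_left _ _))
  have hlh : IsLocalHomeomorph (RootSpace.proj : RootSpace p R → _) := by
    refine isLocalHomeomorph_iff_isOpenEmbedding_restrict.2 fun e => ?_
    obtain ⟨ξ, hξ, hξe, δ, hδ, H⟩ := hlocal e
    have h1 : ∀ᶠ q in 𝓝 e, ∀ z : ℂ, ‖z - (e.1.2 : ℂ)‖ < δ → ((p q.proj).IsRoot z ↔ z = ξ q.proj) :=
      ((continuous_subtype_val.comp hcont).tendsto e).eventually H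
    have h2 : ∀ᶠ q in 𝓝 e, ‖(q.1.2 : ℂ) - (e.1.2 : ℂ)‖ < δ := by
      filter_upwards [Metric.ball_mem_nhds e hδ] with q hq
      have h3 : max (dist q.proj e.proj) (dist (q.1.2 : ℂ) (e.1.2 : ℂ)) < δ := hq
      rw [Complex.dist_eq] at h3
      exact (le_max_right _ _).trans_lt h3
    obtain ⟨U, hU, hUo, heU⟩ := eventually_nhds_iff.1 (h1.and h2)
    refine ⟨U, hUo.mem_nhds heU, .of_continuous_injective_isOpenMap
      (hcont.comp continuous_subtype_val) ?_ (hopen.comp hUo.isOpenMap_subtype_val)⟩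
    rintro ⟨q, hq⟩ ⟨q', hq'⟩ (hqq : q.proj = q'.proj)
    have e1 : (q.1.2 : ℂ) = ξ q.proj := ((hU q hq).1 _ (hU q hq).2).1 q.2
    have e2 : (q'.1.2 : ℂ) = ξ q'.proj := ((hU q' hq').1 _ (hU q' hq').2).1 q'.2
    refine Subtype.ext (Subtype.ext (Prod.ext hqq (Subtype.ext ?_)))
    rw [e1, e2, hqq]
  rw [isCoveringMap_iff_isCoveringMapOn_univ]
  refine hclosed.isCoveringMapOn_of_isLocalHomeomorphOn (fun b _ => ?_)
    hlh.isLocalHomeomorphOn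
  refine Set.Finite.of_finite_image (f := fun q : RootSpace p R => (q.1.2 : ℂ))
    (((p b).roots.toFinset.finite_toSet).subset ?_) ?_
  · rintro _ ⟨q, hq, rfl⟩
    have hq : q.proj = b := hq
    rw [Finset.mem_coe, Multiset.mem_toFinset, mem_roots (hp b).1.ne_zero, ← hq]
    exact q.2
  · intro q hq q' hq' h
    exact Subtype.ext (Prod.ext ((show q.proj = b from hq).trans (show q'.proj = b from hq').symm)
      (Subtype.ext h))

/-- Since the disc is simply connected, every root of a single polynomial extends to a holomorphic
function on the disc. -/
theorem exists_root_section (hp : ∀ b, (p b).Monic ∧ (p b).natDegree = d)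
    (hc : ∀ b ∈ Metric.ball (0 : ℂ) 1, ∀ i, AnalyticAt ℂ (fun b => (p b).coeff i) b)
    (hcard : ∀ b ∈ Metric.ball (0 : ℂ) 1, (p b).roots.toFinset.card = m)
    (hR : ∀ b ∈ Metric.ball (0 : ℂ) 1, ∀ z, (p b).IsRoot z → ‖z‖ ≤ R)
    {a z₀ : ℂ} (ha : a ∈ Metric.ball (0 : ℂ) 1) (hz : (p a).IsRoot z₀) :
    ∃ ξ : ℂ → ℂ, AnalyticOnNhd ℂ ξ (Metric.ball 0 1) ∧ ξ a = z₀ ∧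
      ∀ b ∈ Metric.ball (0 : ℂ) 1, (p b).IsRoot (ξ b) := by
  have hcov := isCoveringMap_rootSpace hp hc hcard hR
  have : ContractibleSpace (Metric.ball (0 : ℂ) 1) :=
    (convex_ball (0 : ℂ) 1).contractibleSpace ⟨a, ha⟩
  have : LocallyPathConnectedSpace (Metric.ball (0 : ℂ) 1) :=
    Metric.isOpen_ball.locallyPathConnectedSpace
  obtain ⟨F, ⟨hFa, hF⟩, -⟩ := hcov.existsUnique_continuousMap_lifts
    (ContinuousMap.id (Metric.ball (0 : ℂ) 1)) ⟨a, ha⟩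
    ⟨(⟨a, ha⟩, ⟨z₀, by simpa using hR a ha z₀ hz⟩), hz⟩ rfl
  have hF : ∀ b, (F b).proj = b := fun b => congrFun hF b
  classical
  set ξ : ℂ → ℂ := fun b => if h : b ∈ Metric.ball (0 : ℂ) 1 then ((F ⟨b, h⟩).1.2 : ℂ) else 0
    with hξdef
  have hξ : ∀ b : Metric.ball (0 : ℂ) 1, ξ b = (F b).1.2 := fun b => dif_pos b.2
  have hroot : ∀ b ∈ Metric.ball (0 : ℂ) 1, (p b).IsRoot (ξ b) := by
    intro b hb
    rw [hξ ⟨b, hb⟩]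
    have h1 := (F ⟨b, hb⟩).2
    rwa [show (F ⟨b, hb⟩).1.1 = ⟨b, hb⟩ from hF _] at h1
  have hcont : ContinuousOn ξ (Metric.ball 0 1) := by
    rw [continuousOn_iff_continuous_domRestrict]
    have h1 : (Metric.ball (0 : ℂ) 1).domRestrict ξ = fun b => ((F b).1.2 : ℂ) := funext hξ
    rw [h1]
    exact continuous_subtype_val.comp (continuous_snd.comp (continuous_subtype_val.comp F.continuous))
  refine ⟨ξ, fun b hb => ?_, ?_, hroot⟩
  · obtain ⟨η, hη, hηb, δ, hδ, H⟩ := exists_local_root hp (hc b hb)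
      (by filter_upwards [Metric.isOpen_ball.mem_nhds hb] with b' hb'; rw [hcard b' hb', hcard b hb])
      (hroot b hb)
    refine hη.congr ?_
    have h1 : ∀ᶠ b' in 𝓝 b, ‖ξ b' - ξ b‖ < δ := by
      have := (hcont.continuousAt (Metric.isOpen_ball.mem_nhds hb)).eventually
        (Metric.ball_mem_nhds (ξ b) hδ)
      simpa only [Metric.mem_ball, Complex.dist_eq] using this
    filter_upwards [H, h1, Metric.isOpen_ball.mem_nhds hb] with b' h2 h3 h4
    exact ((h2 _ h3).1 (hroot b' h4)).symm
  · rw [hξ ⟨a, ha⟩, hFa]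

/-- Two holomorphic roots that agree at one point are equal. -/
theorem eqOn_of_root_sections (hp : ∀ b, (p b).Monic ∧ (p b).natDegree = d)
    (hc : ∀ b ∈ Metric.ball (0 : ℂ) 1, ∀ i, AnalyticAt ℂ (fun b => (p b).coeff i) b)
    (hcard : ∀ b ∈ Metric.ball (0 : ℂ) 1, (p b).roots.toFinset.card = m)
    {ξ η : ℂ → ℂ} (hξ : AnalyticOnNhd ℂ ξ (Metric.ball 0 1))
    (hη : AnalyticOnNhd ℂ η (Metric.ball 0 1))
    (hξr : ∀ b ∈ Metric.ball (0 : ℂ) 1, (p b).IsRoot (ξ b))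
    (hηr : ∀ b ∈ Metric.ball (0 : ℂ) 1, (p b).IsRoot (η b)) {b : ℂ}
    (hb : b ∈ Metric.ball (0 : ℂ) 1) (he : ξ b = η b) : Set.EqOn ξ η (Metric.ball 0 1) := by
  refine hξ.eqOn_of_preconnected_of_eventuallyEq hη (convex_ball 0 1).isPreconnected hb ?_
  obtain ⟨ζ, -, -, δ, hδ, H⟩ := exists_local_root hp (hc b hb)
    (by filter_upwards [Metric.isOpen_ball.mem_nhds hb] with b' hb'; rw [hcard b' hb', hcard b hb])
    (hξr b hb)
  have h1 : ∀ θ : ℂ → ℂ, AnalyticOnNhd ℂ θ (Metric.ball 0 1) → θ b = ξ b →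
      ∀ᶠ b' in 𝓝 b, ‖θ b' - ξ b‖ < δ := fun θ hθ hb' => by
    have := (hθ b hb).continuousAt.eventually (Metric.ball_mem_nhds (θ b) hδ)
    simpa only [Metric.mem_ball, Complex.dist_eq, hb'] using this
  filter_upwards [H, h1 ξ hξ rfl, h1 η hη he.symm, Metric.isOpen_ball.mem_nhds hb] with b' h2 h3 h4 h5
  rw [(h2 _ h3).1 (hξr b' h5), (h2 _ h4).1 (hηr b' h5)]

end Monodromy

/-! ### A Harnack inequality for differences of roots -/

section Harnack

/-- A nonvanishing function bounded by `1` on the unit disc that is small at the origin is small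
nearby: Harnack's inequality for the harmonic function `log ‖h‖`. -/
theorem norm_le_rpow_of_forall_ne_zero {h : ℂ → ℂ} (hh : AnalyticOnNhd ℂ h (Metric.ball 0 1))
    (h0 : ∀ b ∈ Metric.ball (0 : ℂ) 1, h b ≠ 0) (h1 : ∀ b ∈ Metric.ball (0 : ℂ) 1, ‖h b‖ ≤ 1)
    {b : ℂ} (hb : b ∈ Metric.ball (0 : ℂ) 1) :
    ‖h b‖ ≤ ‖h 0‖ ^ (1 - 2 * ‖b‖ / (1 - ‖b‖)) := by
  have h0m : (0 : ℂ) ∈ Metric.ball (0 : ℂ) 1 := Metric.mem_ball_self one_pos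
  have hpos : 0 < ‖h 0‖ := norm_pos_iff.2 (h0 0 h0m)
  rcases (h1 0 h0m).lt_or_eq with hlt | heq
  swap
  · rw [heq, Real.one_rpow]; exact h1 b hb
  set M := -Real.log ‖h 0‖ with hMdef
  have hM : 0 < M := neg_pos.2 (Real.log_neg hpos hlt)
  have hdiff : DifferentiableOn ℂ (fun z => deriv h z / h z) (Metric.ball 0 1) := fun z hz =>
    (((hh z hz).deriv.div (hh z hz) (h0 z hz)).differentiableAt).differentiableWithinAt
  obtain ⟨g, hg0, hg⟩ := hdiff.isExactOn_ball.with_val_at 0 0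
  -- `g` is a primitive of the logarithmic derivative, so `h = h 0 * exp g`
  have hexp : ∀ z ∈ Metric.ball (0 : ℂ) 1, h z = h 0 * Complex.exp (g z) := by
    have hd : ∀ z ∈ Metric.ball (0 : ℂ) 1,
        HasDerivAt (fun z => h z * Complex.exp (-g z)) 0 z := by
      intro z hz
      have h2 := (hh z hz).differentiableAt.hasDerivAt.mul (hg z hz).neg.cexp
      convert! h2 using 1
      field_simp [h0 z hz]
      ring
    intro z hz
    have h2 := Metric.isOpen_ball.is_const_of_deriv_eq_zero (convex_ball (0 : ℂ) 1).isPreconnected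
      (fun z hz => (hd z hz).differentiableAt.differentiableWithinAt)
      (fun z hz => (hd z hz).deriv) hz h0m
    simp only [hg0, neg_zero, Complex.exp_zero, mul_one] at h2
    rw [← h2, mul_assoc, ← Complex.exp_add, neg_add_cancel, Complex.exp_zero, mul_one]
  have hnorm : ∀ z ∈ Metric.ball (0 : ℂ) 1, ‖h z‖ = Real.exp (-M + (g z).re) := by
    intro z hz
    rw [hexp z hz, norm_mul, Complex.norm_exp, Real.exp_add, hMdef, neg_neg, Real.exp_log hpos]
  -- `‖h‖ ≤ 1` bounds the real part of `g`, and Borel and Carathéodory bound its modulus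
  have hbc : ‖g b‖ ≤ 2 * M * ‖b‖ / (1 - ‖b‖) := by
    refine Complex.borelCaratheodory_zero hM
      (fun z hz => (hg z hz).differentiableAt.differentiableWithinAt) (fun z hz => ?_) one_pos hb hg0
    have h2 := h1 z hz
    rw [hnorm z hz, Real.exp_le_one_iff] at h2
    change (g z).re ≤ M
    linarith
  rw [hnorm b hb, Real.rpow_def_of_pos hpos, Real.exp_le_exp]
  have h2 := (Complex.re_le_norm _).trans hbc
  have h3 : Real.log ‖h 0‖ * (1 - 2 * ‖b‖ / (1 - ‖b‖)) = -M + 2 * M * ‖b‖ / (1 - ‖b‖) := by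
    rw [hMdef]; ring
  rw [h3]
  linarith

/-- The differences of the roots of a family with a constant number of roots are nonvanishing
functions on the disc, so Harnack's inequality applies to them. -/
theorem norm_sub_root_le {p : ℂ → ℂ[X]} {d m : ℕ} (hp : ∀ b, (p b).Monic ∧ (p b).natDegree = d)
    (hc : ∀ b ∈ Metric.ball (0 : ℂ) 1, ∀ i, AnalyticAt ℂ (fun b => (p b).coeff i) b)
    (hcard : ∀ b ∈ Metric.ball (0 : ℂ) 1, (p b).roots.toFinset.card = m)
    (hR : ∀ b ∈ Metric.ball (0 : ℂ) 1, ∀ z, (p b).IsRoot z → ‖z‖ ≤ 1 / 2) {B : ℝ} (hB0 : 0 ≤ B)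
    (hB : ∀ z z', (p 0).IsRoot z → (p 0).IsRoot z' → ‖z - z'‖ ≤ B) {a : ℂ} (ha : ‖a‖ ≤ 1 / 3)
    {z z' : ℂ} (hz : (p a).IsRoot z) (hz' : (p a).IsRoot z') :
    ‖z - z'‖ ≤ B ^ (1 - 2 * ‖a‖ / (1 - ‖a‖)) := by
  rcases eq_or_ne z z' with rfl | hne
  · rw [sub_self, norm_zero]
    exact Real.rpow_nonneg hB0 _
  have ham : a ∈ Metric.ball (0 : ℂ) 1 := by rw [mem_ball_zero_iff]; linarith
  obtain ⟨ξ, hξ, rfl, hξr⟩ := exists_root_section hp hc hcard hR ham hz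
  obtain ⟨η, hη, rfl, hηr⟩ := exists_root_section hp hc hcard hR ham hz'
  have h0m : (0 : ℂ) ∈ Metric.ball (0 : ℂ) 1 := Metric.mem_ball_self one_pos
  refine (norm_le_rpow_of_forall_ne_zero (hξ.sub hη) (fun b hb h => hne ?_) (fun b hb => ?_)
    ham).trans (Real.rpow_le_rpow (norm_nonneg _) (hB _ _ (hξr 0 h0m) (hηr 0 h0m)) ?_)
  · exact eqOn_of_root_sections hp hc hcard hξ hη hξr hηr hb (sub_eq_zero.1 h) ham
  · refine (norm_sub_le _ _).trans ?_
    linarith [hR b hb _ (hξr b hb), hR b hb _ (hηr b hb)]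
  · rw [sub_nonneg, div_le_one (by linarith)]
    linarith

end Harnack

/-! ### Equimultiplicity of families of polynomials with a constant number of roots -/

section Equimultiplicity

variable {S Y : Type*} [NormedAddCommGroup S] [NormedSpace ℂ S] [NormedAddCommGroup Y]
  [NormedSpace ℂ Y]

omit [NormedSpace ℂ Y] in
/-- Along a cone of directions on which the number of roots is constant in the parameter, root
differences that are `O(‖x‖)` for the central member are `O(‖x‖ ^ θ)` for its neighbors, with
`θ` as close to `1` as required. -/
theorem exists_norm_sub_root_le {P : S × Y → ℂ[X]} {d m : ℕ}
    (hP : ∀ w, (P w).Monic ∧ (P w).natDegree = d) {O : Set Y} {ε C r : ℝ}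
    (hr : 0 < r) (hr3 : r ≤ 1 / 3) (hC : 0 ≤ C)
    (hc : ∀ s x, ‖s‖ < ε → ‖x‖ < ε → ∀ i, AnalyticAt ℂ (fun s => (P (s, x)).coeff i) s)
    (hcard : ∀ s x, ‖s‖ < ε → ‖x‖ < ε → x ∈ O → (P (s, x)).roots.toFinset.card = m)
    (hR : ∀ s x, ‖s‖ < ε → ‖x‖ < ε → ∀ z, (P (s, x)).IsRoot z → ‖z‖ ≤ 1 / 2)
    (h0 : ∀ x, ‖x‖ < ε → ∀ z, (P (0, x)).IsRoot z → ‖z‖ ≤ C * ‖x‖) {s : S} {x : Y}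
    (hs : ‖s‖ < r * ε) (hx : ‖x‖ < ε) (hxO : x ∈ O) {z z' : ℂ} (hz : (P (s, x)).IsRoot z)
    (hz' : (P (s, x)).IsRoot z') :
    ‖z - z'‖ ≤ (2 * C * ‖x‖) ^ (1 - 2 * r / (1 - r)) := by
  have hr0 : (r : ℂ) ≠ 0 := by exact_mod_cast hr.ne'
  have hsm : ∀ b ∈ Metric.ball (0 : ℂ) 1, ‖(b / r) • s‖ < ε := by
    intro b hb
    rw [mem_ball_zero_iff] at hb
    have hr' : ‖(r : ℂ)‖ = r := by rw [Complex.norm_real, Real.norm_of_nonneg hr.le]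
    rw [norm_smul, norm_div, hr']
    calc ‖b‖ / r * ‖s‖ ≤ 1 / r * ‖s‖ := by gcongr
      _ < 1 / r * (r * ε) := by gcongr
      _ = ε := by field_simp
  have hra : ‖(r : ℂ)‖ = r := by rw [Complex.norm_real, Real.norm_of_nonneg hr.le]
  -- the complex disc through `0` and `s` that meets `s` at the parameter `r`
  have key := norm_sub_root_le (p := fun b : ℂ => P ((b / r) • s, x)) (m := m) (B := 2 * C * ‖x‖)
    (a := (r : ℂ)) (z := z) (z' := z')
    (fun b => hP _) (fun b hb i => ?_) (fun b hb => hcard _ _ (hsm b hb) hx hxO)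
    (fun b hb => hR _ _ (hsm b hb) hx) (by positivity) (fun z z' hz hz' => ?_) (by rw [hra]; exact hr3)
    (by simpa [hr0] using hz) (by simpa [hr0] using hz')
  · rwa [hra] at key
  · refine AnalyticAt.comp (g := fun s => (P (s, x)).coeff i) (f := fun b : ℂ => (b / r) • s)
      (hc _ _ (hsm b hb) hx i) ?_
    exact (analyticAt_id.div analyticAt_const hr0).smul analyticAt_const
  · simp only [zero_div, zero_smul] at hz hz'
    refine (norm_sub_le _ _).trans ?_
    linarith [h0 x hx z hz, h0 x hx z' hz']

/-- Each entry of a tuple is as close to the average as the entries are to one another. -/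
theorem norm_sub_average_le {d : ℕ} (hd : d ≠ 0) {ξ : Fin d → ℂ} {B : ℝ}
    (h : ∀ i j, ‖ξ i - ξ j‖ ≤ B) (i : Fin d) : ‖ξ i - (∑ j, ξ j) / d‖ ≤ B := by
  have hd' : (d : ℂ) ≠ 0 := by exact_mod_cast hd
  have h1 : ξ i - (∑ j, ξ j) / d = (∑ j, (ξ i - ξ j)) / d := by
    rw [Finset.sum_sub_distrib, Finset.sum_const, Finset.card_univ, Fintype.card_fin, nsmul_eq_mul]
    field_simp
  rw [h1, norm_div, Complex.norm_natCast, div_le_iff₀ (by positivity)]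
  refine (norm_sum_le _ _).trans ((Finset.sum_le_sum fun j _ => h i j).trans ?_)
  simp [mul_comm]

/-- Roots that are `O(|c| ^ θ)` on a punctured neighborhood, with `θ` close to `1`, force the
coefficients to have the orders of those of a homogeneous polynomial. -/
theorem isBigO_coeff_of_norm_root_le {p : ℂ → ℂ[X]} {d : ℕ}
    (hp : ∀ c, (p c).Monic ∧ (p c).natDegree = d)
    (hc : ∀ i, AnalyticAt ℂ (fun c => (p c).coeff i) 0) {θ K : ℝ} (hθ : (d : ℝ) - 1 < d * θ)
    (hθ1 : θ ≤ 1)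
    (hr : ∀ᶠ c in 𝓝[≠] (0 : ℂ), ∀ z, (p c).IsRoot z → ‖z‖ ≤ K * ‖c‖ ^ θ) {j : ℕ} (hj : j ≤ d) :
    (fun c => (p c).coeff (d - j)) =O[𝓝 0] fun c : ℂ => c ^ j := by
  refine isBigO_pow_of_isBigO_rpow (q := j * θ) (hc _) ?_ ?_
  · have h1 : ((d : ℝ) - j) * (1 - θ) ≥ 0 :=
      mul_nonneg (sub_nonneg.2 (by exact_mod_cast hj)) (sub_nonneg.2 hθ1)
    nlinarith
  · refine Asymptotics.IsBigO.of_bound (K ^ j * (d.choose (d - j))) ?_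
    filter_upwards [hr] with c hc
    have h1 := coeff_le_of_roots_le (p := p c) (f := RingHom.id ℂ) (B := K * ‖c‖ ^ θ) (d - j)
      (hp c).1 (by simpa using IsAlgClosed.splits (p c)) (by
        intro z hz
        rw [Polynomial.map_id] at hz
        exact hc z ((mem_roots (hp c).1.ne_zero).1 hz))
    rw [Polynomial.map_id, (hp c).2, Nat.sub_sub_self hj] at h1
    refine h1.trans (le_of_eq ?_)
    rw [Real.norm_of_nonneg (by positivity), mul_pow, mul_comm (j : ℝ) θ,
      Real.rpow_mul (norm_nonneg c), Real.rpow_natCast]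
    ring

theorem eventually_analyticAt_coeff {E : Type*} [NormedAddCommGroup E] [NormedSpace ℂ E]
    {P : E → ℂ[X]} {d : ℕ} (hP : ∀ w, (P w).natDegree = d) {w₀ : E}
    (hc : ∀ i, AnalyticAt ℂ (fun w => (P w).coeff i) w₀) :
    ∀ᶠ w in 𝓝 w₀, ∀ i, AnalyticAt ℂ (fun w => (P w).coeff i) w := by
  filter_upwards [(Finset.eventually_all (Finset.range (d + 1))).2 fun i _ =>
    (hc i).eventually_analyticAt] with w hw i
  rcases lt_or_ge i (d + 1) with hi | hi
  · exact hw i (Finset.mem_range.2 hi)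
  · have : ∀ w, (P w).coeff i = 0 := fun w => coeff_eq_zero_of_natDegree_lt (by rw [hP]; omega)
    simpa only [this] using analyticAt_const

/-- If the number of roots of `P (s, x)` is constant for `s` near `0` and small `x` in an open cone,
the roots of the central member are `O(‖x‖)`, and `P (s, 0)` has the root `0`, then all the members
are equimultiple with the central one along `x = 0`. The differences of the roots are controlled by
Harnack's inequality, and so is their distance to their average, a coefficient. -/
theorem eventually_isBigO_coeff {P : S × Y → ℂ[X]} {d m : ℕ}
    (hP : ∀ w, (P w).Monic ∧ (P w).natDegree = d) (hP0 : P 0 = X ^ d)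
    (hc : ∀ i, AnalyticAt ℂ (fun w => (P w).coeff i) 0) {O : Set Y} (hO : IsOpen O)
    (hne : O.Nonempty) (hcone : ∀ v ∈ O, ∀ c : ℂ, c ≠ 0 → c • v ∈ O)
    (hcard : ∀ᶠ q in 𝓝 (0 : S × Y), q.2 ∈ O → (P q).roots.toFinset.card = m) {C : ℝ} (hC : 0 ≤ C)
    (h0 : ∀ᶠ x in 𝓝 (0 : Y), ∀ z, (P (0, x)).IsRoot z → ‖z‖ ≤ C * ‖x‖)
    (hsec : ∀ᶠ s in 𝓝 (0 : S), (P (s, 0)).IsRoot 0) :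
    ∀ᶠ s in 𝓝 (0 : S), P (s, 0) = X ^ d ∧
      ∀ j ≤ d, (fun x => (P (s, x)).coeff (d - j)) =O[𝓝 0] fun x => ‖x‖ ^ j := by
  rcases eq_or_ne d 0 with rfl | hd
  · have h1 : ∀ w, P w = 1 := fun w => (hP w).1.natDegree_eq_zero.1 (hP w).2
    refine Eventually.of_forall fun s => ⟨by simp [h1], fun j hj => ?_⟩
    obtain rfl : j = 0 := by omega
    simpa [h1] using Asymptotics.isBigO_refl (fun _ : Y => (1 : ℝ)) (𝓝 0)
  obtain ⟨ε₁, hε₁, H₁⟩ := Metric.eventually_nhds_iff_ball.1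
    (((eventually_analyticAt_coeff (fun w => (hP w).2) hc).and hcard).and
      (eventually_norm_root_lt hP hP0 (fun i => (hc i).continuousAt) one_half_pos))
  obtain ⟨ε₂, hε₂, H₂⟩ := Metric.eventually_nhds_iff_ball.1 h0
  set ε := min ε₁ ε₂ with hεdef
  have hε : 0 < ε := lt_min hε₁ hε₂
  have H : ∀ s : S, ∀ x : Y, ‖s‖ < ε → ‖x‖ < ε → (s, x) ∈ Metric.ball (0 : S × Y) ε₁ := by
    intro s x hs hx
    rw [mem_ball_zero_iff, Prod.norm_def]
    exact max_lt (hs.trans_le (min_le_left _ _)) (hx.trans_le (min_le_left _ _))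
  -- this radius makes the Harnack exponent larger than `1 - 1 / d`
  set r : ℝ := 1 / (4 * (d + 1)) with hrdef
  have hd1 : (1 : ℝ) ≤ d := by exact_mod_cast Nat.one_le_iff_ne_zero.2 hd
  have hr : 0 < r := by positivity
  have hr3 : r ≤ 1 / 3 := one_div_le_one_div_of_le (by norm_num) (by linarith)
  set θ : ℝ := 1 - 2 * r / (1 - r) with hθdef
  have hθeq : θ = 1 - 2 / (4 * d + 3) := by
    have h1 : 1 - r = (4 * d + 3) / (4 * (d + 1)) := by rw [hrdef]; field_simp; ring
    rw [hθdef, h1, hrdef]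
    field_simp
  have hθ1 : θ ≤ 1 := by
    rw [hθeq]; linarith [show 0 ≤ 2 / (4 * (d : ℝ) + 3) by positivity]
  have hfrac : d * (2 / (4 * (d : ℝ) + 3)) < 1 := by
    rw [mul_div_assoc', div_lt_one (by positivity)]; linarith
  have hθd : (d : ℝ) - 1 < d * θ := by
    rw [hθeq, mul_sub]; linarith
  have hθ0 : 0 < θ := by
    have h1 : 0 < d * θ := by linarith
    exact (pos_iff_pos_of_mul_pos h1).1 (by linarith)
  filter_upwards [Metric.ball_mem_nhds (0 : S) (mul_pos hr hε), Metric.ball_mem_nhds (0 : S) hε, hsec]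
    with s hs hsε hs0
  rw [mem_ball_zero_iff] at hs hsε
  have hcs : ∀ x : Y, ‖x‖ < ε → ∀ i, AnalyticAt ℂ (fun x => (P (s, x)).coeff i) x := fun x hx i =>
    AnalyticAt.comp (g := fun w => (P w).coeff i) (f := fun x : Y => (s, x))
      ((H₁ _ (H s x hsε hx)).1.1 i) (analyticAt_const.prod analyticAt_id)
  have hcs0 : ∀ i, AnalyticAt ℂ (fun x => (P (s, x)).coeff i) 0 := hcs 0 (by simpa using hε)
  set A : Y → ℂ := fun x => -(P (s, x)).coeff (d - 1) / d with hAdef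
  have hA : AnalyticAt ℂ A 0 := (hcs0 _).neg.div analyticAt_const (by simpa using hd)
  have hrootA : ∀ x ∈ O, ‖x‖ < ε → ∀ z, (P (s, x)).IsRoot z →
      ‖z - A x‖ ≤ (2 * C * ‖x‖) ^ θ := by
    intro x hxO hx z hz
    obtain ⟨ξ, hξ, -⟩ := exists_roots_tuple (hP (s, x)).1 (hP (s, x)).2
    have hroot : ∀ z, (P (s, x)).IsRoot z ↔ ∃ i, ξ i = z := fun z => by
      rw [← mem_roots (hP (s, x)).1.ne_zero, hξ]; simp
    have hAx : A x = (∑ j, ξ j) / d := by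
      have h1 := (IsAlgClosed.splits (P (s, x))).nextCoeff_eq_neg_sum_roots_of_monic (hP (s, x)).1
      rw [nextCoeff_of_natDegree_pos (by rw [(hP (s, x)).2]; omega), (hP (s, x)).2, hξ] at h1
      rw [hAdef]
      simp only [h1, neg_neg]
      rfl
    obtain ⟨i, rfl⟩ := (hroot z).1 hz
    rw [hAx]
    refine norm_sub_average_le hd (fun i j => ?_) i
    refine exists_norm_sub_root_le hP hr hr3 hC (m := m) (O := O) (ε := ε) (fun s x hs hx i => ?_)
      (fun s x hs hx => (H₁ _ (H s x hs hx)).1.2)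
      (fun s x hs hx z hz => ((H₁ _ (H s x hs hx)).2 z hz).le)
      (fun x hx => H₂ x (by simpa using hx.trans_le (min_le_right _ _))) hs hx hxO
      ((hroot _).2 ⟨i, rfl⟩) ((hroot _).2 ⟨j, rfl⟩)
    exact AnalyticAt.comp (g := fun w => (P w).coeff i) (f := fun s : S => (s, x))
      ((H₁ _ (H s x hs hx)).1.1 i) (analyticAt_id.prod analyticAt_const)
  have hline : ∀ v : Y, Tendsto (fun c : ℂ => c • v) (𝓝[≠] 0) (𝓝 0) := fun v =>
    ((continuous_id.smul continuous_const).tendsto' (0 : ℂ) (0 : Y) (by simp)).mono_left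
      nhdsWithin_le_nhds
  have hsmall : ∀ v : Y, ∀ᶠ c : ℂ in 𝓝[≠] 0, ‖c • v‖ < ε := fun v => by
    simpa using (hline v).eventually (Metric.ball_mem_nhds 0 hε)
  -- the average of the roots vanishes at the origin: otherwise no root could tend to `0`
  have hA0 : A 0 = 0 := by
    by_contra hA0
    obtain ⟨v, hv⟩ := hne
    have hρ : 0 < ‖A 0‖ / 2 := half_pos (norm_pos_iff.2 hA0)
    have h1 : Tendsto (fun c : ℂ => ‖A (c • v)‖ - (2 * C * ‖c • v‖) ^ θ) (𝓝[≠] 0)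
        (𝓝 (‖A 0‖ - 0)) := by
      refine (hA.continuousAt.norm.tendsto.comp (hline v)).sub ?_
      have h2 : Tendsto (fun x : Y => (2 * C * ‖x‖) ^ θ) (𝓝 0) (𝓝 0) := by
        have h3 : Continuous fun x : Y => (2 * C * ‖x‖) ^ θ :=
          (by fun_prop : Continuous fun x : Y => 2 * C * ‖x‖).rpow_const fun _ => Or.inr hθ0.le
        exact h3.tendsto' 0 0 (by simp [Real.zero_rpow hθ0.ne'])
      exact h2.comp (hline v)
    have h2 : Tendsto (fun c : ℂ => ‖(P (s, c • v)).eval 0‖) (𝓝[≠] 0) (𝓝 0) := by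
      have h3 := ((hcs0 0).continuousAt.norm.tendsto.comp (hline v))
      simp only [coeff_zero_eq_eval_zero] at h3
      rwa [show (P (s, 0)).eval 0 = 0 from hs0, norm_zero] at h3
    obtain ⟨c, hc1, hc2, hc3, hc4⟩ := ((h1.eventually (lt_mem_nhds (a := ‖A 0‖ / 2) (by linarith))).and
      ((h2.eventually (gt_mem_nhds (pow_pos hρ d))).and
        ((hsmall v).and self_mem_nhdsWithin))).exists
    obtain ⟨ξ, hξ, hprod⟩ := exists_roots_tuple (hP (s, c • v)).1 (hP (s, c • v)).2
    have h3 : (‖A 0‖ / 2) ^ d ≤ ‖(P (s, c • v)).eval 0‖ := by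
      rw [hprod, eval_prod, norm_prod]
      have h4 : ∏ _i : Fin d, (‖A 0‖ / 2) = (‖A 0‖ / 2) ^ d := by
        rw [Finset.prod_const, Finset.card_univ, Fintype.card_fin]
      rw [← h4]
      refine Finset.prod_le_prod (fun _ _ => hρ.le) fun i _ => ?_
      have h5 := hrootA _ (hcone v hv c hc4) hc3 (ξ i) (by
        rw [← mem_roots (hP (s, c • v)).1.ne_zero, hξ]; simp)
      have h6 := norm_sub_norm_le (A (c • v)) (ξ i)
      rw [norm_sub_rev] at h6
      simp only [eval_sub, eval_X, eval_C, zero_sub, norm_neg]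
      linarith
    exact absurd hc2 (not_lt.2 h3)
  have hbig : ∀ j ≤ d, (fun x => (P (s, x)).coeff (d - j)) =O[𝓝 0] fun x => ‖x‖ ^ j := by
    intro j hj
    have h1 := isBigO_of_isBigO_lines (n := j) (hcs0 (d - j)) hO hne fun v hv => ?_
    · simpa using h1
    have hlin : AnalyticAt ℂ (fun c : ℂ => c • v) 0 := analyticAt_id.smul analyticAt_const
    have hAv : AnalyticAt ℂ (fun c : ℂ => A (c • v)) 0 :=
      AnalyticAt.comp (g := A) (f := fun c : ℂ => c • v) (by simpa using hA) hlin
    obtain ⟨K, hK, hKb⟩ := (hAv.differentiableAt.isBigO_sub).exists_pos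
    have h2 := isBigO_coeff_of_norm_root_le (p := fun c : ℂ => P (s, c • v)) (θ := θ)
      (K := K + (2 * C * ‖v‖) ^ θ) (fun c => hP _) (fun i => AnalyticAt.comp
        (g := fun x => (P (s, x)).coeff i) (f := fun c : ℂ => c • v) (by simpa using hcs0 i) hlin)
      hθd hθ1 ?_ hj
    · simpa using h2
    filter_upwards [nhdsWithin_le_nhds hKb.bound, hsmall v, self_mem_nhdsWithin,
      nhdsWithin_le_nhds (Metric.ball_mem_nhds (0 : ℂ) one_pos)] with c h3 h4 h5 h6 z hz
    have h7 := hrootA _ (hcone v hv c h5) h4 z hz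
    rw [mem_ball_zero_iff] at h6
    simp only [zero_smul, hA0, sub_zero] at h3
    have h8 : ‖c‖ ≤ ‖c‖ ^ θ := by
      simpa using Real.rpow_le_rpow_of_exponent_ge (norm_pos_iff.2 h5) h6.le hθ1
    have h9 : (2 * C * ‖c • v‖) ^ θ = (2 * C * ‖v‖) ^ θ * ‖c‖ ^ θ := by
      rw [← Real.mul_rpow (by positivity) (norm_nonneg c), norm_smul]
      ring_nf
    have h10 : ‖z‖ ≤ ‖z - A (c • v)‖ + ‖A (c • v)‖ := by
      simpa using norm_add_le (z - A (c • v)) (A (c • v))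
    rw [h9] at h7
    have h11 : K * ‖c‖ ≤ K * ‖c‖ ^ θ := by gcongr
    linarith [add_mul K ((2 * C * ‖v‖) ^ θ) (‖c‖ ^ θ)]
  refine ⟨Polynomial.ext fun i => ?_, hbig⟩
  rw [coeff_X_pow]
  rcases lt_trichotomy i d with hi | rfl | hi
  · obtain ⟨K, hK⟩ := (hbig (d - i) (Nat.sub_le _ _)).bound
    have h1 := hK.self_of_nhds
    rw [if_neg hi.ne]
    simpa [Nat.sub_sub_self hi.le, show d - i ≠ 0 by omega] using h1
  · rw [if_pos rfl]
    have h1 := (hP (s, 0)).1.coeff_natDegree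
    rwa [(hP (s, 0)).2] at h1
  · rw [if_neg hi.ne', coeff_eq_zero_of_natDegree_lt (by rw [(hP _).2]; exact hi)]

end Equimultiplicity

/-! ### Tangent cones, multiplicities and the roots of the Weierstrass polynomial -/

section Weierstrass

variable {E : Type*} [NormedAddCommGroup E] [NormedSpace ℂ E]

theorem axisTransverse_iff {g : E × ℂ → ℂ} :
    AxisTransverse g ↔ ∃ C ≥ 0, ∀ᶠ q in 𝓝 (0 : E × ℂ), g q = 0 → ‖q.2‖ ≤ C * ‖q.1‖ := by
  constructor
  · intro h
    by_contra! hcon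
    refine h ?_
    have h1 : ∀ n : ℕ, ∃ q : E × ℂ, ‖q‖ < 1 / (n + 1) ∧ g q = 0 ∧ n * ‖q.1‖ < ‖q.2‖ := by
      intro n
      obtain ⟨q, hq, hb⟩ := ((hcon n (Nat.cast_nonneg n)).and_eventually
        (Metric.ball_mem_nhds (0 : E × ℂ) (Nat.one_div_pos_of_nat (n := n)))).exists
      exact ⟨q, by simpa using hb, hq⟩
    choose q hq hg hlt using h1
    -- rescaled by the inverses of their last coordinates, these points converge to `(0, 1)`
    have hne : ∀ n, (q n).2 ≠ 0 := fun n => norm_pos_iff.1 ((by positivity : (0 : ℝ) ≤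
      n * ‖(q n).1‖).trans_lt (hlt n))
    refine mem_tangentConeAt_of_seq atTop (fun n => ((q n).2)⁻¹) q ?_
      (Eventually.of_forall fun n => by simpa using hg n) ?_
    · exact squeeze_zero_norm (fun n => (hq n).le) tendsto_one_div_add_atTop_nhds_zero_nat
    · have h2 : (fun n => ((q n).2)⁻¹ • q n) = fun n => (((q n).2)⁻¹ • (q n).1, (1 : ℂ)) := by
        ext1 n
        refine Prod.ext rfl ?_
        simp [hne n]
      rw [h2]
      refine Tendsto.prodMk_nhds ?_ tendsto_const_nhds
      refine squeeze_zero_norm' (a := fun n : ℕ => 1 / (n : ℝ)) ?_ tendsto_one_div_atTop_nhds_zero_nat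
      filter_upwards [eventually_gt_atTop 0] with n hn
      have hn : (0 : ℝ) < n := by exact_mod_cast hn
      rw [norm_smul, norm_inv, inv_mul_le_iff₀ (norm_pos_iff.2 (hne n)), mul_one_div,
        le_div_iff₀ hn]
      linarith [hlt n]
  · rintro ⟨C, hC, h⟩ hmem
    obtain ⟨α, l, hl, c, q, hq, hg, hlim⟩ := exists_fun_of_mem_tangentConeAt hmem
    have h1 : ∀ᶠ n in l, ‖(c n • q n).2‖ ≤ C * ‖(c n • q n).1‖ := by
      filter_upwards [hq.eventually h, hg] with n h2 h3
      have h4 : g (q n) = 0 := by simpa using h3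
      rw [Prod.smul_snd, Prod.smul_fst, norm_smul, norm_smul]
      have := mul_le_mul_of_nonneg_left (h2 h4) (norm_nonneg (c n))
      linarith
    have h2 := le_of_tendsto_of_tendsto ((continuous_snd.tendsto _).comp hlim).norm
      (((continuous_fst.tendsto _).comp hlim).norm.const_mul C) h1
    norm_num at h2

/-- A function vanishing on the last axis would have that axis in its tangent cone. -/
theorem AxisTransverse.regularInLast {g : E × ℂ → ℂ} (h : AxisTransverse g)
    (hg : AnalyticAt ℂ g 0) : RegularInLast g := by
  refine ⟨hg, fun h0 => ?_⟩
  obtain ⟨C, -, hC⟩ := axisTransverse_iff.1 h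
  have h1 : Tendsto (fun z : ℂ => ((0, z) : E × ℂ)) (𝓝 0) (𝓝 0) :=
    (continuous_const.prodMk continuous_id).tendsto' _ _ rfl
  have h2 : ∀ᶠ z in 𝓝[≠] (0 : ℂ), False := by
    filter_upwards [nhdsWithin_le_nhds h0, nhdsWithin_le_nhds (h1.eventually hC),
      self_mem_nhdsWithin] with z h3 h4 h5
    have := h4 h3
    rw [norm_zero, mul_zero] at this
    exact h5 (norm_le_zero_iff.1 this)
  exact h2.exists.elim fun _ => id

theorem IsWeierstrassPoly.eventually_root_iff {g : E × ℂ → ℂ} {P : E → ℂ[X]}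
    (hP : IsWeierstrassPoly g P) : ∀ᶠ q in 𝓝 (0 : E × ℂ), g q = 0 ↔ (P q.1).IsRoot q.2 := by
  obtain ⟨d, hPd, hP0, hPc, u, hu, hu0, hgu⟩ := hP
  filter_upwards [hgu, hu.continuousAt.eventually_ne hu0] with q h1 h2
  rw [h1, IsRoot.def, mul_eq_zero, or_iff_right h2]

theorem IsWeierstrassPoly.regularInLast {g : E × ℂ → ℂ} {P : E → ℂ[X]}
    (hP : IsWeierstrassPoly g P) : RegularInLast g := by
  have hroot := hP.eventually_root_iff
  obtain ⟨d, hPd, hP0, hPc, u, hu, hu0, hgu⟩ := hP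
  refine ⟨(hu.mul (analyticAt_eval (fun w => (hPd w).2) hPc 0)).congr
    (by filter_upwards [hgu] with q hq using hq.symm), fun h0 => ?_⟩
  have h1 : Tendsto (fun z : ℂ => ((0, z) : E × ℂ)) (𝓝 0) (𝓝 0) :=
    (continuous_const.prodMk continuous_id).tendsto' _ _ rfl
  have h2 : ∀ᶠ z in 𝓝[≠] (0 : ℂ), False := by
    filter_upwards [nhdsWithin_le_nhds h0, nhdsWithin_le_nhds (h1.eventually hroot),
      self_mem_nhdsWithin] with z h3 h4 h5
    have h6 := h4.1 h3
    rw [hP0, IsRoot.def, eval_pow, eval_X] at h6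
    exact h5 (eq_zero_of_pow_eq_zero h6)
  exact h2.exists.elim fun _ => id

/-- Transversality of the last axis in terms of the roots of the Weierstrass polynomial. -/
theorem IsWeierstrassPoly.axisTransverse_iff {g : E × ℂ → ℂ} {P : E → ℂ[X]}
    (hP : IsWeierstrassPoly g P) : AxisTransverse g ↔
      ∃ C ≥ 0, ∀ᶠ w in 𝓝 (0 : E), ∀ z, (P w).IsRoot z → ‖z‖ ≤ C * ‖w‖ := by
  rw [ZariskiEq.axisTransverse_iff]
  have hroot := hP.eventually_root_iff
  obtain ⟨d, hPd, hP0, hPc, -⟩ := hP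
  constructor
  · rintro ⟨C, hC, h⟩
    refine ⟨C, hC, ?_⟩
    obtain ⟨ε, hε, H⟩ := Metric.eventually_nhds_iff_ball.1 (hroot.and h)
    filter_upwards [eventually_norm_root_lt hPd hP0 (fun i => (hPc i).continuousAt) hε,
      Metric.ball_mem_nhds (0 : E) hε] with w h1 h2 z hz
    have hmem : ((w, z) : E × ℂ) ∈ Metric.ball 0 ε := by
      rw [mem_ball_zero_iff, Prod.norm_def]
      exact max_lt (by simpa using h2) (h1 z hz)
    exact (H _ hmem).2 ((H _ hmem).1.2 hz)
  · rintro ⟨C, hC, h⟩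
    refine ⟨C, hC, ?_⟩
    filter_upwards [hroot, (continuous_fst.tendsto' (0 : E × ℂ) 0 rfl).eventually h] with q h1 h2 h3
    exact h2 _ (h1.1 h3)

omit [NormedSpace ℂ E] in
theorem exists_norm_root_le_of_isBigO {P : E → ℂ[X]} {d : ℕ}
    (hP : ∀ w, (P w).Monic ∧ (P w).natDegree = d)
    (hc : ∀ j ≤ d, (fun w => (P w).coeff (d - j)) =O[𝓝 0] fun w => ‖w‖ ^ j) :
    ∃ C ≥ 0, ∀ᶠ w in 𝓝 (0 : E), ∀ z, (P w).IsRoot z → ‖z‖ ≤ C * ‖w‖ := by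
  have h1 : ∀ i ∈ Finset.range d, ∀ᶠ M in atTop, ∀ᶠ w in 𝓝 (0 : E),
      ‖(P w).coeff i‖ ≤ M * ‖w‖ ^ (d - i) := by
    intro i hi
    have hi := (Finset.mem_range.1 hi).le
    obtain ⟨K, hK⟩ := (hc (d - i) (Nat.sub_le _ _)).bound
    rw [Nat.sub_sub_self hi] at hK
    filter_upwards [eventually_ge_atTop K] with M hM
    filter_upwards [hK] with w hw
    rw [norm_pow, norm_norm] at hw
    exact hw.trans (by gcongr)
  obtain ⟨M, hM, hM0⟩ := (((Finset.eventually_all _).2 h1).and (eventually_ge_atTop 0)).exists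
  refine ⟨1 + d * M, by positivity, ?_⟩
  filter_upwards [(Finset.eventually_all _).2 hM] with w hw z hz
  exact norm_root_le (hP w).1 (hP w).2 hM0 (norm_nonneg w)
    (fun i hi => hw i (Finset.mem_range.2 hi)) hz

/-- If the coefficients of the Weierstrass polynomial vanish to the orders prescribed by
homogeneity, its degree is the multiplicity. -/
theorem IsWeierstrassPoly.mult_eq {g : E × ℂ → ℂ} {P : E → ℂ[X]} {d : ℕ}
    (hP : IsWeierstrassPoly g P) (hd : (P 0).natDegree = d)
    (hc : ∀ j ≤ d, (fun w => (P w).coeff (d - j)) =O[𝓝 0] fun w => ‖w‖ ^ j) : mult g 0 = d := by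
  have hg := hP.regularInLast.1
  obtain ⟨d', hPd, hP0, hPc, u, hu, hu0, hgu⟩ := hP
  obtain rfl : d' = d := (hPd 0).2.symm.trans hd
  rw [mult_eq_coe_iff hg]
  simp only [zero_add]
  constructor
  · have h1 : (fun q : E × ℂ => (P q.1).eval q.2) =O[𝓝 0] fun q => ‖q‖ ^ d' := by
      have h2 : (fun q : E × ℂ => (P q.1).eval q.2) =
          fun q : E × ℂ => ∑ i ∈ Finset.range (d' + 1), (P q.1).coeff i * q.2 ^ i := by
        ext q
        rw [eval_eq_sum_range, (hPd _).2]
      rw [h2]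
      refine Asymptotics.IsBigO.fun_sum fun i hi => ?_
      have hi : i ≤ d' := Nat.lt_succ_iff.1 (Finset.mem_range.1 hi)
      have h3 := (hc (d' - i) (Nat.sub_le _ _)).comp_tendsto
        (continuous_fst.tendsto' (0 : E × ℂ) 0 rfl)
      rw [Nat.sub_sub_self hi] at h3
      have h4 : (fun q : E × ℂ => ‖q.1‖ ^ (d' - i)) =O[𝓝 0] fun q => ‖q‖ ^ (d' - i) :=
        (Asymptotics.IsBigO.of_norm_le fun q => by
          rw [norm_norm]; exact norm_fst_le q : (fun q : E × ℂ => ‖q.1‖) =O[𝓝 0] fun q => ‖q‖).pow _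
      have h5 : (fun q : E × ℂ => q.2 ^ i) =O[𝓝 0] fun q => ‖q‖ ^ i :=
        (Asymptotics.IsBigO.of_norm_le fun q => norm_snd_le q :
          (fun q : E × ℂ => q.2) =O[𝓝 0] fun q => ‖q‖).pow _
      refine ((h3.trans h4).mul h5).congr (fun _ => rfl) fun q => ?_
      rw [← pow_add, Nat.sub_add_cancel hi]
    have h6 : u =O[𝓝 0] fun _ => (1 : ℝ) := hu.continuousAt.isBigO_one ℝ
    exact (h6.mul h1).congr' (by filter_upwards [hgu] with q hq using hq.symm) (by simp)
  · intro h
    have h1 := IsBigO.line (g := g) (p := 0) (n := d' + 1) (by simpa using h) (0, 1)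
    have ht : Tendsto (fun c : ℂ => (0 : E × ℂ) + c • ((0, 1) : E × ℂ)) (𝓝 0) (𝓝 0) :=
      Continuous.tendsto' (by fun_prop) _ _ (by simp)
    obtain ⟨K, hK⟩ := h1.bound
    have h2 : ∀ᶠ c in 𝓝[≠] (0 : ℂ), ‖u ((0 : E × ℂ) + c • ((0, 1) : E × ℂ))‖ ≤ K * ‖c‖ := by
      filter_upwards [nhdsWithin_le_nhds hK, nhdsWithin_le_nhds (ht.eventually hgu),
        self_mem_nhdsWithin] with c h3 h4 h5
      have h6 : 0 < ‖c‖ := norm_pos_iff.2 h5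
      rw [h4, norm_mul] at h3
      simp only [zero_add, Prod.smul_mk, smul_zero, smul_eq_mul, mul_one, hP0, eval_pow, eval_X,
        norm_pow, norm_mul, pow_succ] at h3 ⊢
      refine le_of_mul_le_mul_right ?_ (pow_pos h6 d')
      linarith
    have h3 : Tendsto (fun c : ℂ => ‖u ((0 : E × ℂ) + c • ((0, 1) : E × ℂ))‖) (𝓝[≠] 0) (𝓝 ‖u 0‖) :=
      ((hu.continuousAt.tendsto.comp ht).norm).mono_left nhdsWithin_le_nhds
    have h4 : Tendsto (fun c : ℂ => K * ‖c‖) (𝓝[≠] 0) (𝓝 0) :=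
      ((by fun_prop : Continuous fun c : ℂ => K * ‖c‖).tendsto' 0 0 (by simp)).mono_left
        nhdsWithin_le_nhds
    exact hu0 (norm_le_zero_iff.1 (le_of_tendsto_of_tendsto h3 h4 h2))

/-- A power of a linear form times a unit has the expected multiplicity along the kernel of the form. -/
theorem mult_pow_mul {V : E → ℂ} {p : E} (hV : AnalyticAt ℂ V p) (hV0 : V p ≠ 0) {ℓ : E →L[ℂ] ℂ}
    (hℓ : ℓ ≠ 0) (hp : ℓ p = 0) (k : ℕ) : mult (fun w => ℓ w ^ k * V w) p = k := by
  have hg : AnalyticAt ℂ (fun w => ℓ w ^ k * V w) p := ((ℓ.analyticAt p).pow k).mul hV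
  have ht : Tendsto (fun y : E => p + y) (𝓝 0) (𝓝 p) :=
    Continuous.tendsto' (by fun_prop) _ _ (by simp)
  rw [mult_eq_coe_iff hg]
  simp only [map_add, hp, zero_add]
  constructor
  · have h1 : (fun y : E => ℓ y) =O[𝓝 0] fun y => ‖y‖ := (ℓ.isBigO_id _).norm_right
    have h2 : (fun y => V (p + y)) =O[𝓝 0] fun _ => (1 : ℝ) :=
      (hV.continuousAt.isBigO_one ℝ).comp_tendsto ht
    simpa using (h1.pow k).mul h2
  · intro h
    obtain ⟨v, hv⟩ : ∃ v, ℓ v ≠ 0 := by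
      by_contra! hcon
      exact hℓ (ContinuousLinearMap.ext hcon)
    have hline : Tendsto (fun c : ℂ => p + c • v) (𝓝 0) (𝓝 p) :=
      Continuous.tendsto' (by fun_prop) _ _ (by simp)
    have h1 := IsBigO.line (g := fun w => ℓ w ^ k * V w) (p := p) (n := k + 1)
      (by simpa [hp] using h) v
    obtain ⟨K, hK⟩ := h1.bound
    have h2 : ∀ᶠ c in 𝓝[≠] (0 : ℂ), ‖ℓ v‖ ^ k * ‖V (p + c • v)‖ ≤ K * ‖c‖ := by
      filter_upwards [nhdsWithin_le_nhds hK, self_mem_nhdsWithin] with c h3 h4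
      have h5 : 0 < ‖c‖ := norm_pos_iff.2 h4
      simp only [map_add, hp, zero_add, map_smul, smul_eq_mul, norm_mul, norm_pow, mul_pow,
        pow_succ] at h3
      refine le_of_mul_le_mul_right ?_ (pow_pos h5 k)
      linarith
    have h3 : Tendsto (fun c : ℂ => ‖ℓ v‖ ^ k * ‖V (p + c • v)‖) (𝓝[≠] 0)
        (𝓝 (‖ℓ v‖ ^ k * ‖V p‖)) :=
      (((hV.continuousAt.tendsto.comp hline).norm).mono_left nhdsWithin_le_nhds).const_mul _
    have h4 : Tendsto (fun c : ℂ => K * ‖c‖) (𝓝[≠] 0) (𝓝 0) :=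
      ((by fun_prop : Continuous fun c : ℂ => K * ‖c‖).tendsto' 0 0 (by simp)).mono_left
        nhdsWithin_le_nhds
    have h5 := le_of_tendsto_of_tendsto h3 h4 h2
    have h6 : 0 < ‖ℓ v‖ ^ k * ‖V p‖ :=
      mul_pos (pow_pos (norm_pos_iff.2 hv) k) (norm_pos_iff.2 hV0)
    linarith

/-- The generalized discriminants can be computed from any representative of the Weierstrass
polynomial. -/
theorem IsWeierstrassPoly.genDiscr_eventuallyEq {g : E × ℂ → ℂ} {P : E → ℂ[X]}
    (hP : IsWeierstrassPoly g P) (i : ℕ) : genDiscr i g =ᶠ[𝓝 0] fun w => polyDiscr (P w) i := by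
  filter_upwards [hP.weierstrassPoly_eventuallyEq] with w hw
  rw [genDiscr, hw]

theorem IsWeierstrassPoly.idiscr_eq {g : E × ℂ → ℂ} {P : E → ℂ[X]} (hP : IsWeierstrassPoly g P)
    {i₀ : ℕ} (hlt : ∀ i < i₀, ∀ᶠ w in 𝓝 (0 : E), polyDiscr (P w) i = 0)
    (hne : ∃ᶠ w in 𝓝 (0 : E), polyDiscr (P w) i₀ ≠ 0) :
    idiscr g = i₀ ∧ firstDiscr g =ᶠ[𝓝 0] fun w => polyDiscr (P w) i₀ := by
  have h1 : idiscr g = i₀ := by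
    refine le_antisymm (Nat.sInf_le fun h => hne ?_) (le_csInf ⟨i₀, fun h => hne ?_⟩ fun i hi => ?_)
    · filter_upwards [h, hP.genDiscr_eventuallyEq i₀] with w h1 h2 h3
      exact h3 (h2.symm.trans h1)
    · filter_upwards [h, hP.genDiscr_eventuallyEq i₀] with w h1 h2 h3
      exact h3 (h2.symm.trans h1)
    · by_contra! hlt'
      refine hi ?_
      filter_upwards [hlt i hlt', hP.genDiscr_eventuallyEq i] with w h1 h2
      rw [h2, h1]
  exact ⟨h1, by rw [firstDiscr, h1]; exact hP.genDiscr_eventuallyEq i₀⟩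

theorem polyDiscr_natDegree_add_one (p : ℂ[X]) : polyDiscr p (p.natDegree + 1) = 1 := by
  have h : p.roots.toList.length = p.natDegree := by
    rw [Multiset.length_toList]
    exact (IsAlgClosed.splits p).natDegree_eq_card_roots.symm
  simp [polyDiscr, rootDiscr, h]

/-- The generalized discriminant of index `idiscr g` is indeed not identically zero: the infimum
defining the index is over a nonempty set, since the last discriminant is `1`. -/
theorem IsWeierstrassPoly.polyDiscr_idiscr {g : E × ℂ → ℂ} {P : E → ℂ[X]}
    (hP : IsWeierstrassPoly g P) :
    (∀ i < idiscr g, ∀ᶠ w in 𝓝 (0 : E), polyDiscr (P w) i = 0) ∧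
      (∃ᶠ w in 𝓝 (0 : E), polyDiscr (P w) (idiscr g) ≠ 0) := by
  have hset : {i : ℕ | ¬ ∀ᶠ w in 𝓝 (0 : E), genDiscr i g w = 0} =
      {i : ℕ | ¬ ∀ᶠ w in 𝓝 (0 : E), polyDiscr (P w) i = 0} := by
    ext i
    refine not_congr (eventually_congr ?_)
    filter_upwards [hP.genDiscr_eventuallyEq i] with w hw
    rw [hw]
  rw [idiscr, hset]
  constructor
  · intro i hi
    by_contra hcon
    exact Nat.notMem_of_lt_sInf hi hcon
  · have hne : ({i : ℕ | ¬ ∀ᶠ w in 𝓝 (0 : E), polyDiscr (P w) i = 0}).Nonempty := by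
      obtain ⟨d, hPd, -⟩ := hP
      refine ⟨d + 1, fun h => ?_⟩
      obtain ⟨w, hw⟩ := h.exists
      rw [← (hPd w).2, polyDiscr_natDegree_add_one] at hw
      exact one_ne_zero hw
    exact not_eventually.1 (Nat.sInf_mem hne)

end Weierstrass

/-! ### Equisingular families of plane curves -/

section CurveFamily

variable {S : Type*} [NormedAddCommGroup S] [NormedSpace ℂ S]

/-- In an equisingular family of plane curves, the first nonvanishing generalized discriminant is
a power of `x` times a unit. -/
theorem IsEquisingularCurveFamily.exists_eq_pow_mul {D : (S × ℂ) × ℂ → ℂ}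
    (hD : IsEquisingularCurveFamily D) {W : S × ℂ → ℂ[X]} (hW : IsWeierstrassPoly D W) :
    ∃ (k : ℕ) (V : S × ℂ → ℂ), AnalyticAt ℂ V 0 ∧ V 0 ≠ 0 ∧
      ∀ᶠ w in 𝓝 (0 : S × ℂ), polyDiscr (W w) (idiscr D) = w.2 ^ k * V w := by
  obtain ⟨hlt, hne⟩ := hW.polyDiscr_idiscr
  have hfirst := (hW.idiscr_eq hlt hne).2
  have hroot := hW.eventually_root_iff
  obtain ⟨e, hWd, hW0, hWc, -⟩ := hW
  have hΦ : ∀ᶠ w in 𝓝 (0 : S × ℂ), AnalyticAt ℂ (fun w => polyDiscr (W w) (idiscr D)) w :=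
    (analyticAt_polyDiscr hWd hWc _).eventually_analyticAt
  rcases hD with hD | ⟨-, -, hmult⟩
  · -- the polynomial is constant, and so are its discriminants
    have he : e = 0 := by
      by_contra he
      refine hD (hroot.self_of_nhds.2 ?_)
      change (W 0).IsRoot 0
      simp [hW0, he]
    have hW1 : ∀ w, W w = 1 := fun w => (hWd w).1.natDegree_eq_zero.1 ((hWd w).2.trans he)
    refine ⟨0, fun _ => polyDiscr 1 (idiscr D), analyticAt_const, ?_, ?_⟩
    · obtain ⟨w, hw⟩ := hne.exists
      rwa [hW1] at hw
    · exact Eventually.of_forall fun w => by rw [hW1]; ring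
  set Φ : S × ℂ → ℂ := fun w => polyDiscr (W w) (idiscr D) with hΦdef
  have htop : mult Φ 0 ≠ ⊤ := fun h =>
    hne ((eventually_eq_zero_of_mult_eq_top hΦ.self_of_nhds h).mono fun w hw h => h hw)
  obtain ⟨k, hk⟩ := ENat.ne_top_iff_exists.1 htop
  have hslice : Tendsto (fun s : S => ((s, 0) : S × ℂ)) (𝓝 0) (𝓝 0) :=
    (continuous_id.prodMk continuous_const).tendsto' _ _ rfl
  have hO : ∀ᶠ s in 𝓝 (0 : S), (fun x : ℂ => Φ (s, x)) =O[𝓝 0] fun x => x ^ k := by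
    filter_upwards [hmult, hslice.eventually hfirst.eventually_nhds, hslice.eventually hΦ]
      with s h1 h2 h3
    rw [mult_congr h2, mult_congr (p := ((0, 0) : S × ℂ)) hfirst, ← Prod.zero_eq_mk, ← hk] at h1
    have h4 := IsBigO.line ((le_mult_iff h3).1 h1.ge) (0, 1)
    simpa using h4
  obtain ⟨V, hV, hVΦ⟩ := ZariskiEq.exists_eq_pow_mul hΦ.self_of_nhds hO
  -- if `V` vanished at `0`, the multiplicity at `0` would exceed `k`
  refine ⟨k, V, hV, fun hV0 => ?_, hVΦ⟩
  refine ((mult_eq_coe_iff hΦ.self_of_nhds).1 hk.symm).2 ?_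
  have h1 : V =O[𝓝 0] fun q => ‖q‖ := by
    simpa [hV0] using (hV.differentiableAt.isBigO_sub).norm_right
  have h2 : (fun q : S × ℂ => q.2) =O[𝓝 0] fun q => ‖q‖ :=
    Asymptotics.IsBigO.of_norm_le fun q => norm_snd_le q
  simp only [zero_add]
  refine ((h2.pow k).mul h1).congr' ?_ (by simp [pow_succ])
  filter_upwards [hVΦ] with q hq using hq.symm

/-- An equisingular family of plane curves whose central member is transverse to the `y`-axis is
equimultiple. -/
theorem IsEquisingularCurveFamily.eventually_isBigO_coeff {D : (S × ℂ) × ℂ → ℂ}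
    (hD : IsEquisingularCurveFamily D) {W : S × ℂ → ℂ[X]} (hW : IsWeierstrassPoly D W) {e : ℕ}
    (he : (W 0).natDegree = e)
    (h0 : ∃ C ≥ 0, ∀ᶠ x in 𝓝 (0 : ℂ), ∀ y, (W (0, x)).IsRoot y → ‖y‖ ≤ C * ‖x‖) :
    ∀ᶠ s in 𝓝 (0 : S), W (s, 0) = X ^ e ∧
      ∀ j ≤ e, (fun x => (W (s, x)).coeff (e - j)) =O[𝓝 0] fun x => ‖x‖ ^ j := by
  obtain ⟨k, V, hV, hV0, hVW⟩ := hD.exists_eq_pow_mul hW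
  obtain ⟨hlt, hne⟩ := hW.polyDiscr_idiscr
  have hroot := hW.eventually_root_iff
  obtain ⟨e', hWd, hW0, hWc, -⟩ := hW
  obtain rfl : e' = e := (hWd 0).2.symm.trans he
  obtain ⟨C, hC, h0⟩ := h0
  have hslice : Tendsto (fun s : S => (((s, 0), 0) : (S × ℂ) × ℂ)) (𝓝 0) (𝓝 0) :=
    Continuous.tendsto' (by fun_prop) _ _ rfl
  rcases eq_or_ne e' 0 with rfl | he0
  · have hW1 : ∀ w, W w = 1 := fun w => (hWd w).1.natDegree_eq_zero.1 (hWd w).2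
    refine Eventually.of_forall fun s => ⟨by simp [hW1], fun j hj => ?_⟩
    obtain rfl : j = 0 := by omega
    simpa [hW1] using Asymptotics.isBigO_refl (fun _ : ℂ => (1 : ℝ)) (𝓝 0)
  refine ZariskiEq.eventually_isBigO_coeff (m := e' + 1 - idiscr D) (O := {0}ᶜ) hWd hW0 hWc
    isOpen_compl_singleton ⟨1, one_ne_zero⟩ (fun v hv c hc => smul_ne_zero hc hv) ?_ hC h0 ?_
  · filter_upwards [eventually_card_roots hWd hlt, hVW, hV.continuousAt.eventually_ne hV0]
      with w h1 h2 h3 h4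
    exact h1 (by rw [h2]; exact mul_ne_zero (pow_ne_zero _ h4) h3)
  · have hD0 : D 0 = 0 := hroot.self_of_nhds.2 (by change (W 0).IsRoot 0; simp [hW0, he0])
    obtain ⟨-, h1, -⟩ := hD.resolve_left (by simpa using hD0)
    filter_upwards [h1, hslice.eventually hroot] with s h2 h3
    exact h3.1 h2

/-- The orders of the coefficients at `x = 0` give, by the Schwarz lemma on a disc of a fixed radius,
a cone containing the roots that does not depend on the parameter. -/
theorem exists_norm_root_le_uniform {W : S × ℂ → ℂ[X]} {e : ℕ}
    (hW : ∀ w, (W w).Monic ∧ (W w).natDegree = e) (hW0 : W 0 = X ^ e)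
    (hWc : ∀ i, AnalyticAt ℂ (fun w => (W w).coeff i) 0)
    (h : ∀ᶠ s in 𝓝 (0 : S), ∀ j ≤ e, (fun x => (W (s, x)).coeff (e - j)) =O[𝓝 0] fun x => ‖x‖ ^ j) :
    ∃ C ≥ 0, ∀ᶠ w in 𝓝 (0 : S × ℂ), ∀ y, (W w).IsRoot y → ‖y‖ ≤ C * ‖w.2‖ := by
  have hb : ∀ i ∈ Finset.range (e + 1), ∀ᶠ w in 𝓝 (0 : S × ℂ), ‖(W w).coeff i‖ ≤ 2 := by
    intro i _
    have h1 : ‖(W 0).coeff i‖ < 2 := by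
      rw [hW0, coeff_X_pow]; split_ifs <;> norm_num
    filter_upwards [(hWc i).continuousAt.norm.eventually (gt_mem_nhds h1)] with w hw
    exact le_of_lt hw
  obtain ⟨ρ, hρ, H⟩ := Metric.eventually_nhds_iff_ball.1
    (((Finset.eventually_all _).2 hb).and (eventually_analyticAt_coeff (fun w => (hW w).2) hWc))
  refine ⟨(1 + e * 2) * (1 / ρ), by positivity, ?_⟩
  filter_upwards [(continuous_fst.tendsto' (0 : S × ℂ) 0 rfl).eventually h,
    Metric.ball_mem_nhds 0 hρ] with w h1 hw y hy
  rw [mem_ball_zero_iff, Prod.norm_def] at hw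
  have hw1 := (le_max_left _ _).trans_lt hw
  have hw2 := (le_max_right _ _).trans_lt hw
  have hmem : ∀ x ∈ Metric.ball (0 : ℂ) ρ, ((w.1, x) : S × ℂ) ∈ Metric.ball 0 ρ := by
    intro x hx
    rw [mem_ball_zero_iff, Prod.norm_def]
    exact max_lt hw1 (by simpa using hx)
  have h2 := norm_root_le (hW w).1 (hW w).2 zero_le_two (R := ‖w.2‖ / ρ) (by positivity)
    (fun i hi => ?_) hy
  · refine h2.trans (le_of_eq ?_)
    ring
  have h3 := h1 (e - i) (Nat.sub_le _ _)
  rw [Nat.sub_sub_self hi.le] at h3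
  refine norm_le_of_isBigO_pow (φ := fun x => (W (w.1, x)).coeff i) (ρ := ρ) (fun x hx => ?_)
    (fun x hx => (H _ (hmem x hx)).1 i (Finset.mem_range.2 (by omega)))
    (h3.trans (Asymptotics.IsBigO.of_bound 1 (Eventually.of_forall fun x => by simp))) (by simpa using hw2)
  exact (AnalyticAt.comp (g := fun w => (W w).coeff i) (f := fun x : ℂ => (w.1, x))
    ((H _ (hmem x hx)).2 i) (analyticAt_const.prod analyticAt_id)).differentiableAt.differentiableWithinAt

end CurveFamily

/-! ### Families of surfaces -/

section Slices

variable {E : Type*} [NormedAddCommGroup E] [NormedSpace ℂ E]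

/-- The invariants of a function whose generalized discriminant is a power of a linear form times
a unit. -/
theorem IsWeierstrassPoly.mult_firstDiscr {G : E × ℂ → ℂ} {W : E → ℂ[X]}
    (hW : IsWeierstrassPoly G W) {i₀ k : ℕ} {ℓ : E →L[ℂ] ℂ} (hℓ : ℓ ≠ 0) {V : E → ℂ}
    (hV : AnalyticAt ℂ V 0) (hV0 : V 0 ≠ 0)
    (hlt : ∀ i < i₀, ∀ᶠ w in 𝓝 (0 : E), polyDiscr (W w) i = 0)
    (heq : ∀ᶠ w in 𝓝 (0 : E), polyDiscr (W w) i₀ = ℓ w ^ k * V w) :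
    idiscr G = i₀ ∧ ∀ᶠ p in 𝓝 (0 : E), ℓ p = 0 → mult (firstDiscr G) p = k := by
  have hg : AnalyticAt ℂ (fun w => ℓ w ^ k * V w) 0 := ((ℓ.analyticAt 0).pow k).mul hV
  obtain ⟨h1, h2⟩ := hW.idiscr_eq hlt (by
    intro h
    refine ((mult_eq_coe_iff hg).1 (mult_pow_mul hV hV0 hℓ (map_zero ℓ) k)).2 ?_
    simp only [zero_add]
    have h3 : (fun w => ℓ w ^ k * V w) =ᶠ[𝓝 0] fun _ => 0 := by
      filter_upwards [heq, h] with w h4 h5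
      rw [← h4]
      exact not_not.1 h5
    exact h3.trans_isBigO (Asymptotics.isBigO_zero _ _))
  refine ⟨h1, ?_⟩
  have h3 : firstDiscr G =ᶠ[𝓝 0] fun w => ℓ w ^ k * V w := h2.trans heq
  filter_upwards [h3.eventually_nhds, hV.eventually_analyticAt, hV.continuousAt.eventually_ne hV0]
    with p h4 h5 h6 h7
  rw [mult_congr h4, mult_pow_mul h5 h6 hℓ h7]

variable {T : Type*} [NormedAddCommGroup T] [NormedSpace ℂ T]

/-- While all the roots of `P` over the axis `x = y = 0` vanish, `P` restricts to the Weierstrass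
polynomials of the members of the family and of their shears. -/
theorem eventually_isWeierstrassPoly_surface {f : ((ℂ × ℂ) × ℂ) × T → ℂ}
    {P : ((ℂ × T) × ℂ) × ℂ → ℂ[X]} (hP : IsWeierstrassPoly (shearFamily f) P) :
    ∀ᶠ t in 𝓝 (0 : T), P (((0, t), 0), 0) = X ^ (P 0).natDegree →
      IsWeierstrassPoly (fun p => f (p, t)) (fun w : ℂ × ℂ => P (((0, t), w.1), w.2)) ∧
      IsWeierstrassPoly (shear fun p => f (p, t))
        (fun w : (ℂ × ℂ) × ℂ => P (((w.1.1, t), w.1.2), w.2)) := by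
  let L₁ : ℂ × ℂ →L[ℂ] ((ℂ × T) × ℂ) × ℂ :=
    ((0 : ℂ × ℂ →L[ℂ] ℂ × T).prod (.fst ℂ ℂ ℂ)).prod (.snd ℂ ℂ ℂ)
  let L₂ : (ℂ × ℂ) × ℂ →L[ℂ] ((ℂ × T) × ℂ) × ℂ :=
    (((((ContinuousLinearMap.fst ℂ ℂ ℂ).comp (.fst ℂ (ℂ × ℂ) ℂ)).prod 0).prod
      ((ContinuousLinearMap.snd ℂ ℂ ℂ).comp (.fst ℂ (ℂ × ℂ) ℂ))).prod (.snd ℂ (ℂ × ℂ) ℂ))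
  have ht : Tendsto (fun t : T => ((((0, t), 0), 0) : ((ℂ × T) × ℂ) × ℂ)) (𝓝 0) (𝓝 0) :=
    Continuous.tendsto' (by fun_prop) _ _ rfl
  filter_upwards [ht.eventually (hP.restrict L₁), ht.eventually (hP.restrict L₂)]
    with t h1 h2 h3
  refine ⟨by simpa [L₁, shearFamily] using h1 h3, ?_⟩
  change IsWeierstrassPoly (fun q : ((ℂ × ℂ) × ℂ) × ℂ =>
    f (((q.1.1.2, q.1.2 + q.1.1.1 * q.2), q.2), t)) _
  simpa [L₂, shearFamily] using h2 h3

/-- While all the roots of `W` over the axis `x = 0` vanish, `W` restricts to the Weierstrass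
polynomials of the discriminants of the members of the family and of their shears. -/
theorem eventually_isWeierstrassPoly_curve {D : ((ℂ × T) × ℂ) × ℂ → ℂ}
    {W : (ℂ × T) × ℂ → ℂ[X]} (hW : IsWeierstrassPoly D W) :
    ∀ᶠ t in 𝓝 (0 : T), W ((0, t), 0) = X ^ (W 0).natDegree →
      IsWeierstrassPoly (fun q : ℂ × ℂ => D (((0, t), q.1), q.2)) (fun x : ℂ => W ((0, t), x)) ∧
      IsWeierstrassPoly (fun q : (ℂ × ℂ) × ℂ => D (((q.1.1, t), q.1.2), q.2))
        (fun w : ℂ × ℂ => W ((w.1, t), w.2)) := by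
  let L₁ : ℂ →L[ℂ] (ℂ × T) × ℂ := (0 : ℂ →L[ℂ] ℂ × T).prod (.id ℂ ℂ)
  let L₂ : ℂ × ℂ →L[ℂ] (ℂ × T) × ℂ := (((ContinuousLinearMap.fst ℂ ℂ ℂ).prod 0).prod (.snd ℂ ℂ ℂ))
  have ht : Tendsto (fun t : T => (((0, t), 0) : (ℂ × T) × ℂ)) (𝓝 0) (𝓝 0) :=
    Continuous.tendsto' (by fun_prop) _ _ rfl
  filter_upwards [ht.eventually (hW.restrict L₁), ht.eventually (hW.restrict L₂)]
    with t h1 h2 h3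
  exact ⟨by simpa [L₁] using h1 h3, by simpa [L₂] using h2 h3⟩

theorem analyticAt_shearFamily {f : ((ℂ × ℂ) × ℂ) × T → ℂ} (hf : AnalyticAt ℂ f 0) :
    AnalyticAt ℂ (shearFamily f) 0 := by
  have h : ContDiff ℂ ⊤ fun p : (((ℂ × T) × ℂ) × ℂ) × ℂ =>
    (((p.1.1.2, p.1.2 + p.1.1.1.1 * p.2), p.2), p.1.1.1.2) := by fun_prop
  refine AnalyticAt.comp (g := f) (f := fun p : (((ℂ × T) × ℂ) × ℂ) × ℂ =>
    (((p.1.1.2, p.1.2 + p.1.1.1.1 * p.2), p.2), p.1.1.1.2)) ?_ h.contDiffAt.analyticAt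
  simpa [← Prod.zero_eq_mk] using hf

theorem regularInLast_shearFamily {f : ((ℂ × ℂ) × ℂ) × T → ℂ} (hf : AnalyticAt ℂ f 0)
    (h : AxisTransverse fun p => f (p, 0)) : RegularInLast (shearFamily f) := by
  have h1 := h.regularInLast (AnalyticAt.comp (g := f) (f := fun p : (ℂ × ℂ) × ℂ => (p, (0 : T)))
    hf (analyticAt_id.prod analyticAt_const))
  refine ⟨analyticAt_shearFamily hf, fun h0 => h1.2 ?_⟩
  filter_upwards [h0] with z hz
  simpa [shearFamily, Prod.zero_eq_mk] using hz

/-- The constancy of the multiplicities and the persistence of `ν`-transversality. The discriminant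
family is equimultiple by equisingularity, so its branches stay inside a cone around `y = 0`; in
the complementary cone the number of points of `V_t` over `(x, y)` is constant, so that the family
of surfaces is equimultiple as well. -/
theorem IsNuTransverseZariskiEquisingular.exists_invariants {f : ((ℂ × ℂ) × ℂ) × T → ℂ}
    (hV : IsNuTransverseZariskiEquisingular f) (hf : AnalyticAt ℂ f 0)
    (h0 : ∀ᶠ t in 𝓝 (0 : T), f (0, t) = 0) :
    ∃ d e i₀ k : ℕ, ∀ᶠ t in 𝓝 (0 : T), IsNuTransverse (fun p => f (p, t)) ∧
      multSeq (fun p => f (p, t)) = ((d : ℕ∞), (e : ℕ∞), i₀, (k : ℕ∞)) := by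
  obtain ⟨⟨hA1, hA2, -⟩, hE⟩ := hV
  obtain ⟨P, hP⟩ := exists_isWeierstrassPoly (regularInLast_shearFamily hf hA1)
  have hslice := eventually_isWeierstrassPoly_surface hP
  have hDP := hP.genDiscr_eventuallyEq 1
  obtain ⟨d, hPd, hP0, hPc, -⟩ := id hP
  have hDan : AnalyticAt ℂ (stdDiscr (shearFamily f)) 0 :=
    (analyticAt_polyDiscr hPd hPc 1).congr hDP.symm
  obtain ⟨W, hW⟩ : ∃ W, IsWeierstrassPoly (stdDiscr (shearFamily f)) W := by
    refine exists_isWeierstrassPoly ?_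
    rcases hE with h | ⟨h, -⟩
    · exact ⟨hDan, fun h1 => h h1.self_of_nhds⟩
    · exact h
  have hW' : IsWeierstrassPoly (fun w => polyDiscr (P w) 1) W := hW.congr hDP
  have hcurve := eventually_isWeierstrassPoly_curve hW'
  have hrootW := hW'.eventually_root_iff
  obtain ⟨e, hWd, hW0, hWc, -⟩ := id hW
  rw [(hPd 0).2] at hslice
  rw [(hWd 0).2] at hcurve
  -- the Weierstrass polynomials of a member of the family and of its discriminants
  have hstd : ∀ᶠ t in 𝓝 (0 : T), P (((0, t), 0), 0) = X ^ d → W ((0, t), 0) = X ^ e →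
      IsWeierstrassPoly (fun p => f (p, t)) (fun w : ℂ × ℂ => P (((0, t), w.1), w.2)) ∧
      IsWeierstrassPoly (stdDiscr fun p => f (p, t)) (fun x : ℂ => W ((0, t), x)) ∧
      IsWeierstrassPoly (stdDiscr (shear fun p => f (p, t)))
        (fun w : ℂ × ℂ => W ((w.1, t), w.2)) := by
    filter_upwards [hslice, hcurve] with t h1 h2 h3 h4
    exact ⟨(h1 h3).1, (h2 h4).1.congr ((h1 h3).1.genDiscr_eventuallyEq 1).symm,
      (h2 h4).2.congr ((h1 h3).2.genDiscr_eventuallyEq 1).symm⟩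
  obtain ⟨hf0, hD0, -⟩ := hstd.self_of_nhds hP0 hW0
  obtain ⟨C₁, hC₁, hb₁⟩ := hf0.axisTransverse_iff.1 hA1
  have hWcoeff := hE.eventually_isBigO_coeff hW (hWd 0).2 (hD0.axisTransverse_iff.1 hA2)
  obtain ⟨k, V, hV, hV0, hVW⟩ := hE.exists_eq_pow_mul hW
  have hlt := hW.polyDiscr_idiscr.1
  obtain ⟨C₂, hC₂, hb₂⟩ := exists_norm_root_le_uniform hWd hW0 hWc
    (hWcoeff.mono fun s hs => hs.2)
  have hassoc : Tendsto (fun q : (ℂ × T) × (ℂ × ℂ) =>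
      (((q.1, q.2.1), q.2.2) : ((ℂ × T) × ℂ) × ℂ)) (𝓝 0) (𝓝 0) :=
    Continuous.tendsto' (by fun_prop) _ _ rfl
  -- away from the cone that contains the roots of `W` the discriminant does not vanish
  have hPcoeff := eventually_isBigO_coeff (m := d) (O := {v : ℂ × ℂ | C₂ * ‖v.1‖ < ‖v.2‖})
    (P := fun q : (ℂ × T) × (ℂ × ℂ) => P ((q.1, q.2.1), q.2.2)) (fun q => hPd _) hP0
    (fun i => AnalyticAt.comp (g := fun w => (P w).coeff i)
      (f := fun q : (ℂ × T) × (ℂ × ℂ) => (((q.1, q.2.1), q.2.2) : ((ℂ × T) × ℂ) × ℂ))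
      (hPc i) (ContDiff.contDiffAt (n := ⊤) (by fun_prop)).analyticAt)
    (isOpen_lt (by fun_prop) (by fun_prop)) ⟨(0, 1), by simp⟩
    (fun v hv c hc => by
      have h1 : C₂ * ‖v.1‖ < ‖v.2‖ := hv
      have h2 := mul_lt_mul_of_pos_left h1 (norm_pos_iff.2 hc)
      change C₂ * ‖c • v.1‖ < ‖c • v.2‖
      rw [norm_smul, norm_smul]
      linarith) (by
      have h1 : Tendsto (fun q : (ℂ × T) × (ℂ × ℂ) => ((q.1, q.2.1) : (ℂ × T) × ℂ)) (𝓝 0) (𝓝 0) :=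
        Continuous.tendsto' (by fun_prop) _ _ rfl
      filter_upwards [h1.eventually hb₂, hassoc.eventually hrootW] with q h2 h3 h4
      have h5 : polyDiscr (P ((q.1, q.2.1), q.2.2)) 1 ≠ 0 := fun h =>
        absurd (h2 _ (h3.1 h)) (not_le.2 h4)
      rw [card_roots_of_polyDiscr_one_ne_zero (hPd _).1 h5, (hPd _).2]) hC₁ hb₁ (by
      have h1 : Tendsto (fun s : ℂ × T => (((s, 0), 0) : ((ℂ × T) × ℂ) × ℂ)) (𝓝 0) (𝓝 0) :=
        Continuous.tendsto' (by fun_prop) _ _ rfl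
      have h2 : Tendsto (fun s : ℂ × T => ((((s, 0), 0), 0) : (((ℂ × T) × ℂ) × ℂ) × ℂ)) (𝓝 0) (𝓝 0) :=
        Continuous.tendsto' (by fun_prop) _ _ rfl
      filter_upwards [h2.eventually hP.eventually_root_iff,
        (continuous_snd.tendsto' (0 : ℂ × T) 0 rfl).eventually h0] with s h3 h4
      exact h3.1 (by simpa [shearFamily, Prod.zero_eq_mk] using h4))
  have htS : Tendsto (fun t : T => ((0, t) : ℂ × T)) (𝓝 0) (𝓝 0) :=
    Continuous.tendsto' (by fun_prop) _ _ rfl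
  have htW : Tendsto (fun t : T => (((0, t), 0) : (ℂ × T) × ℂ)) (𝓝 0) (𝓝 0) :=
    Continuous.tendsto' (by fun_prop) _ _ rfl
  set i₀ := idiscr (stdDiscr (shearFamily f)) with hi₀
  have hlt' : ∀ᶠ w in 𝓝 (0 : (ℂ × T) × ℂ), ∀ i ∈ Finset.range i₀, polyDiscr (W w) i = 0 :=
    (Finset.eventually_all _).2 fun i hi => hlt i (Finset.mem_range.1 hi)
  refine ⟨d, e, i₀, k, ?_⟩
  filter_upwards [hstd, htS.eventually hPcoeff, htS.eventually hWcoeff,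
    htS.eventually hWcoeff.eventually_nhds, htW.eventually hlt'.eventually_nhds,
    htW.eventually hVW.eventually_nhds, htW.eventually hV.eventually_analyticAt,
    htW.eventually (hV.continuousAt.eventually_ne hV0)]
    with t h1 ⟨h3, h4⟩ ⟨h5, h6⟩ h7 h8 h9 h10 h11
  obtain ⟨hft, hDt, hDs⟩ := h1 h3 h5
  have hx : Tendsto (fun x : ℂ => (((0, t), x) : (ℂ × T) × ℂ)) (𝓝 0) (𝓝 ((0, t), 0)) :=
    Continuous.tendsto' (by fun_prop) _ _ rfl
  have hbx : Tendsto (fun w : ℂ × ℂ => (((w.1, t), w.2) : (ℂ × T) × ℂ)) (𝓝 0) (𝓝 ((0, t), 0)) :=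
    Continuous.tendsto' (by fun_prop) _ _ rfl
  obtain ⟨hi1, hm1⟩ := hDt.mult_firstDiscr (i₀ := i₀) (k := k) (ℓ := .id ℂ ℂ)
    (V := fun x : ℂ => V ((0, t), x))
    (fun h => one_ne_zero (α := ℂ) (by simpa using DFunLike.congr_fun h (1 : ℂ)))
    (AnalyticAt.comp (g := V) (f := fun x : ℂ => (((0, t), x) : (ℂ × T) × ℂ)) h10 (by fun_prop)) h11
    (fun i hi => (hx.eventually h8).mono fun x hx => hx i (Finset.mem_range.2 hi))
    (hx.eventually h9)
  obtain ⟨-, hm2⟩ := hDs.mult_firstDiscr (i₀ := i₀) (k := k) (ℓ := .snd ℂ ℂ ℂ)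
    (V := fun w : ℂ × ℂ => V ((w.1, t), w.2))
    (fun h => one_ne_zero (α := ℂ) (by simpa using DFunLike.congr_fun h ((0, 1) : ℂ × ℂ)))
    (AnalyticAt.comp (g := V) (f := fun w : ℂ × ℂ => (((w.1, t), w.2) : (ℂ × T) × ℂ)) h10
      (ContDiff.contDiffAt (n := ⊤) (by fun_prop)).analyticAt) h11
    (fun i hi => (hbx.eventually h8).mono fun x hx => hx i (Finset.mem_range.2 hi))
    (hbx.eventually h9)
  have hb0 : Tendsto (fun b : ℂ => ((b, 0) : ℂ × ℂ)) (𝓝 0) (𝓝 0) :=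
    Continuous.tendsto' (by fun_prop) _ _ rfl
  have hb00 : Tendsto (fun b : ℂ => (((b, 0), 0) : (ℂ × ℂ) × ℂ)) (𝓝 0) (𝓝 0) :=
    Continuous.tendsto' (by fun_prop) _ _ rfl
  have hbt : Tendsto (fun b : ℂ => ((b, t) : ℂ × T)) (𝓝 0) (𝓝 (0, t)) :=
    Continuous.tendsto' (by fun_prop) _ _ rfl
  refine ⟨⟨hft.axisTransverse_iff.2 (exists_norm_root_le_of_isBigO (fun w => hPd _) h4),
    hDt.axisTransverse_iff.2 (exists_norm_root_le_of_isBigO (fun w => hWd _) h6), ?_⟩, ?_⟩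
  · by_cases hne : stdDiscr (shear fun p => f (p, t)) 0 = 0
    swap
    · exact Or.inl hne
    have hroot := hDs.eventually_root_iff
    have he : e ≠ 0 := by
      rintro rfl
      have h12 : (W ((0, t), 0)).IsRoot 0 := hroot.self_of_nhds.1 hne
      simp [h5] at h12
    refine Or.inr ⟨hDs.regularInLast, ?_, ?_⟩
    · filter_upwards [hb00.eventually hroot, hbt.eventually h7] with b h12 h13
      refine h12.2 ?_
      simp [h13.1, he]
    · filter_upwards [hb0.eventually hm2] with b h12
      rw [h12 rfl]
      exact (hm2.self_of_nhds rfl).symm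
  · rw [multSeq, hi1, hm1.self_of_nhds rfl, hft.mult_eq (hPd _).2 h4, hDt.mult_eq (hWd _).2 h6]

end Slices

end ZariskiEq

theorem mainTheorem6 {l : ℕ} (f : ((ℂ × ℂ) × ℂ) × (Fin l → ℂ) → ℂ)
    (hf : AnalyticAt ℂ f 0)
    (h0 : ∀ᶠ t in 𝓝 (0 : Fin l → ℂ), f (0, t) = 0)
    (hred : ∀ᶠ t in 𝓝 (0 : Fin l → ℂ), ZariskiEq.IsReducedGerm (fun p => f (p, t)))
    (hV : ZariskiEq.IsNuTransverseZariskiEquisingular f) :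
    ∀ᶠ t in 𝓝 (0 : Fin l → ℂ),
      ZariskiEq.IsNuTransverse (fun p => f (p, t)) ∧
        ZariskiEq.multSeq (fun p => f (p, t)) = ZariskiEq.multSeq (fun p => f (p, 0)) := by
  obtain ⟨d, e, i₀, k, h⟩ := hV.exists_invariants hf h0
  have h1 := h.self_of_nhds.2
  filter_upwards [h] with t ht
  exact ⟨ht.1, ht.2.trans h1.symm⟩
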